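/- Let $R>0$ and let $\mathbf H_R^3=\{x\in\mathbb R^4: [x,x]=R^2,\ x_0>0\}$, where $[x,y]=x_0y_0-x_1y_1-x_2y_2-x_3y_3$, with geodesic polar coordinates $$x=R(\cosh r,\ \sinh r\cos\theta,\ \sinh r\sin\theta\cos\phi,\ \sinh r\sin\theta\sin\phi),\qquad r\ge0,\ \theta\in[0,\pi],\ \phi\in[0,2\pi).$$ Let $\mathcal H_R^3(x,x')=\frac{1}{4\pi R}\int_\rho^\infty\frac{ds}{\sinh^2 s}$, with $\rho=\cosh^{-1}([x,x']/R^2)$, be the fundamental solution of $-\Delta$ on $\mathbf H_R^3$, and put $\mathfrak h^3=4\pi R\,\mathcal H_R^3=\coth\rho-1$. For $m\in\mathbb Z$ let $\epsilon_m=2-\delta_m^0$ and let $${\sf H}_m^{1/2}(r,r',\theta,\theta')=\frac{\epsilon_m}{\pi}\int_0^\pi \mathfrak h^3\cos(m\psi)\,d\psi ,\qquad \psi=\phi-\phi',$$ be the azimuthal Fourier coefficients of $\mathfrak h^3$, where $\mathfrak h^3$ is evaluated at the points with coordinates $(r,\theta,\phi)$ and $(r',\theta',\phi')$ and depends on $\phi,\phi'$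 only through $\psi$. Let $m\in\mathbb Z$, $r,r'\in(0,\infty)$, $\theta,\theta'\in[0,\pi]$ with $(r,\theta)\ne(r',\theta')$; if $m=0$ and $r=r'$, assume also that $\theta,\theta'$ do not both lie in $\{0,\pi\}$. Then the integrand above is integrable on $[0,\pi]$ and, with $r_<=\min\{r,r'\}$ and $r_>=\max\{r,r'\}$, $${\sf H}_m^{1/2}(r,r',\theta,\theta')=\frac{-i\epsilon_m}{\sqrt{\sinh r\sinh r'}}\sum_{l=|m|}^\infty(-1)^l(2l+1)\frac{(l-m)!}{(l+m)!}P_l^m(\cos\theta)P_l^m(\cos\theta')\,P_{1/2}^{-(1/2+l)}(\cosh r_<)\,Q_{1/2}^{1/2+l}(\cosh r_>),$$ where the series converges as the limit of its partial sums. Here, on $[-1,1]$, $P_l^m(x)=(-1)^m(1-x^2)^{m/2}\frac{d^m}{dx^m}P_l(x)$ for $0\le m\le l$, with $P_l$ the Legendre polynomial, and $P_l^{-m}=(-1)^m\frac{(l-m)!}{(l+m)!}P_l^m$; and for $z>1$, $$P_\nu^\mu(z)=\frac1{\Gamma(1-\mu)}\Big(\frac{z+1}{z-1}\Big)^{\mu/2}{}_2F_1\Big(-\nu,\nu+1;1-\mu;\frac{1-z}2\Big),$$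 $$Q_\nu^\mu(z)=\frac{e^{i\pi\mu}\sqrt\pi\,\Gamma(\nu+\mu+1)(z^2-1)^{\mu/2}}{2^{\nu+1}\Gamma(\nu+\frac32)z^{\nu+\mu+1}}\,{}_2F_1\Big(\frac{\nu+\mu+2}2,\frac{\nu+\mu+1}2;\nu+\frac32;\frac1{z^2}\Big).$$ -/

import Mathlib

noncomputable section

namespace HypFourier

/-! ### The hyperboloid of radius `R` in four-dimensional Minkowski space -/

/-- The Minkowski bilinear form `[x, y] = x₀y₀ - x₁y₁ - x₂y₂ - x₃y₃`. -/
def minkowski (x y : Fin 4 → ℝ) : ℝ :=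
  x 0 * y 0 - x 1 * y 1 - x 2 * y 2 - x 3 * y 3

/-- The point with standard geodesic polar coordinates `(r, θ, φ)` on the hyperboloid
`[x, x] = R²`, `x₀ > 0`. -/
def geodesicPolar (R r θ φ : ℝ) : Fin 4 → ℝ :=
  ![R * Real.cosh r,
    R * Real.sinh r * Real.cos θ,
    R * Real.sinh r * Real.sin θ * Real.cos φ,
    R * Real.sinh r * Real.sin θ * Real.sin φ]

/-- The geodesic distance `d(x, x')` on the hyperboloid of radius `R`. -/
def hypDist (R : ℝ) (x x' : Fin 4 → ℝ) : ℝ :=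
  R * Real.arcosh (minkowski x x' / R ^ 2)

/-- `𝓘_d(ρ) = ∫_ρ^∞ dx / sinh^{d-1} x`. -/
def radialIntegral (d : ℕ) (ρ : ℝ) : ℝ :=
  ∫ x in Set.Ioi ρ, 1 / Real.sinh x ^ (d - 1)

/-- The fundamental solution `𝓗_R³` of `-Δ` on the three-dimensional hyperboloid of radius `R`:
`𝓗_R³(x, x') = Γ(3/2) / (2 π^{3/2} R) · 𝓘₃(d(x, x') / R)`. -/
def fundSol (R : ℝ) (x x' : Fin 4 → ℝ) : ℝ :=
  Real.Gamma (3 / 2) / (2 * Real.pi ^ (3 / 2 : ℝ) * R) * radialIntegral 3 (hypDist R x x' / R)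

/-- The unnormalized fundamental solution `𝔥³ = 4πR 𝓗_R³`. -/
def unnormFundSol (R : ℝ) (x x' : Fin 4 → ℝ) : ℝ :=
  4 * Real.pi * R * fundSol R x x'

/-! ### Azimuthal Fourier coefficients -/

/-- The Neumann factor `ε_m = 2 - δ_m^0`. -/
def neumannFactor (m : ℤ) : ℝ := if m = 0 then 1 else 2

/-- The integrand `𝔥³ cos(mψ)` of the `m`-th azimuthal Fourier coefficient; `𝔥³` depends on the
azimuthal angles `φ, φ'` only through `ψ = φ - φ'`. -/
def fourierIntegrand (R : ℝ) (m : ℤ) (r r' θ θ' ψ : ℝ) : ℝ :=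
  unnormFundSol R (geodesicPolar R r θ ψ) (geodesicPolar R r' θ' 0) * Real.cos (m * ψ)

/-- The azimuthal Fourier coefficient
`H_m^{1/2}(r, r', θ, θ') = (ε_m / π) ∫_0^π 𝔥³ cos(mψ) dψ`. -/
def azimuthalCoeff (R : ℝ) (m : ℤ) (r r' θ θ' : ℝ) : ℝ :=
  neumannFactor m / Real.pi * ∫ ψ in (0 : ℝ)..Real.pi, fourierIntegrand R m r r' θ θ' ψ

/-! ### Legendre functions -/

/-- The Gauss hypergeometric function `₂F₁(a, b; c; x)` for real `x < 1`: the power series for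
`0 ≤ x < 1`, and its analytic continuation to `x < 0` by Pfaff's transformation
`₂F₁(a, b; c; x) = (1 - x)^{-a} ₂F₁(a, c - b; c; x / (x - 1))`, where `0 < x / (x - 1) < 1`. -/
def gaussF (a b c x : ℝ) : ℝ :=
  if 0 ≤ x then ordinaryHypergeometric a b c x
  else (1 - x) ^ (-a) * ordinaryHypergeometric a (c - b) c (x / (x - 1))

/-- The associated Legendre function of the first kind `P_ν^μ(z)` for `z > 1`,
`P_ν^μ(z) = Γ(1-μ)⁻¹ ((z+1)/(z-1))^{μ/2} ₂F₁(-ν, ν+1; 1-μ; (1-z)/2)`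
(for `μ` not a positive integer). -/
def legendreFirst (ν μ z : ℝ) : ℝ :=
  1 / Real.Gamma (1 - μ) * ((z + 1) / (z - 1)) ^ (μ / 2) *
    gaussF (-ν) (ν + 1) (1 - μ) ((1 - z) / 2)

/-- The associated Legendre function of the second kind `Q_ν^μ(z)` for `z > 1`, with the usual
factor `e^{iπμ}`:
`Q_ν^μ(z) = e^{iπμ} √π Γ(ν+μ+1) (z²-1)^{μ/2} / (2^{ν+1} Γ(ν+3/2) z^{ν+μ+1})
  · ₂F₁((ν+μ+2)/2, (ν+μ+1)/2; ν+3/2; 1/z²)`. -/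
def legendreSecond (ν μ z : ℝ) : ℂ :=
  Complex.exp (Complex.I * Real.pi * μ) *
    ((Real.sqrt Real.pi * Real.Gamma (ν + μ + 1) * (z ^ 2 - 1) ^ (μ / 2) /
      (2 ^ (ν + 1) * Real.Gamma (ν + 3 / 2) * z ^ (ν + μ + 1)) *
      gaussF ((ν + μ + 2) / 2) ((ν + μ + 1) / 2) (ν + 3 / 2) (1 / z ^ 2) : ℝ) : ℂ)

/-- The Legendre polynomial `P_l = (2^l l!)⁻¹ (d/dx)^l (x² - 1)^l`. -/
def legendrePoly (l : ℕ) : Polynomial ℝ :=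
  Polynomial.C (1 / (2 ^ l * (l.factorial : ℝ))) *
    Polynomial.derivative^[l] ((Polynomial.X ^ 2 - 1) ^ l)

/-- `P_l^m(x) = (-1)^m (1 - x²)^{m/2} (d/dx)^m P_l(x)` on `[-1, 1]`, for `m ∈ ℕ₀`. -/
def ferrersNat (l m : ℕ) (x : ℝ) : ℝ :=
  (-1) ^ m * Real.sqrt (1 - x ^ 2) ^ m *
    (Polynomial.derivative^[m] (legendrePoly l)).eval x

/-- The associated Legendre (Ferrers) function `P_l^m` on `[-1, 1]` for `m ∈ ℤ`, `|m| ≤ l`; for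
negative order `P_l^{-k} = (-1)^k (l-k)!/(l+k)! P_l^k`. -/
def ferrers (l : ℕ) (m : ℤ) (x : ℝ) : ℝ :=
  if 0 ≤ m then ferrersNat l m.natAbs x
  else (-1) ^ m.natAbs * (((l - m.natAbs).factorial : ℝ) / ((l + m.natAbs).factorial : ℝ)) *
    ferrersNat l m.natAbs x

/-- The `l`-th term (`l ≥ |m|`) of the addition theorem:
`(-1)^l (2l+1) (l-m)!/(l+m)! P_l^m(cos θ) P_l^m(cos θ') P_{1/2}^{-(1/2+l)}(cosh r_<)
Q_{1/2}^{1/2+l}(cosh r_>)`. -/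
def additionTerm (m : ℤ) (r r' θ θ' : ℝ) (l : ℕ) : ℂ :=
  (((-1) ^ l * (2 * l + 1) *
      ((((l : ℤ) - m).toNat.factorial : ℝ) / (((l : ℤ) + m).toNat.factorial : ℝ)) *
      ferrers l m (Real.cos θ) * ferrers l m (Real.cos θ') *
      legendreFirst (1 / 2) (-(1 / 2 + l)) (Real.cosh (min r r')) : ℝ) : ℂ) *
    legendreSecond (1 / 2) (1 / 2 + l) (Real.cosh (max r r'))

end HypFourier

end

/-! Let `c = cosh r cosh r' - sinh r sinh r' cos γ` be the hyperbolic cosine of the distance, where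
`cos γ = cosAngle θ θ' ψ`. Then `𝔥³ = coth ρ - 1 = c / √(c² - 1) - 1`, and this equals `(1/π) ∫₀^π
cos φ / (c - cos φ) dφ` (`integral_cos_div_sub_cos`). The denominator is `sinh r sinh r' (Y(φ) - cos
γ)` with `Y = radialArg`, so Heine's expansion `1 / (Y - x) = ∑ (2l+1) P_l(x) Q_l(Y)` separates the
spherical angle from the radii. The coefficient of `(2l+1) P_l(cos γ)` is `radialCoeff`, the
integral of `cos φ Q_l(Y(φ)) / (π sinh r sinh r')` over `[0, π]`.

Angular part: the Fourier coefficients of `P_l(cos γ)` in `ψ` are products of Ferrers functions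
(`integral_legP_cosAngle_mul_cos`). Laplace's integral writes `P_l(cos γ)` as an average of `l`-th
powers of a component of a complex null vector, and such a component splits into two linear factors
in `e^{iψ}`.

Radial part: for `r₁ < r₂`, `Q_l(Y(φ))` is an integral over `s ∈ [-r₁, r₁]` in which `φ` enters only
through `s - iφ` (`shift_integral_eq_legQ`, proved by comparing three-term recurrences and initial
values). Against `e^{iφ}`, moving the contour removes `s` from the `φ`-integral at the price of a
factor `e^s`, so the double integral is a product `innerRadial * outerRadial`
(`integral_cos_mul_legQ`); equal radii follow by a limit. A binomial expansion identifies the outer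
factor with `Q_{1/2}^{1/2+l}`, and a contiguous relation identifies the inner one with
`P_{1/2}^{-(1/2+l)}`.

Convergence: the Christoffel–Darboux form of Heine's remainder bounds the error by `(N+1) ∫
Q_N(Y(φ)) dφ` times `|P_{N+1}| + |P_N|` (`abs_kernelAt_sub_sum_le`). For `r ≠ r'` the integral
decays geometrically. For `r = r'` the product with `N+1` only stays bounded, and the decay comes
from `∫ |P_N(cos γ)| dψ → 0`, which needs one of the points off the polar axis. If both are on the
axis then `m ≠ 0` and all the Fourier integrals vanish. -/

namespace HypFourier
open Polynomial Finset Real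

/-! ### Fourier coefficients of Laurent polynomials and coefficients of binomial products -/

lemma integral_exp_int_mul_I (n : ℤ) :
    ∫ t in (0 : ℝ)..2 * π, Complex.exp (n * t * Complex.I) = if n = 0 then (2 * π : ℂ) else 0 := by
  split_ifs with h
  · simp [h]
  · have hc : (n * Complex.I : ℂ) ≠ 0 := by simp [h]
    have := integral_exp_mul_complex (a := 0) (b := 2 * π) hc
    rw [← intervalIntegral.integral_congr (f := fun t : ℝ => Complex.exp (n * Complex.I * t))
      (fun t _ => by simp only []; congr 1; ring), this]
    have h2 : Complex.exp (n * Complex.I * ((2 * π : ℝ) : ℂ)) = 1 := by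
      rw [Complex.exp_eq_one_iff]; exact ⟨n, by push_cast; ring⟩
    rw [h2]; simp

/-- By orthogonality of exponentials only the monomial of degree `k` survives. All later Fourier
integrals in the angular part become extractions of polynomial coefficients. -/
lemma integral_eval_exp_mul_exp (p : ℂ[X]) (k : ℕ) :
    ∫ t in (0 : ℝ)..2 * π, p.eval (Complex.exp (t * Complex.I)) *
      Complex.exp (-(k * t * Complex.I)) = 2 * π * p.coeff k := by
  induction p using Polynomial.induction_on' with
  | add p q hp hq =>
    simp only [eval_add, add_mul, coeff_add, mul_add]
    rw [intervalIntegral.integral_add, hp, hq]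
    · exact Continuous.intervalIntegrable (by fun_prop) _ _
    · exact Continuous.intervalIntegrable (by fun_prop) _ _
  | monomial n a =>
    have h := integral_exp_int_mul_I ((n : ℤ) - k)
    rw [intervalIntegral.integral_congr (g := fun t : ℝ => a *
      Complex.exp ((((n : ℤ) - k : ℤ) : ℂ) * t * Complex.I)), intervalIntegral.integral_const_mul, h,
      coeff_monomial]
    · have : ((n : ℤ) - k = 0) ↔ n = k := by omega
      simp only [this]; split_ifs <;> ring
    · intro t _
      simp only [eval_monomial]
      rw [← Complex.exp_nat_mul, mul_assoc, ← Complex.exp_add]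
      congr 2; push_cast; ring

lemma coeff_linear_pow {R : Type*} [CommSemiring R] (p q : R) (n i : ℕ) :
    ((C q * X + C p) ^ n).coeff i = q ^ i * p ^ (n - i) * n.choose i := by
  rw [add_pow, finsetSum_coeff]
  simp_rw [mul_pow, ← C_pow]
  have : ∀ k, (C (q ^ k) * X ^ k * C (p ^ (n - k)) * ((n.choose k : ℕ) : R[X])).coeff i =
      if i = k then q ^ k * p ^ (n - k) * n.choose k else 0 := by
    intro k
    rw [show (C (q ^ k) * X ^ k * C (p ^ (n - k)) * ((n.choose k : ℕ) : R[X])) =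
      C (q ^ k * p ^ (n - k) * n.choose k) * X ^ k by
        simp only [C_mul, C_pow, map_natCast]; ring, coeff_C_mul_X_pow]
  simp_rw [this]
  rw [Finset.sum_ite_eq]
  split_ifs with h
  · rfl
  · rw [Nat.choose_eq_zero_of_lt (by simpa using h)]; simp

lemma coeff_linear_pow_mul_linear_pow {R : Type*} [CommSemiring R] (p q r t : R) (A B n : ℕ) :
    ((C q * X + C p) ^ A * (C r * X + C t) ^ B).coeff n = ∑ x ∈ antidiagonal n,
      (q ^ x.1 * p ^ (A - x.1) * A.choose x.1) * (r ^ x.2 * t ^ (B - x.2) * B.choose x.2) := by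
  rw [coeff_mul]; simp_rw [coeff_linear_pow]

/-- The `m`-th Fourier coefficient of `(cos θ + i sin θ cos t)^l`. -/
noncomputable def laplaceCoeff (l m : ℕ) (θ : ℝ) : ℂ :=
  ((C (Complex.I * Real.sin θ / 2) * X ^ 2 + C (Real.cos θ : ℂ) * X +
    C (Complex.I * Real.sin θ / 2)) ^ l).coeff (l + m)

/-- The quadratic has discriminant `cos² θ + sin² θ = 1`, hence splits into linear factors whose
coefficients are half-angle functions. -/
lemma laplaceCoeff_eq_coeff (l m : ℕ) (θ : ℝ) : laplaceCoeff l m θ =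
    ((C (Complex.I * Real.sin (θ / 2)) * X + C (Real.cos (θ / 2) : ℂ)) ^ l *
      (C (Real.cos (θ / 2) : ℂ) * X + C (Complex.I * Real.sin (θ / 2))) ^ l).coeff (l + m) := by
  rw [laplaceCoeff, ← mul_pow]
  congr 2
  have hs : (Real.sin θ : ℂ) = 2 * Real.sin (θ / 2) * Real.cos (θ / 2) := by
    rw [← Complex.ofReal_ofNat, ← Complex.ofReal_mul, ← Complex.ofReal_mul, ← Real.sin_two_mul]
    congr 2; ring
  have hc : (Real.cos θ : ℂ) = Real.cos (θ / 2) ^ 2 - Real.sin (θ / 2) ^ 2 := by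
    rw [← Complex.ofReal_pow, ← Complex.ofReal_pow, ← Complex.ofReal_sub, ← Real.cos_two_mul']
    congr 2; ring
  rw [show Complex.I * (Real.sin θ : ℂ) / 2 =
    (Complex.I * Real.sin (θ / 2)) * Real.cos (θ / 2) by rw [hs]; ring,
    show (Real.cos θ : ℂ) = Real.cos (θ / 2) * Real.cos (θ / 2) +
      (Complex.I * Real.sin (θ / 2)) * (Complex.I * Real.sin (θ / 2)) by
      rw [hc]; linear_combination (-(Real.sin (θ / 2) : ℂ) ^ 2) * Complex.I_sq]
  simp only [C_mul, C_add]; ring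

/-- Homogeneity: in a term with indices `i + j = l + m`, the factor `U` occurs `i + j` times and `V`
occurs `(l - i) + (l - j) = l - m` times. Terms with `i > l` or `j > l`, where the subtraction
truncates, have a zero binomial coefficient. -/
lemma coeff_linear_pow_scaled {R : Type*} [CommSemiring R] (p q r t U V : R) {l m : ℕ} (hm : m ≤ l) :
    ((C (q * U) * X + C (p * V)) ^ l * (C (r * U) * X + C (t * V)) ^ l).coeff (l + m) =
      ((C q * X + C p) ^ l * (C r * X + C t) ^ l).coeff (l + m) * (U ^ (l + m) * V ^ (l - m)) := by
  rw [coeff_linear_pow_mul_linear_pow, coeff_linear_pow_mul_linear_pow, Finset.sum_mul]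
  refine Finset.sum_congr rfl fun x hx => ?_
  obtain ⟨i, j⟩ := x
  simp only [HasAntidiagonal.mem_antidiagonal] at hx ⊢
  by_cases hi : i ≤ l
  · by_cases hj : j ≤ l
    · rw [← hx, show l - m = (l - i) + (l - j) by omega]
      simp only [mul_pow, pow_add]; ring
    · simp [Nat.choose_eq_zero_of_lt (not_le.mp hj)]
  · simp [Nat.choose_eq_zero_of_lt (not_le.mp hi)]

/-- The two expansions agree term by term up to factorials. This turns the coefficient left by the
second integration in the addition theorem into `laplaceCoeff` at the other angle, and produces the
weight `(l+m)! (l-m)! / l!²`. -/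
lemma coeff_linear_pow_neg {R : Type*} [CommRing R] (a b : R) {l m : ℕ} (hm : m ≤ l) :
    ((C (-b) * X + C a) ^ (l + m) * (C a * X + C (-b)) ^ (l - m)).coeff l * (l.factorial : R) ^ 2 =
      (-1) ^ m * ((l + m).factorial * (l - m).factorial : R) *
      ((C b * X + C a) ^ l * (C a * X + C b) ^ l).coeff (l + m) := by
  -- The sums have different lengths; indices above `l` contribute nothing on the right because
  -- `C(l, i) = 0`. Indices below `m` vanish on both sides.
  rw [coeff_linear_pow_mul_linear_pow, coeff_linear_pow_mul_linear_pow,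
    Nat.sum_antidiagonal_eq_sum_range_succ_mk, Nat.sum_antidiagonal_eq_sum_range_succ_mk,
    ← Finset.sum_subset (s₁ := range (l + 1)) (s₂ := range (l + m + 1)), Finset.sum_mul,
    Finset.mul_sum]
  · refine Finset.sum_congr rfl fun i hi => ?_
    have hi' : i ≤ l := by simpa [Nat.lt_succ_iff] using hi
    by_cases him : m ≤ i
    · obtain ⟨q, rfl⟩ := Nat.exists_eq_add_of_le him
      obtain ⟨p, rfl⟩ := Nat.exists_eq_add_of_le hi'
      simp only [show m + q + p - (m + q) = p by omega, show m + q + p + m - (m + q) = m + p by omega,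
        show m + q + p - m = p + q by omega, show p + q - p = q by omega,
        show m + q + p - (m + p) = q by omega]
      have h1 := Nat.add_choose_mul_factorial_mul_factorial (m + p) (m + q)
      have h2 := Nat.add_choose_mul_factorial_mul_factorial q p
      have h3 := Nat.add_choose_mul_factorial_mul_factorial p (m + q)
      have h4 := Nat.add_choose_mul_factorial_mul_factorial q (m + p)
      rw [show q + (m + p) = m + q + p by ring] at h4
      rw [show p + (m + q) = m + q + p by ring] at h3
      rw [show q + p = p + q by ring] at h2
      rw [show m + p + (m + q) = m + q + p + m by ring] at h1
      -- With `i = m + q` and `l = m + q + p`, both sides are `(l+m)! (l-m)! l!²` divided by `(m+q)!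
      -- (m+p)! p! q!`.
      have key : (m + q + p + m).choose (m + q) * (p + q).choose p * (m + q + p).factorial ^ 2 =
          (m + q + p + m).factorial * (p + q).factorial *
            ((m + q + p).choose (m + q) * (m + q + p).choose (m + p)) := by
        rw [← h1, ← h2, sq]; nth_rewrite 1 [← h3]; rw [← h4]; ring
      have key' := congrArg (Nat.cast : ℕ → R) key
      push_cast at key'
      have hs : (-b) ^ (m + q) * (-b) ^ q = (-1) ^ m * (b ^ (m + q) * b ^ q) := by
        rw [neg_pow b (m + q), neg_pow b q, pow_add (-1 : R) m q]
        have : ((-1 : R) ^ q) * (-1) ^ q = 1 := by rw [← mul_pow]; simp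
        linear_combination ((-1) ^ m * b ^ (m + q) * b ^ q) * this
      linear_combination (b ^ (m + q) * b ^ q * a ^ (m + p) * a ^ p * (-1) ^ m) * key' +
        (a ^ (m + p) * a ^ p * ((m + q + p + m).choose (m + q) * (p + q).choose p *
          ((m + q + p).factorial : R) ^ 2)) * hs
    · rw [Nat.choose_eq_zero_of_lt (show l - m < l - i by omega),
        Nat.choose_eq_zero_of_lt (show l < l + m - i by omega)]
      simp
  · intro i hi; simp only [mem_range] at hi ⊢; omega
  · intro i _ hi
    rw [Nat.choose_eq_zero_of_lt (show l < i by simpa using hi)]; simp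

end HypFourier

namespace HypFourier
open Polynomial Finset Real

/-! ### Legendre polynomials and Laplace's integral -/

/-- The value of the Legendre polynomial `P_l` at `x`. -/
noncomputable def legP (l : ℕ) (x : ℝ) : ℝ := (legendrePoly l).eval x

/-- By Rodrigues' formula this is a derivative of order `l + m` of `(X² - 1)^l`, that is, `(l + m)!`
times a coefficient of its Taylor expansion at `x`. -/
lemma eval_iterate_derivative_legendrePoly (l m : ℕ) (x : ℝ) :
    (derivative^[m] (legendrePoly l)).eval x = ((l + m).factorial : ℝ) / (2 ^ l * l.factorial) *
      ((X ^ 2 + C (2 * x) * X + C (x ^ 2 - 1)) ^ l).coeff (l + m) := by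
  have h1 : taylor x ((X ^ 2 - 1) ^ l) = (X ^ 2 + C (2 * x) * X + C (x ^ 2 - 1)) ^ l := by
    rw [taylor_apply, pow_comp]
    congr 1
    simp only [sub_comp, pow_comp, X_comp, one_comp, C_mul, C_sub, C_pow, C_1, C_ofNat]
    ring
  rw [legendrePoly, iterate_derivative_C_mul, ← Function.iterate_add_apply, eval_mul, eval_C, ← h1,
    taylor_coeff, ← factorial_smul_hasseDeriv, add_comm m l]
  rw [LinearMap.smul_apply, eval_smul, nsmul_eq_mul]
  ring

/-- Substituting `i sin θ · X` for `X` turns `X² + 2 cos θ X - sin² θ` into `2 i sin θ` times the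
quadratic of `laplaceCoeff`. -/
lemma coeff_quadratic_eq_laplaceCoeff (l m : ℕ) (θ : ℝ) :
    (Complex.I * Real.sin θ) ^ m * ((((X ^ 2 + C (2 * Real.cos θ) * X +
      C (Real.cos θ ^ 2 - 1)) ^ l).coeff (l + m) : ℝ) : ℂ) = 2 ^ l * laplaceCoeff l m θ := by
  set x := Real.cos θ with hx
  set s := Real.sin θ with hs
  have hxs : (x : ℂ) ^ 2 - 1 = - (s : ℂ) ^ 2 := by
    have : x ^ 2 - 1 = - s ^ 2 := by rw [hx, hs]; nlinarith [Real.sin_sq_add_cos_sq θ]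
    exact_mod_cast this
  have hc : ((((X ^ 2 + C (2 * x) * X + C (x ^ 2 - 1)) ^ l).coeff (l + m) : ℝ) : ℂ) =
      ((X ^ 2 + C (2 * x : ℂ) * X + C ((x : ℂ) ^ 2 - 1)) ^ l).coeff (l + m) := by
    have := coeff_map (Complex.ofRealHom) (p := (X ^ 2 + C (2 * x) * X + C (x ^ 2 - 1)) ^ l) (l + m)
    rw [Complex.ofRealHom_eq_coe] at this
    rw [← this]; simp
  rw [hc, hxs, laplaceCoeff, ← hx, ← hs]
  -- The substitution is invertible only for `sin θ ≠ 0`. On the axis both sides are computed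
  -- directly, and they vanish unless `m = 0`.
  by_cases h0 : s = 0
  · rw [h0]
    have e1 : (X ^ 2 + C (2 * x : ℂ) * X + C (-((0 : ℝ) : ℂ) ^ 2)) ^ l =
        X ^ l * (X + C (2 * x : ℂ)) ^ l := by rw [← mul_pow]; congr 1; simp; ring
    have e2 : (C (Complex.I * ((0 : ℝ) : ℂ) / 2) * X ^ 2 + C (x : ℂ) * X +
        C (Complex.I * ((0 : ℝ) : ℂ) / 2)) ^ l = C ((x : ℂ) ^ l) * X ^ l := by
      rw [C_pow, ← mul_pow]; congr 1; simp
    rw [e1, e2, add_comm l m, coeff_X_pow_mul, coeff_C_mul_X_pow, coeff_X_add_C_pow]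
    rcases Nat.eq_zero_or_pos m with rfl | hm
    · simp [mul_pow]
    · simp [hm.ne']
  · have hσ : (Complex.I * s : ℂ) ≠ 0 := by simp [h0]
    have hcomp : ((X ^ 2 + C (2 * x : ℂ) * X + C (-(s : ℂ) ^ 2)) ^ l).comp (C (Complex.I * s) * X) =
        C ((2 * (Complex.I * s)) ^ l) * (C (Complex.I * s / 2) * X ^ 2 + C (x : ℂ) * X +
          C (Complex.I * s / 2)) ^ l := by
      rw [pow_comp, C_pow, ← mul_pow]
      congr 1
      have hi : (-(s : ℂ) ^ 2) = 2 * (Complex.I * s) * (Complex.I * s / 2) := by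
        linear_combination -(s : ℂ) ^ 2 * Complex.I_sq
      have hi2 : (Complex.I * s) ^ 2 = 2 * (Complex.I * s) * (Complex.I * s / 2) := by ring
      simp only [add_comp, mul_comp, pow_comp, X_comp, C_comp]
      rw [hi, mul_pow, ← C_pow, hi2]
      simp only [C_mul]; ring
    have h2 := congrArg (fun p => coeff p (l + m)) hcomp
    simp only [comp_C_mul_X_coeff, coeff_C_mul] at h2
    have : (Complex.I * s : ℂ) ^ l ≠ 0 := pow_ne_zero _ hσ
    apply mul_left_cancel₀ this
    rw [pow_add, mul_pow 2] at h2
    linear_combination h2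

lemma legP_cos_eq_laplaceCoeff (l : ℕ) (θ : ℝ) :
    (legP l (Real.cos θ) : ℂ) = laplaceCoeff l 0 θ := by
  have h := coeff_quadratic_eq_laplaceCoeff l 0 θ
  have h2 := eval_iterate_derivative_legendrePoly l 0 (Real.cos θ)
  simp only [Function.iterate_zero, id, add_zero] at h2
  rw [legP, h2]
  simp only [pow_zero, one_mul, add_zero] at h
  push_cast
  rw [h]
  have : (l.factorial : ℂ) ≠ 0 := by exact_mod_cast l.factorial_ne_zero
  field_simp

lemma ferrersNat_cos (l m : ℕ) {θ : ℝ} (hθ : 0 ≤ Real.sin θ) :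
    (ferrersNat l m (Real.cos θ) : ℂ) =
      Complex.I ^ m * (((l + m).factorial : ℂ) / l.factorial) * laplaceCoeff l m θ := by
  have h := coeff_quadratic_eq_laplaceCoeff l m θ
  have hs : √(1 - Real.cos θ ^ 2) = Real.sin θ := by
    rw [← Real.sin_sq, Real.sqrt_sq hθ]
  rw [ferrersNat, eval_iterate_derivative_legendrePoly, hs]
  push_cast
  rw [mul_pow] at h
  have hI : (-1 : ℂ) ^ m = Complex.I ^ m * Complex.I ^ m := by
    rw [← mul_pow, Complex.I_mul_I]
  have h2 : (2 : ℂ) ^ l ≠ 0 := by simp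
  have : (l.factorial : ℂ) ≠ 0 := by exact_mod_cast l.factorial_ne_zero
  rw [hI, ← Complex.ofReal_sin]
  field_simp
  linear_combination ((l + m).factorial : ℂ) * h

lemma exp_quadratic (θ t : ℝ) :
    (C (Complex.I * Real.sin θ / 2) * X ^ 2 + C (Real.cos θ : ℂ) * X +
      C (Complex.I * Real.sin θ / 2)).eval (Complex.exp (t * Complex.I)) =
      Complex.exp (t * Complex.I) * (Real.cos θ + Complex.I * Real.sin θ * Real.cos t) := by
  have hc : (Real.cos t : ℂ) = (Complex.exp (t * Complex.I) + Complex.exp (-(t * Complex.I))) / 2 := by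
    rw [Complex.ofReal_cos, Complex.cos]; simp
  have he : Complex.exp (t * Complex.I) * Complex.exp (-(t * Complex.I)) = 1 := by
    rw [← Complex.exp_add]; simp
  simp only [eval_add, eval_mul, eval_C, eval_pow, eval_X]
  rw [hc]
  linear_combination (-(Complex.I * Real.sin θ / 2)) * he

/-- Laplace's first integral for the Legendre polynomials. -/
lemma integral_laplace (l : ℕ) (θ : ℝ) :
    ∫ t in (0 : ℝ)..2 * π, ((Real.cos θ : ℂ) + Complex.I * Real.sin θ * Real.cos t) ^ l =
      2 * π * legP l (Real.cos θ) := by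
  rw [legP_cos_eq_laplaceCoeff, laplaceCoeff, ← integral_eval_exp_mul_exp]
  refine intervalIntegral.integral_congr fun t _ => ?_
  simp only [eval_pow, exp_quadratic, mul_pow, add_zero]
  have h : Complex.exp (t * Complex.I) ^ l * Complex.exp (-(l * t * Complex.I)) = 1 := by
    rw [← Complex.exp_nat_mul, ← Complex.exp_add, mul_assoc]; simp
  linear_combination (-((Real.cos θ : ℂ) + Complex.I * Real.sin θ * Real.cos t) ^ l) * h

/-- Laplace's integrand has base of modulus at most one, strictly less unless `sin θ sin t = 0`.
This gives both `|P_l| ≤ 1` and the decay of `P_l` inside the interval. -/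
lemma norm_sq_laplace (θ t : ℝ) : ‖(Real.cos θ : ℂ) + Complex.I * Real.sin θ * Real.cos t‖ ^ 2 =
    1 - (Real.sin θ * Real.sin t) ^ 2 := by
  rw [show (Real.cos θ : ℂ) + Complex.I * Real.sin θ * Real.cos t =
    ((Real.cos θ : ℝ) : ℂ) + ((Real.sin θ * Real.cos t : ℝ) : ℂ) * Complex.I by push_cast; ring,
    Complex.sq_norm, Complex.normSq_add_mul_I]
  linear_combination Real.sin_sq_add_cos_sq θ + Real.sin θ ^ 2 * Real.sin_sq_add_cos_sq t

lemma norm_laplace_le_one (θ t : ℝ) :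
    ‖(Real.cos θ : ℂ) + Complex.I * Real.sin θ * Real.cos t‖ ≤ 1 := by
  rw [← sq_le_one_iff₀ (norm_nonneg _), norm_sq_laplace]
  nlinarith [sq_nonneg (Real.sin θ * Real.sin t)]

lemma abs_legP_cos_le_one (l : ℕ) (θ : ℝ) : |legP l (Real.cos θ)| ≤ 1 := by
  have h := intervalIntegral.norm_integral_le_of_norm_le_const (a := 0) (b := 2 * π) (C := 1)
    (f := fun t : ℝ => ((Real.cos θ : ℂ) + Complex.I * Real.sin θ * Real.cos t) ^ l)
    (fun t _ => by rw [norm_pow]; exact pow_le_one₀ (norm_nonneg _) (norm_laplace_le_one θ t))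
  rw [integral_laplace] at h
  have hp := Real.pi_pos
  rw [norm_mul, norm_mul, Complex.norm_real, Complex.norm_real, Complex.norm_ofNat,
    Real.norm_eq_abs, Real.norm_eq_abs, abs_of_pos hp, sub_zero, one_mul,
    abs_of_pos (by positivity : (0 : ℝ) < 2 * π)] at h
  exact le_of_mul_le_mul_left (by linarith) (by positivity : (0 : ℝ) < 2 * π)

lemma abs_legP_le_one (l : ℕ) {x : ℝ} (hx : x ∈ Set.Icc (-1 : ℝ) 1) : |legP l x| ≤ 1 := by
  rw [← Real.cos_arccos hx.1 hx.2]; exact abs_legP_cos_le_one _ _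

lemma tendsto_legP_cos {θ : ℝ} (hθ : Real.sin θ ≠ 0) :
    Filter.Tendsto (fun l => legP l (Real.cos θ)) Filter.atTop (nhds 0) := by
  have h : Filter.Tendsto (fun l : ℕ => ∫ t in (0 : ℝ)..2 * π,
      ((Real.cos θ : ℂ) + Complex.I * Real.sin θ * Real.cos t) ^ l) Filter.atTop
      (nhds (∫ t in (0 : ℝ)..2 * π, (0 : ℂ))) := by
    refine intervalIntegral.tendsto_integral_filter_of_dominated_convergence (fun _ => 1) ?_ ?_ ?_ ?_
    · exact Filter.Eventually.of_forall fun l => Continuous.aestronglyMeasurable (by fun_prop)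
    · exact Filter.Eventually.of_forall fun l => Filter.Eventually.of_forall fun t _ => by
        rw [norm_pow]; exact pow_le_one₀ (norm_nonneg _) (norm_laplace_le_one θ t)
    · exact intervalIntegrable_const
    -- On `(0, 2π]` the zeros of `sin t` are `π` and `2π`; elsewhere the powers tend to zero.
    · have hfin : ({π, 2 * π} : Set ℝ).Countable := (Set.toFinite _).countable
      filter_upwards [hfin.ae_notMem MeasureTheory.volume] with t ht hmem
      rw [Set.uIoc_of_le (by positivity)] at hmem
      simp only [Set.mem_insert_iff, Set.mem_singleton_iff, not_or] at ht
      apply tendsto_pow_atTop_nhds_zero_of_norm_lt_one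
      rw [← sq_lt_one_iff₀ (norm_nonneg _), norm_sq_laplace]
      have : Real.sin t ≠ 0 := by
        intro h0
        rcases lt_or_gt_of_ne ht.1 with h | h
        · exact absurd h0 (Real.sin_pos_of_pos_of_lt_pi hmem.1 h).ne'
        · have h3 := Real.sin_pos_of_pos_of_lt_pi (x := t - π) (by linarith)
            (by have := lt_of_le_of_ne hmem.2 ht.2; linarith)
          rw [Real.sin_sub_pi] at h3; linarith
      have := mul_ne_zero hθ this
      have := sq_pos_of_ne_zero this
      linarith
  simp_rw [integral_laplace] at h
  have h2 := h.norm
  simp only [norm_mul, Complex.norm_real, Complex.norm_ofNat, intervalIntegral.integral_zero,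
    norm_zero] at h2
  rw [tendsto_zero_iff_norm_tendsto_zero]
  have h3 := h2.const_mul ((2 * ‖π‖)⁻¹)
  rw [mul_zero] at h3
  refine h3.congr fun l => ?_
  have : ‖π‖ ≠ 0 := by simp [Real.pi_ne_zero]
  field_simp

/-- Bonnet's recurrence on `[-1, 1]`. -/
lemma legP_cos_recurrence (l : ℕ) (θ : ℝ) :
    (l + 2) * legP (l + 2) (Real.cos θ) - (2 * l + 3) * Real.cos θ * legP (l + 1) (Real.cos θ) +
      (l + 1) * legP l (Real.cos θ) = 0 := by
  set σ : ℂ := Complex.I * Real.sin θ with hσ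
  have hx2 : (Real.cos θ : ℂ) ^ 2 = 1 + σ ^ 2 := by
    have : (Real.cos θ : ℂ) ^ 2 = 1 - (Real.sin θ : ℂ) ^ 2 := by
      have := Real.cos_sq' θ; exact_mod_cast this
    rw [this, hσ, mul_pow, Complex.I_sq]; ring
  set w : ℝ → ℂ := fun t => (Real.cos θ : ℂ) + σ * Real.cos t with hw
  -- The recurrence combination of the integrands is an exact derivative, and its primitive vanishes
  -- at `0` and `2π` because of the factor `sin t`.
  have hderiv : ∀ t : ℝ, HasDerivAt (fun t : ℝ => σ * Real.sin t * w t ^ (l + 1))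
      ((l + 2) * w t ^ (l + 2) - (2 * l + 3) * Real.cos θ * w t ^ (l + 1) +
        (l + 1) * w t ^ l) t := by
    intro t
    have hs : HasDerivAt (fun t : ℝ => ((Real.sin t : ℝ) : ℂ)) (Real.cos t : ℂ) t :=
      (Real.hasDerivAt_sin t).ofReal_comp
    have hc : HasDerivAt (fun t : ℝ => ((Real.cos t : ℝ) : ℂ)) ((-Real.sin t : ℝ) : ℂ) t :=
      (Real.hasDerivAt_cos t).ofReal_comp
    have hw' : HasDerivAt w (σ * ((-Real.sin t : ℝ) : ℂ)) t := (hc.const_mul σ).const_add _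
    have := (hs.const_mul σ).mul (hw'.pow (l + 1))
    convert! this using 1
    have hst : (Real.sin t : ℂ) ^ 2 = 1 - (Real.cos t : ℂ) ^ 2 := by
      have := Real.sin_sq t; exact_mod_cast this
    simp only [add_tsub_cancel_right, Pi.pow_apply]
    have hwt : w t = Real.cos θ + σ * Real.cos t := rfl
    rw [pow_succ (w t) (l + 1), pow_succ (w t) l]
    push_cast at hst hx2 ⊢
    rw [Complex.ofReal_cos, Complex.ofReal_cos] at hwt
    linear_combination (-(l + 1) * w t ^ l) * hx2 + ((l + 1) * w t ^ l * σ ^ 2) * hst +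
      w t ^ l * (w t + (l + 1) * (w t + σ * Complex.cos t - Complex.cos θ)) * hwt
  have hint := intervalIntegral.integral_eq_sub_of_hasDerivAt (a := 0) (b := 2 * π)
    (fun t _ => hderiv t) (Continuous.intervalIntegrable (by fun_prop) _ _)
  simp only [Real.sin_zero, Real.sin_two_pi, Complex.ofReal_zero, mul_zero, zero_mul, sub_zero]
    at hint
  rw [intervalIntegral.integral_add (Continuous.intervalIntegrable (by fun_prop) _ _)
    (Continuous.intervalIntegrable (by fun_prop) _ _),
    intervalIntegral.integral_sub (Continuous.intervalIntegrable (by fun_prop) _ _)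
    (Continuous.intervalIntegrable (by fun_prop) _ _), intervalIntegral.integral_const_mul,
    intervalIntegral.integral_const_mul, intervalIntegral.integral_const_mul,
    integral_laplace, integral_laplace, integral_laplace] at hint
  have h2 : (2 * π : ℂ) ≠ 0 := by simp [Real.pi_ne_zero]
  have h3 : (2 * π : ℂ) * (((l + 2) * legP (l + 2) (Real.cos θ) -
      (2 * l + 3) * Real.cos θ * legP (l + 1) (Real.cos θ) +
      (l + 1) * legP l (Real.cos θ) : ℝ) : ℂ) = 0 := by
    rw [← hint]; push_cast; ring
  exact_mod_cast (mul_eq_zero.mp h3).resolve_left h2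

lemma legP_recurrence (l : ℕ) {x : ℝ} (hx : x ∈ Set.Icc (-1 : ℝ) 1) :
    (l + 2) * legP (l + 2) x - (2 * l + 3) * x * legP (l + 1) x + (l + 1) * legP l x = 0 := by
  rw [← Real.cos_arccos hx.1 hx.2]; exact legP_cos_recurrence _ _

lemma legP_zero (x : ℝ) : legP 0 x = 1 := by simp [legP, legendrePoly]

lemma legP_one (x : ℝ) : legP 1 x = x := by
  simp [legP, legendrePoly]; ring

lemma continuous_legP (l : ℕ) : Continuous (legP l) := (legendrePoly l).continuous

/-! ### The addition theorem for Legendre polynomials -/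

/-- Since `α cos t + β sin t = |z| cos (t - arg z)` for `z = α + iβ`, a shift over a full period
reduces this to Laplace's integral with `sin θ = |z|`. -/
lemma integral_laplace_rotated (l : ℕ) {c α β : ℝ} (h : c ^ 2 + α ^ 2 + β ^ 2 = 1) :
    ∫ t in (0 : ℝ)..2 * π, ((c : ℂ) + Complex.I * (α * Real.cos t + β * Real.sin t)) ^ l =
      2 * π * legP l c := by
  set z : ℂ := ⟨α, β⟩ with hz
  have hn : ‖z‖ ^ 2 = α ^ 2 + β ^ 2 := by rw [Complex.sq_norm, Complex.normSq_mk]; ring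
  have hα : α = ‖z‖ * Real.cos z.arg := (Complex.norm_mul_cos_arg z).symm
  have hβ : β = ‖z‖ * Real.sin z.arg := (Complex.norm_mul_sin_arg z).symm
  have hc1 : -1 ≤ c := by nlinarith
  have hc2 : c ≤ 1 := by nlinarith
  have hsin : Real.sin (Real.arccos c) = ‖z‖ := by
    rw [Real.sin_arccos, Real.sqrt_eq_iff_mul_self_eq (by nlinarith) (norm_nonneg _)]; nlinarith
  have hL := integral_laplace l (Real.arccos c)
  rw [Real.cos_arccos hc1 hc2, hsin] at hL
  rw [← hL]
  have hper : Function.Periodic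
      (fun t : ℝ => ((c : ℂ) + Complex.I * ‖z‖ * Real.cos t) ^ l) (2 * π) := by
    intro t; simp
  have h2 := hper.intervalIntegral_add_eq (-z.arg) 0
  rw [zero_add] at h2
  rw [← h2, show -z.arg + 2 * π = 2 * π - z.arg by ring, ← zero_sub,
    ← intervalIntegral.integral_comp_sub_right]
  refine intervalIntegral.integral_congr fun t _ => ?_
  simp only [Real.cos_sub]
  congr 2
  rw [hα, hβ]
  push_cast
  ring

end HypFourier

/-! ### Factorization of null vectors and the Fourier coefficients of `P_l (cos γ)`. -/

namespace HypFourier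
open Polynomial Finset Real

lemma intervalIntegral_swap_of_continuousOn {E : Type*} [NormedAddCommGroup E] [NormedSpace ℝ E]
    {F : ℝ → ℝ → E} {a b c d : ℝ}
    (hF : ContinuousOn F.uncurry (Set.uIcc a b ×ˢ Set.uIcc c d)) :
    ∫ x in a..b, ∫ y in c..d, F x y = ∫ y in c..d, ∫ x in a..b, F x y :=
  MeasureTheory.intervalIntegral_intervalIntegral_swap
    ((hF.integrableOn_compact (isCompact_uIcc.prod isCompact_uIcc)).mono_set
      (Set.prod_mono Set.uIoc_subset_uIcc Set.uIoc_subset_uIcc))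

/-- Here `a, b` and `a', b'` are the cosines and sines of the half-angles, `η = e^{it}` and `ζ =
e^{iψ}`. The left side is quadratic in `ζ`; with `U = a' - i b' η` and `V = a' η - i b'`, its
coefficients come from `U V`, `i U²` and `i V²` (`n0`, `nm`, `np`), so it splits like the spinor
form of a null vector. -/
lemma null_vector_factorization (a b a' b' η η' ζ ζ' : ℂ) (h1 : a' ^ 2 + b' ^ 2 = 1)
    (hη : η * η' = 1) (hζ : ζ * ζ' = 1) :
    η * ζ * ((a ^ 2 - b ^ 2) * (a' ^ 2 - b' ^ 2) + 2 * a * b * (2 * a' * b') * ((ζ + ζ') / 2) +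
      Complex.I * ((-(a ^ 2 - b ^ 2) * (2 * a' * b') + 2 * a * b * (a' ^ 2 - b' ^ 2) *
        ((ζ + ζ') / 2)) * ((η + η') / 2) +
        2 * a * b * (-Complex.I * (ζ - ζ') / 2) * (-Complex.I * (η - η') / 2))) =
    (a * (a' * η - Complex.I * b') + Complex.I * b * (a' - Complex.I * b' * η) * ζ) *
      (a * (a' - Complex.I * b' * η) * ζ + Complex.I * b * (a' * η - Complex.I * b')) := by
  have hI := Complex.I_sq
  have n0 : η * (a' ^ 2 - b' ^ 2 - Complex.I * (2 * a' * b') * ((η + η') / 2)) =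
      (a' - Complex.I * b' * η) * (a' * η - Complex.I * b') := by
    linear_combination (-Complex.I * a' * b') * hη - (b' ^ 2 * η) * hI
  have nm : η * (2 * a' * b' + Complex.I * (a' ^ 2 - b' ^ 2) * ((η + η') / 2) -
      Complex.I * (η - η') / 2) = Complex.I * (a' - Complex.I * b' * η) ^ 2 := by
    linear_combination (Complex.I / 2 * (a' ^ 2 - b' ^ 2) + Complex.I / 2) * hη +
      (2 * a' * b' * η - Complex.I * b' ^ 2 * η ^ 2) * hI + (Complex.I / 2 * (η ^ 2 - 1)) * h1
  have np : η * (2 * a' * b' + Complex.I * (a' ^ 2 - b' ^ 2) * ((η + η') / 2) +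
      Complex.I * (η - η') / 2) = Complex.I * (a' * η - Complex.I * b') ^ 2 := by
    linear_combination (Complex.I / 2 * (a' ^ 2 - b' ^ 2) - Complex.I / 2) * hη +
      (2 * a' * b' * η - Complex.I * b' ^ 2) * hI - (Complex.I / 2 * (η ^ 2 - 1)) * h1
  linear_combination (ζ * (a ^ 2 - b ^ 2)) * n0 + (a * b * ζ ^ 2) * nm + (a * b) * np +
    (2 * a * b * η * a' * b' + Complex.I * a * b * η * (a' ^ 2 - b' ^ 2) * ((η + η') / 2) +
      a * b * η * Complex.I * (η - η') / 2) * hζ +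
    (Complex.I * η * ζ * a * b * (ζ * η - ζ' * η - ζ * η' + ζ' * η') / 2 - η * ζ * b ^ 2 * a' ^ 2 -
      η * ζ * b ^ 2 * b' ^ 2 * Complex.I ^ 2 + Complex.I * ζ * b ^ 2 * a' * b' * (η ^ 2 + 1)) * hI

/-- The cosine of the angle between the directions `(θ, ψ)` and `(θ', 0)` on the sphere. -/
noncomputable def cosAngle (θ θ' ψ : ℝ) : ℝ :=
  Real.cos θ * Real.cos θ' + Real.sin θ * Real.sin θ' * Real.cos ψ

lemma continuous_cosAngle (θ θ' : ℝ) : Continuous (cosAngle θ θ') := by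
  unfold cosAngle; fun_prop

lemma cosAngle_sq_add (θ θ' ψ : ℝ) : cosAngle θ θ' ψ ^ 2 +
    (-(Real.cos θ * Real.sin θ') + Real.sin θ * Real.cos θ' * Real.cos ψ) ^ 2 +
    (Real.sin θ * Real.sin ψ) ^ 2 = 1 := by
  rw [cosAngle]
  linear_combination Real.sin_sq_add_cos_sq θ + (Real.cos θ ^ 2 + Real.sin θ ^ 2 * Real.cos ψ ^ 2) *
    Real.sin_sq_add_cos_sq θ' + Real.sin θ ^ 2 * Real.sin_sq_add_cos_sq ψ

lemma cosAngle_mem_Icc (θ θ' ψ : ℝ) : cosAngle θ θ' ψ ∈ Set.Icc (-1 : ℝ) 1 := by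
  rw [Set.mem_Icc, ← abs_le, ← sq_le_one_iff_abs_le_one]
  nlinarith [cosAngle_sq_add θ θ' ψ,
    sq_nonneg (-(Real.cos θ * Real.sin θ') + Real.sin θ * Real.cos θ' * Real.cos ψ),
    sq_nonneg (Real.sin θ * Real.sin ψ)]

lemma cos_sin_half (θ : ℝ) : (Real.cos θ : ℂ) = Real.cos (θ / 2) ^ 2 - Real.sin (θ / 2) ^ 2 ∧
    (Real.sin θ : ℂ) = 2 * Real.cos (θ / 2) * Real.sin (θ / 2) ∧
    (Real.cos (θ / 2) : ℂ) ^ 2 + (Real.sin (θ / 2) : ℂ) ^ 2 = 1 := by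
  refine ⟨?_, ?_, ?_⟩
  · rw [← Complex.ofReal_pow, ← Complex.ofReal_pow, ← Complex.ofReal_sub, ← Real.cos_two_mul']
    congr 2; ring
  · have : Real.sin θ = 2 * Real.cos (θ / 2) * Real.sin (θ / 2) := by
      have := Real.sin_two_mul (θ / 2)
      rw [show 2 * (θ / 2) = θ by ring] at this; linarith
    rw [this]; push_cast; ring
  · exact_mod_cast Real.cos_sq_add_sin_sq (θ / 2)

lemma cos_sin_exp (t : ℝ) : (Real.cos t : ℂ) =
      (Complex.exp (t * Complex.I) + Complex.exp (-(t * Complex.I))) / 2 ∧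
    (Real.sin t : ℂ) =
      -Complex.I * (Complex.exp (t * Complex.I) - Complex.exp (-(t * Complex.I))) / 2 := by
  rw [Complex.ofReal_cos, Complex.ofReal_sin, Complex.cos, Complex.sin]
  simp only [neg_mul]
  exact ⟨trivial, by ring⟩

/-- The product of Fourier coefficients appearing in the addition theorem. -/
lemma integral_legP_cosAngle_exp (l k : ℕ) (θ θ' : ℝ) :
    (l.factorial : ℂ) ^ 2 * ∫ ψ in (0 : ℝ)..2 * π,
      (legP l (cosAngle θ θ' ψ) : ℂ) * Complex.exp (-(k * ψ * Complex.I)) =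
    if k ≤ l then 2 * π * ((-1) ^ k * ((l + k).factorial * (l - k).factorial) *
      (laplaceCoeff l k θ * laplaceCoeff l k θ')) else 0 := by
  have hpi : (2 * π : ℂ) ≠ 0 := by simp [Real.pi_ne_zero]
  obtain ⟨hc, hs, h1⟩ := cos_sin_half θ
  obtain ⟨hc', hs', h1'⟩ := cos_sin_half θ'
  set a : ℂ := (Real.cos (θ / 2) : ℂ) with ha
  set b : ℂ := (Real.sin (θ / 2) : ℂ) with hb
  set a' : ℂ := (Real.cos (θ' / 2) : ℂ) with ha'
  set b' : ℂ := (Real.sin (θ' / 2) : ℂ) with hb'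
  -- `U` and `V` carry all dependence on `θ'` and `t`. After coefficient extraction in `ψ` they
  -- remain only as `U^(l+k) V^(l-k)`, which leaves a second coefficient extraction in `t`.
  set U : ℝ → ℂ := fun t => a' - Complex.I * b' * Complex.exp (t * Complex.I) with hU
  set V : ℝ → ℂ := fun t => a' * Complex.exp (t * Complex.I) - Complex.I * b' with hV
  let p : ℝ → ℂ[X] := fun t => (C (Complex.I * b * U t) * X + C (a * V t)) ^ l *
    (C (a * U t) * X + C (Complex.I * b * V t)) ^ l
  have hfac : ∀ ψ t : ℝ, (((cosAngle θ θ' ψ : ℝ) : ℂ) + Complex.I *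
      (((-(Real.cos θ * Real.sin θ') + Real.sin θ * Real.cos θ' * Real.cos ψ : ℝ) : ℂ) *
        Real.cos t + ((Real.sin θ * Real.sin ψ : ℝ) : ℂ) * Real.sin t)) ^ l *
        Complex.exp (-(k * ψ * Complex.I)) =
      Complex.exp (-(l * t * Complex.I)) * ((p t).eval (Complex.exp (ψ * Complex.I)) *
        Complex.exp (-((l + k : ℕ) * ψ * Complex.I))) := by
    intro ψ t
    have hη : Complex.exp (t * Complex.I) * Complex.exp (-(t * Complex.I)) = 1 := by
      rw [← Complex.exp_add]; simp
    have hζ : Complex.exp (ψ * Complex.I) * Complex.exp (-(ψ * Complex.I)) = 1 := by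
      rw [← Complex.exp_add]; simp
    have h := null_vector_factorization a b a' b' _ _ _ _ h1' hη hζ
    have e1 : Complex.exp (-(l * t * Complex.I)) * Complex.exp (-((l + k : ℕ) * ψ * Complex.I)) *
        (Complex.exp (t * Complex.I) * Complex.exp (ψ * Complex.I)) ^ l =
        Complex.exp (-(k * ψ * Complex.I)) := by
      rw [mul_pow, ← Complex.exp_nat_mul, ← Complex.exp_nat_mul, ← Complex.exp_add,
        ← Complex.exp_add, ← Complex.exp_add]
      congr 1; push_cast; ring
    have e2 : (p t).eval (Complex.exp (ψ * Complex.I)) =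
        (Complex.exp (t * Complex.I) * Complex.exp (ψ * Complex.I)) ^ l *
        (((cosAngle θ θ' ψ : ℝ) : ℂ) + Complex.I *
      (((-(Real.cos θ * Real.sin θ') + Real.sin θ * Real.cos θ' * Real.cos ψ : ℝ) : ℂ) *
        Real.cos t + ((Real.sin θ * Real.sin ψ : ℝ) : ℂ) * Real.sin t)) ^ l := by
      simp only [p, eval_mul, eval_pow, eval_add, eval_C, eval_X]
      rw [← mul_pow, ← mul_pow]
      congr 1
      rw [cosAngle]
      simp only [Complex.ofReal_add, Complex.ofReal_mul, Complex.ofReal_neg]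
      rw [hc, hs, hc', hs', (cos_sin_exp t).1, (cos_sin_exp t).2, (cos_sin_exp ψ).1,
        (cos_sin_exp ψ).2]
      linear_combination -h
    rw [e2, ← e1]; ring
  have hmain : 2 * π * ∫ ψ in (0 : ℝ)..2 * π,
      (legP l (cosAngle θ θ' ψ) : ℂ) * Complex.exp (-(k * ψ * Complex.I)) =
      2 * π * ∫ t in (0 : ℝ)..2 * π, Complex.exp (-(l * t * Complex.I)) * (p t).coeff (l + k) := by
    rw [← intervalIntegral.integral_const_mul, ← intervalIntegral.integral_const_mul]
    calc _ = ∫ ψ in (0 : ℝ)..2 * π, ∫ t in (0 : ℝ)..2 * π,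
          (((cosAngle θ θ' ψ : ℝ) : ℂ) + Complex.I *
      (((-(Real.cos θ * Real.sin θ') + Real.sin θ * Real.cos θ' * Real.cos ψ : ℝ) : ℂ) *
        Real.cos t + ((Real.sin θ * Real.sin ψ : ℝ) : ℂ) * Real.sin t)) ^ l *
        Complex.exp (-(k * ψ * Complex.I)) := by
          refine intervalIntegral.integral_congr fun ψ _ => ?_
          rw [intervalIntegral.integral_mul_const,
            integral_laplace_rotated l (cosAngle_sq_add θ θ' ψ)]
          ring
      _ = ∫ t in (0 : ℝ)..2 * π, ∫ ψ in (0 : ℝ)..2 * π, _ := by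
          refine intervalIntegral_swap_of_continuousOn (Continuous.continuousOn ?_)
          have := continuous_cosAngle θ θ'
          unfold Function.uncurry
          fun_prop
      _ = _ := by
          refine intervalIntegral.integral_congr fun t _ => ?_
          rw [intervalIntegral.integral_congr (fun ψ _ => hfac ψ t),
            intervalIntegral.integral_const_mul, integral_eval_exp_mul_exp]
          ring
  rw [mul_left_cancel₀ hpi hmain]
  split_ifs with hkl
  · have hp : ∀ t : ℝ, Complex.exp (-(l * t * Complex.I)) * (p t).coeff (l + k) = laplaceCoeff l k θ *
        (((C (-(Complex.I * b')) * X + C a') ^ (l + k) *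
          (C a' * X + C (-(Complex.I * b'))) ^ (l - k)).eval (Complex.exp (t * Complex.I)) *
          Complex.exp (-(l * t * Complex.I))) := by
      intro t
      rw [coeff_linear_pow_scaled _ _ _ _ _ _ hkl, laplaceCoeff_eq_coeff]
      simp only [eval_mul, eval_pow, eval_add, eval_C, eval_X, hU, hV]
      rw [show -(Complex.I * b') * Complex.exp (t * Complex.I) + a' =
        a' - Complex.I * b' * Complex.exp (t * Complex.I) by ring,
        show a' * Complex.exp (t * Complex.I) + -(Complex.I * b') =
        a' * Complex.exp (t * Complex.I) - Complex.I * b' by ring]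
      ring
    simp_rw [hp]
    rw [intervalIntegral.integral_const_mul, integral_eval_exp_mul_exp]
    have := coeff_linear_pow_neg (Real.cos (θ' / 2) : ℂ) (Complex.I * Real.sin (θ' / 2)) hkl
    rw [← laplaceCoeff_eq_coeff] at this
    linear_combination (2 * π * laplaceCoeff l k θ) * this
  -- For `k > l` the degree `2l` of `p t` is too small to reach `l + k`.
  · have hp : ∀ t, (p t).coeff (l + k) = 0 := by
      intro t
      apply coeff_eq_zero_of_natDegree_lt
      have h1 : ∀ u v : ℂ, (((C u * X + C v) ^ l : ℂ[X])).natDegree ≤ l := fun u v =>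
        (natDegree_pow_le_of_le l (natDegree_linear_le)).trans (by simp)
      calc (p t).natDegree ≤ l + l := natDegree_mul_le_of_le (h1 _ _) (h1 _ _)
        _ < l + k := by omega
    simp only [hp, mul_zero, intervalIntegral.integral_zero]

/-- Fourier coefficients of `P_l (cos γ)`: the addition theorem for Legendre polynomials. -/
lemma integral_legP_cosAngle_mul_cos (l k : ℕ) {θ θ' : ℝ} (hθ : 0 ≤ Real.sin θ)
    (hθ' : 0 ≤ Real.sin θ') :
    ∫ ψ in (0 : ℝ)..π, legP l (cosAngle θ θ' ψ) * Real.cos (k * ψ) =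
    if k ≤ l then π * (((l - k).factorial : ℝ) / (l + k).factorial *
      ferrersNat l k (Real.cos θ) * ferrersNat l k (Real.cos θ')) else 0 := by
  have hf := integral_legP_cosAngle_exp l k θ θ'
  set f : ℝ → ℝ := fun ψ => legP l (cosAngle θ θ' ψ) * Real.cos (k * ψ) with hfdef
  have hcont : Continuous f := by
    have := continuous_legP l
    have := continuous_cosAngle θ θ'
    fun_prop
  -- The integrand is symmetric about `π`, so the half-range cosine integral is half of the
  -- full-range exponential one.
  have hrefl : ∀ ψ, f (2 * π - ψ) = f ψ := by
    intro ψ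
    have h1 : Real.cos (2 * π - ψ) = Real.cos ψ := Real.cos_two_pi_sub ψ
    have h2 : Real.cos (k * (2 * π - ψ)) = Real.cos (k * ψ) := by
      rw [show (k : ℝ) * (2 * π - ψ) = k * (2 * π) - k * ψ by ring, Real.cos_nat_mul_two_pi_sub]
    simp only [hfdef, cosAngle, h1, h2]
  have hhalf : ∫ ψ in (0 : ℝ)..2 * π, f ψ = 2 * ∫ ψ in (0 : ℝ)..π, f ψ := by
    rw [← intervalIntegral.integral_add_adjacent_intervals (b := π)
      (hcont.intervalIntegrable _ _) (hcont.intervalIntegrable _ _)]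
    have : ∫ ψ in π..2 * π, f ψ = ∫ ψ in (0 : ℝ)..π, f ψ := by
      have h := intervalIntegral.integral_comp_sub_left (a := 0) (b := π) f (2 * π)
      simp_rw [hrefl] at h
      rw [h]; congr 1 <;> ring
    rw [this]; ring
  have hre : ∫ ψ in (0 : ℝ)..2 * π, f ψ = (∫ ψ in (0 : ℝ)..2 * π,
      (legP l (cosAngle θ θ' ψ) : ℂ) * Complex.exp (-(k * ψ * Complex.I))).re := by
    have hint : IntervalIntegrable (fun ψ : ℝ => (legP l (cosAngle θ θ' ψ) : ℂ) *
        Complex.exp (-(k * ψ * Complex.I))) MeasureTheory.volume 0 (2 * π) := by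
      have := continuous_legP l
      have := continuous_cosAngle θ θ'
      exact Continuous.intervalIntegrable (by fun_prop) _ _
    have := Complex.reCLM.intervalIntegral_comp_comm hint
    simp only [Complex.reCLM_apply] at this
    rw [← this]
    refine intervalIntegral.integral_congr fun ψ _ => ?_
    simp only [hfdef, Complex.re_ofReal_mul]
    rw [show -(k * ψ * Complex.I : ℂ) = ((-(k * ψ) : ℝ) : ℂ) * Complex.I by push_cast; ring,
      Complex.exp_ofReal_mul_I_re, Real.cos_neg]
  have hfac : (l.factorial : ℂ) ≠ 0 := by exact_mod_cast l.factorial_ne_zero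
  rw [hre] at hhalf
  split_ifs with hkl
  · rw [if_pos hkl] at hf
    have hfac2 : ((l + k).factorial : ℂ) ≠ 0 := by exact_mod_cast (l + k).factorial_ne_zero
    have : ∫ ψ in (0 : ℝ)..2 * π, (legP l (cosAngle θ θ' ψ) : ℂ) *
        Complex.exp (-(k * ψ * Complex.I)) =
        ((2 * π * (((l - k).factorial : ℝ) / (l + k).factorial *
          ferrersNat l k (Real.cos θ) * ferrersNat l k (Real.cos θ')) : ℝ) : ℂ) := by
      apply mul_left_cancel₀ (pow_ne_zero 2 hfac)
      rw [hf]
      push_cast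
      rw [ferrersNat_cos l k hθ, ferrersNat_cos l k hθ']
      have hI : (-1 : ℂ) ^ k = Complex.I ^ k * Complex.I ^ k := by
        rw [← mul_pow, Complex.I_mul_I]
      rw [hI]
      field_simp
    rw [this, Complex.ofReal_re] at hhalf
    linarith
  · rw [if_neg hkl] at hf
    rw [(mul_eq_zero.mp hf).resolve_left (pow_ne_zero 2 hfac)] at hhalf
    simp at hhalf; linarith

end HypFourier

namespace HypFourier
open Finset Real

/-! ### Three-term recurrences from an exact derivative -/

section Recurrence

variable {𝕜 : Type*} [RCLike 𝕜]

/-- If `g' = (w - Y) v` and `g w' = (w² - 2Yw + 1) v`, the derivative of `g w^(l+1)` is exactly the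
Legendre recurrence combination of the `w^n v`. The boundary terms vanish with `w`. It applies to
`legQ` and to its complex-shifted form alike. -/
lemma integral_pow_mul_recurrence {w w' g v : ℝ → 𝕜} {Y : 𝕜} {a b : ℝ}
    (hw : ∀ u ∈ Set.uIcc a b, HasDerivAt w (w' u) u)
    (hg : ∀ u ∈ Set.uIcc a b, HasDerivAt g ((w u - Y) * v u) u)
    (hrel : ∀ u ∈ Set.uIcc a b, g u * w' u = (w u ^ 2 - 2 * Y * w u + 1) * v u)
    (hv : ContinuousOn v (Set.uIcc a b)) (ha : w a = 0) (hb : w b = 0) (l : ℕ) :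
    (l + 2) * (∫ u in a..b, w u ^ (l + 2) * v u) -
      (2 * l + 3) * Y * (∫ u in a..b, w u ^ (l + 1) * v u) +
      (l + 1) * (∫ u in a..b, w u ^ l * v u) = 0 := by
  have hwc : ContinuousOn w (Set.uIcc a b) := fun u hu => (hw u hu).continuousAt.continuousWithinAt
  have hi : ∀ n : ℕ, IntervalIntegrable (fun u => w u ^ n * v u) MeasureTheory.volume a b :=
    fun n => ((hwc.pow n).mul hv).intervalIntegrable
  have hd : ∀ u ∈ Set.uIcc a b, HasDerivAt (fun u => g u * w u ^ (l + 1))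
      ((l + 2) * (w u ^ (l + 2) * v u) - (2 * l + 3) * Y * (w u ^ (l + 1) * v u) +
        (l + 1) * (w u ^ l * v u)) u := by
    intro u hu
    convert! (hg u hu).mul ((hw u hu).pow (l + 1)) using 1
    simp only [add_tsub_cancel_right, Pi.pow_apply]
    rw [pow_succ (w u) (l + 1), pow_succ (w u) l]
    push_cast
    linear_combination (-(l + 1) * w u ^ l) * hrel u hu
  have h := intervalIntegral.integral_eq_sub_of_hasDerivAt hd
    ((((hi (l + 2)).const_mul _).sub ((hi (l + 1)).const_mul _)).add ((hi l).const_mul _))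
  rw [intervalIntegral.integral_add (((hi (l + 2)).const_mul _).sub ((hi (l + 1)).const_mul _))
    ((hi l).const_mul _), intervalIntegral.integral_sub ((hi (l + 2)).const_mul _)
    ((hi (l + 1)).const_mul _), intervalIntegral.integral_const_mul,
    intervalIntegral.integral_const_mul, intervalIntegral.integral_const_mul] at h
  rw [h]; simp [ha, hb]

/-- The companion for the first step, where no power of `w` kills the boundary values of `g`; they
give the inhomogeneous term in `Q_1 = Y Q_0 - 1`. -/
lemma integral_mul_sub_integral {w g v : ℝ → 𝕜} {Y : 𝕜} {a b : ℝ}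
    (hg : ∀ u ∈ Set.uIcc a b, HasDerivAt g ((w u - Y) * v u) u)
    (hwc : ContinuousOn w (Set.uIcc a b)) (hv : ContinuousOn v (Set.uIcc a b)) :
    (∫ u in a..b, w u * v u) - Y * (∫ u in a..b, v u) = g b - g a := by
  have hd : ∀ u ∈ Set.uIcc a b, HasDerivAt g (w u * v u - Y * v u) u := by
    intro u hu; convert! hg u hu using 1; ring
  have h1 : IntervalIntegrable (fun u => w u * v u) MeasureTheory.volume a b :=
    (hwc.mul hv).intervalIntegrable
  have h2 := (hv.intervalIntegrable (μ := MeasureTheory.volume)).const_mul Y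
  rw [← intervalIntegral.integral_eq_sub_of_hasDerivAt hd (h1.sub h2),
    intervalIntegral.integral_sub h1 h2, intervalIntegral.integral_const_mul]

lemma eq_of_recurrence {p q : ℕ → 𝕜} {Y : 𝕜} (h0 : p 0 = q 0) (h1 : p 1 = q 1)
    (hp : ∀ l : ℕ, (l + 2) * p (l + 2) - (2 * l + 3) * Y * p (l + 1) + (l + 1) * p l = 0)
    (hq : ∀ l : ℕ, (l + 2) * q (l + 2) - (2 * l + 3) * Y * q (l + 1) + (l + 1) * q l = 0) (l : ℕ) :
    p l = q l := by
  induction l using Nat.twoStepInduction with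
  | zero => exact h0
  | one => exact h1
  | more n hn hn1 =>
    have h : ((n : 𝕜) + 2) ≠ 0 := by exact_mod_cast (n + 1).succ_ne_zero
    apply mul_left_cancel₀ h
    linear_combination hp n - hq n + (2 * n + 3) * Y * hn1 - (n + 1) * hn

end Recurrence

/-! ### Legendre functions of the second kind -/

/-- The Legendre function of the second kind `Q_l(Y)`, `Y > 1`. -/
noncomputable def legQ (l : ℕ) (Y : ℝ) : ℝ :=
  1 / 2 * ∫ u in (-1 : ℝ)..1, ((1 - u ^ 2) / (2 * (Y - u))) ^ l * (Y - u)⁻¹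

section legQ

variable {Y : ℝ}

lemma sub_pos_of_mem_uIcc (hY : 1 < Y) {u : ℝ} (hu : u ∈ Set.uIcc (-1 : ℝ) 1) : 0 < Y - u := by
  rw [Set.uIcc_of_le (by norm_num)] at hu; linarith [hu.2]

lemma continuousOn_legQ_base (hY : 1 < Y) :
    ContinuousOn (fun u : ℝ => (1 - u ^ 2) / (2 * (Y - u))) (Set.uIcc (-1 : ℝ) 1) :=
  ContinuousOn.div (by fun_prop) (by fun_prop) fun u hu => by
    have := sub_pos_of_mem_uIcc hY hu; positivity

lemma continuousOn_legQ_inv (hY : 1 < Y) :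
    ContinuousOn (fun u : ℝ => (Y - u)⁻¹) (Set.uIcc (-1 : ℝ) 1) :=
  ContinuousOn.inv₀ (by fun_prop) fun u hu => (sub_pos_of_mem_uIcc hY hu).ne'

lemma intervalIntegrable_legQ (hY : 1 < Y) (l : ℕ) :
    IntervalIntegrable (fun u : ℝ => ((1 - u ^ 2) / (2 * (Y - u))) ^ l * (Y - u)⁻¹)
      MeasureTheory.volume (-1) 1 :=
  (((continuousOn_legQ_base hY).pow l).mul (continuousOn_legQ_inv hY)).intervalIntegrable

lemma hasDerivAt_legQ_aux (hY : 1 < Y) {u : ℝ} (hu : u ∈ Set.uIcc (-1 : ℝ) 1) :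
    HasDerivAt (fun u : ℝ => (1 + u ^ 2 - 2 * u * Y) / (2 * (Y - u)))
      (((1 - u ^ 2) / (2 * (Y - u)) - Y) * (Y - u)⁻¹) u := by
  have h := (sub_pos_of_mem_uIcc hY hu).ne'
  have h1 : HasDerivAt (fun u : ℝ => 1 + u ^ 2 - 2 * u * Y) (2 * u - 2 * Y) u := by
    convert! (((hasDerivAt_pow 2 u).const_add 1).sub (((hasDerivAt_id u).const_mul 2).mul_const Y))
      using 1
    simp
  have h2 : HasDerivAt (fun u : ℝ => 2 * (Y - u)) (-2) u := by
    convert! (((hasDerivAt_id u).const_sub Y).const_mul 2) using 1; norm_num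
  convert! h1.div h2 (by simpa using h) using 1
  field_simp; ring

lemma legQ_recurrence (hY : 1 < Y) (l : ℕ) :
    (l + 2) * legQ (l + 2) Y - (2 * l + 3) * Y * legQ (l + 1) Y + (l + 1) * legQ l Y = 0 := by
  have h := integral_pow_mul_recurrence (𝕜 := ℝ) (a := -1) (b := 1) (Y := Y)
    (w := fun u : ℝ => (1 - u ^ 2) / (2 * (Y - u))) (v := fun u => (Y - u)⁻¹)
    (w' := fun u => (1 - 2 * u * Y + u ^ 2) / (2 * (Y - u) ^ 2)) ?_
    (fun u hu => hasDerivAt_legQ_aux hY hu) ?_ (continuousOn_legQ_inv hY) (by simp) (by simp) l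
  · simp only [legQ]; linarith
  · intro u hu
    have h := (sub_pos_of_mem_uIcc hY hu).ne'
    have h1 : HasDerivAt (fun u : ℝ => 1 - u ^ 2) (-(2 * u)) u := by
      convert! (hasDerivAt_pow 2 u).const_sub 1 using 1; simp
    have h2 : HasDerivAt (fun u : ℝ => 2 * (Y - u)) (-2) u := by
      convert! (((hasDerivAt_id u).const_sub Y).const_mul 2) using 1; norm_num
    convert! h1.div h2 (by simpa using h) using 1
    field_simp; ring
  · intro u hu
    have h := (sub_pos_of_mem_uIcc hY hu).ne'
    field_simp; ring

lemma legQ_one (hY : 1 < Y) : legQ 1 Y = Y * legQ 0 Y - 1 := by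
  have h := integral_mul_sub_integral (𝕜 := ℝ) (a := -1) (b := 1) (Y := Y)
    (fun u hu => hasDerivAt_legQ_aux hY hu) (continuousOn_legQ_base hY) (continuousOn_legQ_inv hY)
  have h1 : (Y - 1) ≠ 0 := by linarith
  have h2 : (Y + 1) ≠ 0 := by linarith
  have e1 : (1 + (1 : ℝ) ^ 2 - 2 * 1 * Y) / (2 * (Y - 1)) = -1 := by field_simp; ring
  have e2 : (1 + (-1 : ℝ) ^ 2 - 2 * (-1) * Y) / (2 * (Y - (-1))) = 1 := by
    rw [sub_neg_eq_add]; field_simp; ring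
  simp only [e1, e2] at h
  simp only [legQ, pow_one, pow_zero, one_mul]
  linarith

lemma legQ_base_nonneg (hY : 1 < Y) {u : ℝ} (hu : u ∈ Set.Icc (-1 : ℝ) 1) :
    0 ≤ (1 - u ^ 2) / (2 * (Y - u)) := by
  have h1 : 0 ≤ 1 - u ^ 2 := by nlinarith [hu.1, hu.2]
  have h2 : 0 < Y - u := by linarith [hu.2]
  positivity

/-- The exact maximum is `Y - √(Y² - 1)`; this rational bound is weaker but still below one for `Y >
1`, which suffices for geometric decay in `l`. -/
lemma legQ_base_le (hY : 1 < Y) {u : ℝ} (hu : u ∈ Set.Icc (-1 : ℝ) 1) :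
    (1 - u ^ 2) / (2 * (Y - u)) ≤ 2 / (Y + 1) := by
  have h2 : 0 < Y - u := by linarith [hu.2]
  rw [div_le_div_iff₀ (by positivity) (by linarith)]
  nlinarith [hu.1, hu.2, mul_nonneg (by linarith [hu.1] : 0 ≤ 1 + u) (by linarith : 0 ≤ Y - 1),
    mul_nonneg (by linarith [hu.1] : 0 ≤ 1 + u) (by linarith [hu.2] : 0 ≤ 1 - u),
    mul_nonneg (mul_nonneg (by linarith [hu.1] : 0 ≤ 1 + u) (by linarith [hu.2] : 0 ≤ 1 - u))
      (by linarith : 0 ≤ Y - 1), mul_nonneg (by linarith [hu.2] : 0 ≤ 1 - u) (by linarith : 0 ≤ Y - 1)]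

lemma legQ_integrand_nonneg (hY : 1 < Y) (l : ℕ) {u : ℝ} (hu : u ∈ Set.Icc (-1 : ℝ) 1) :
    0 ≤ ((1 - u ^ 2) / (2 * (Y - u))) ^ l * (Y - u)⁻¹ :=
  mul_nonneg (pow_nonneg (legQ_base_nonneg hY hu) l) (inv_nonneg.mpr (by linarith [hu.2]))

lemma legQ_nonneg (hY : 1 < Y) (l : ℕ) : 0 ≤ legQ l Y := by
  rw [legQ]
  exact mul_nonneg (by norm_num) (intervalIntegral.integral_nonneg (by norm_num)
    fun u hu => legQ_integrand_nonneg hY l hu)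

lemma legQ_add_le (hY : 1 < Y) (k l : ℕ) : legQ (k + l) Y ≤ (2 / (Y + 1)) ^ k * legQ l Y := by
  rw [legQ, legQ, mul_left_comm, ← intervalIntegral.integral_const_mul ((2 / (Y + 1)) ^ k)]
  refine mul_le_mul_of_nonneg_left ?_ (by norm_num : (0 : ℝ) ≤ 1 / 2)
  refine intervalIntegral.integral_mono_on (by norm_num) (intervalIntegrable_legQ hY _)
    ((intervalIntegrable_legQ hY _).const_mul _) fun u hu => ?_
  rw [pow_add, mul_assoc]
  exact mul_le_mul_of_nonneg_right (pow_le_pow_left₀ (legQ_base_nonneg hY hu)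
    (legQ_base_le hY hu) k) (legQ_integrand_nonneg hY l hu)

lemma legQ_succ_le (hY : 1 < Y) (l : ℕ) : legQ (l + 1) Y ≤ legQ l Y := by
  rw [add_comm]
  refine (legQ_add_le hY 1 l).trans ?_
  rw [pow_one]
  exact mul_le_of_le_one_left (legQ_nonneg hY l) ((div_le_one (by linarith)).mpr (by linarith))

lemma legQ_anti (hY : 1 < Y) {Y' : ℝ} (h : Y ≤ Y') (l : ℕ) : legQ l Y' ≤ legQ l Y := by
  rw [legQ, legQ]
  refine mul_le_mul_of_nonneg_left ?_ (by norm_num : (0 : ℝ) ≤ 1 / 2)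
  refine intervalIntegral.integral_mono_on (by norm_num)
    (intervalIntegrable_legQ (hY.trans_le h) _) (intervalIntegrable_legQ hY _) fun u hu => ?_
  have h2 : 0 < Y - u := by linarith [hu.2]
  have h1 : 0 ≤ 1 - u ^ 2 := by nlinarith [hu.1, hu.2]
  have := legQ_base_nonneg (hY.trans_le h) hu
  have h3 : 0 < Y' - u := by linarith
  gcongr

lemma continuousOn_legQ (l : ℕ) : ContinuousOn (legQ l) (Set.Ioi 1) := by
  intro Y hY
  rw [Set.mem_Ioi] at hY
  -- Cutting `Y - u` off below at `δ` makes the integrand continuous everywhere, and the cut-off is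
  -- inactive for arguments above `1 + δ`.
  set δ := (Y - 1) / 2 with hδ
  have hδ0 : 0 < δ := by rw [hδ]; linarith
  have hc : Continuous (fun Y : ℝ => 1 / 2 * ∫ u in (-1 : ℝ)..1,
      ((1 - u ^ 2) / (2 * max (Y - u) δ)) ^ l * (max (Y - u) δ)⁻¹) := by
    refine continuous_const.mul
      (intervalIntegral.continuous_parametric_intervalIntegral_of_continuous' ?_ _ _)
    have h : ∀ p : ℝ × ℝ, max (p.1 - p.2) δ ≠ 0 := fun p => (lt_max_of_lt_right hδ0).ne'
    have h' : ∀ p : ℝ × ℝ, 2 * max (p.1 - p.2) δ ≠ 0 := fun p => mul_ne_zero two_ne_zero (h p)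
    unfold Function.uncurry
    have c1 : Continuous fun p : ℝ × ℝ => max (p.1 - p.2) δ := by fun_prop
    exact ((Continuous.div (by fun_prop) (by fun_prop) h').pow l).mul (c1.inv₀ h)
  refine (hc.continuousAt.congr ?_).continuousWithinAt
  have : Set.Ioi (1 + δ) ∈ nhds Y := Ioi_mem_nhds (by rw [hδ]; linarith)
  filter_upwards [this] with Z hZ
  rw [Set.mem_Ioi] at hZ
  rw [legQ]
  congr 1
  refine intervalIntegral.integral_congr fun u hu => ?_
  rw [Set.uIcc_of_le (by norm_num)] at hu
  have : max (Z - u) δ = Z - u := max_eq_left (by linarith [hu.2])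
  simp only [this]

lemma legQ_zero (hY : 1 < Y) : legQ 0 Y = 1 / 2 * Real.log ((Y + 1) / (Y - 1)) := by
  have h : ∀ u ∈ Set.uIcc (-1 : ℝ) 1, HasDerivAt (fun u => -Real.log (Y - u)) ((Y - u)⁻¹) u := by
    intro u hu
    convert! (((hasDerivAt_id u).const_sub Y).log (sub_pos_of_mem_uIcc hY hu).ne').neg using 1
    simp only [id]; ring
  have h2 := intervalIntegral.integral_eq_sub_of_hasDerivAt h
    (continuousOn_legQ_inv hY).intervalIntegrable
  simp only [legQ, pow_zero, one_mul]
  rw [h2, Real.log_div (by linarith) (by linarith)]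
  ring_nf

/-- A Christoffel–Darboux formula for the partial sums of Heine's expansion of `1 / (Y - x)`. -/
lemma christoffel_darboux_heine (hY : 1 < Y) {x : ℝ} (hx : x ∈ Set.Icc (-1 : ℝ) 1) (N : ℕ) :
    1 - (Y - x) * ∑ l ∈ range (N + 1), (2 * l + 1) * legP l x * legQ l Y =
      (N + 1) * (legP (N + 1) x * legQ N Y - legP N x * legQ (N + 1) Y) := by
  induction N with
  | zero => simp [legP_zero, legP_one, legQ_one hY]; ring
  | succ N ih =>
    rw [Finset.sum_range_succ, mul_add, ← sub_sub, ih]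
    push_cast
    linear_combination (-legQ (N + 1) Y) * legP_recurrence N hx + legP (N + 1) x * legQ_recurrence hY N

end legQ
end HypFourier

namespace HypFourier
open Finset Real MeasureTheory

/-! ### A uniform bound for `(N + 1) ∫ Q_N (1 + k (1 - cos φ)) dφ` -/

lemma lintegral_inv_add_mul_sq {d c : ℝ} (hd : 0 < d) (hc : 0 < c) :
    ∫⁻ x : ℝ, ENNReal.ofReal ((d + c * x ^ 2)⁻¹) = ENNReal.ofReal (π / (√d * √c)) := by
  have hk : 0 < √c / √d := by positivity
  have heq : (fun x : ℝ => (d + c * x ^ 2)⁻¹) = fun x => d⁻¹ * (1 + (√c / √d * x) ^ 2)⁻¹ := by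
    funext x
    rw [mul_pow, div_pow, Real.sq_sqrt hd.le, Real.sq_sqrt hc.le, ← mul_inv]
    congr 1; field_simp
  have hi : Integrable (fun x : ℝ => (d + c * x ^ 2)⁻¹) := by
    rw [heq]; exact (integrable_inv_one_add_sq.comp_mul_left' hk.ne').const_mul _
  rw [← ofReal_integral_eq_lintegral_ofReal hi
    (Filter.Eventually.of_forall fun x => by simp only [Pi.zero_apply]; positivity)]
  congr 1
  rw [heq, integral_const_mul, Measure.integral_comp_mul_left (fun y : ℝ => (1 + y ^ 2)⁻¹),
    integral_univ_inv_one_add_sq, abs_of_pos (inv_pos.mpr hk), smul_eq_mul]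
  have : d = √d * √d := (Real.mul_self_sqrt hd.le).symm
  field_simp
  rw [Real.sq_sqrt hd.le]

/-- A primitive is `-(2/√n) arctan (√n √(1 - u))`, and `arctan < π/2`. -/
lemma lintegral_inv_sqrt_mul {n : ℝ} (hn : 0 < n) :
    ∫⁻ u in Set.Ioc (-1 : ℝ) 1, ENNReal.ofReal ((√(1 - u))⁻¹ * (1 + n * (1 - u))⁻¹) ≤
      ENNReal.ofReal (π / √n) := by
  have hc : ContinuousOn (fun u : ℝ => -(2 / √n) * Real.arctan (√n * √(1 - u))) (Set.uIcc (-1) 1) :=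
    Continuous.continuousOn (by fun_prop)
  have hn' : 0 < √n := Real.sqrt_pos.mpr hn
  have hd : ∀ u ∈ Set.Ioo (-1 : ℝ) 1, HasDerivAt (fun u : ℝ => -(2 / √n) *
      Real.arctan (√n * √(1 - u))) ((√(1 - u))⁻¹ * (1 + n * (1 - u))⁻¹) u := by
    intro u hu
    have h1 : 0 < 1 - u := by linarith [hu.2]
    have h2 := ((((hasDerivAt_id u).const_sub 1).sqrt h1.ne').const_mul (√n)).arctan.const_mul
      (-(2 / √n))
    convert! h2 using 1
    simp only [id]
    have h3 : 0 < √(1 - u) := Real.sqrt_pos.mpr h1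
    rw [mul_pow, Real.sq_sqrt hn.le, Real.sq_sqrt h1.le]
    field_simp
  have hpos : ∀ u : ℝ, u ∈ Set.Ioc (-1 : ℝ) 1 → 0 ≤ (√(1 - u))⁻¹ * (1 + n * (1 - u))⁻¹ := by
    intro u hu
    have h1 : 0 ≤ 1 - u := by linarith [hu.2]
    positivity
  have hi : IntervalIntegrable (fun u : ℝ => (√(1 - u))⁻¹ * (1 + n * (1 - u))⁻¹) volume (-1) 1 := by
    refine intervalIntegral.intervalIntegrable_deriv_of_nonneg hc ?_ ?_
    · simpa using hd
    · intro u hu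
      simp only [neg_le_self_iff, zero_le_one, inf_of_le_left, sup_of_le_right] at hu
      exact hpos u ⟨hu.1, hu.2.le⟩
  have hint := intervalIntegral.integral_eq_sub_of_hasDerivAt_of_le (by norm_num)
    (by simpa using hc) hd hi
  rw [← ofReal_integral_eq_lintegral_ofReal hi.1
    ((ae_restrict_iff' measurableSet_Ioc).mpr (Filter.Eventually.of_forall hpos)),
    ← intervalIntegral.integral_of_le (by norm_num), hint]
  apply ENNReal.ofReal_le_ofReal
  simp only [sub_self, Real.sqrt_zero, mul_zero, Real.arctan_zero, zero_sub]
  have := (Real.arctan_lt_pi_div_two (√n * √(1 - (-1)))).le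
  rw [neg_mul, neg_neg, div_mul_eq_mul_div]
  gcongr
  exact (mul_le_mul_of_nonneg_left this zero_le_two).trans_eq (by ring)

/-- With `d = 1 - u` the base is `(1 - d/2) · d/(d + e)`. Bernoulli's inequality, applied to each
factor separately, trades the `N`-th powers for rational functions with the correct scaling in `N`.
-/
lemma legQ_integrand_le {e u : ℝ} (he : 0 < e) (hu : u ∈ Set.Ioo (-1 : ℝ) 1) (N : ℕ) :
    ((1 - u ^ 2) / (2 * (1 + e - u))) ^ N * (1 + e - u)⁻¹ ≤
      2 * ((1 + (N + 1) / 2 * (1 - u))⁻¹ * ((1 - u) + (N + 1) * e)⁻¹) := by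
  set d := 1 - u with hd
  have hd0 : 0 < d := by rw [hd]; linarith [hu.2]
  have hd2 : d < 2 := by rw [hd]; linarith [hu.1]
  have hu' : u = 1 - d := by rw [hd]; ring
  have e1 : (1 - u ^ 2) / (2 * (1 + e - u)) = (1 - d / 2) * (d / (d + e)) := by
    rw [hu']
    have : 0 < d + e := by positivity
    rw [show 1 + e - (1 - d) = d + e by ring]
    field_simp; ring
  have e2 : 1 + e - u = d + e := by rw [hu']; ring
  rw [e1, e2, mul_pow, mul_assoc, ← mul_assoc 2]
  have hde : 0 < d + e := by positivity
  have b1 : (1 - d / 2) ^ N ≤ 2 * (1 + (N + 1) / 2 * d)⁻¹ := by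
    have h1 : 1 + (N : ℝ) * (d / 2) ≤ (1 + d / 2) ^ N :=
      one_add_mul_le_pow (by linarith) N
    have h2 : (1 - d / 2) ^ N * (1 + d / 2) ^ N ≤ 1 := by
      rw [← mul_pow]
      exact pow_le_one₀ (mul_nonneg (by linarith) (by linarith)) (by nlinarith)
    have h0 : 0 ≤ (1 - d / 2) ^ N := pow_nonneg (by linarith) N
    rw [← div_eq_mul_inv, le_div_iff₀ (by positivity)]
    have h3 : (1 - d / 2) ^ N * (1 + (N : ℝ) * (d / 2)) ≤ 1 :=
      (mul_le_mul_of_nonneg_left h1 h0).trans h2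
    have h4 : (1 - d / 2) ^ N * (d / 2) ≤ 1 := by
      have : (1 - d / 2) ^ N ≤ 1 := pow_le_one₀ (by linarith) (by linarith)
      nlinarith
    linarith
  have b2 : (d / (d + e)) ^ N * (d + e)⁻¹ ≤ (d + (N + 1) * e)⁻¹ := by
    have h1 : 1 + ((N + 1 : ℕ) : ℝ) * (e / d) ≤ (1 + e / d) ^ (N + 1) :=
      one_add_mul_le_pow (by have : 0 < e / d := by positivity
                             linarith) (N + 1)
    have h2 : (d / (d + e)) = (1 + e / d)⁻¹ := by field_simp
    have h3 : (d / (d + e)) ^ N * (d + e)⁻¹ = (d / (d + e)) ^ (N + 1) * d⁻¹ := by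
      rw [pow_succ]; field_simp
    rw [h3, h2, inv_pow, ← mul_inv]
    apply inv_anti₀ (by positivity)
    calc d + (N + 1) * e = (1 + ((N + 1 : ℕ) : ℝ) * (e / d)) * d := by push_cast; field_simp
      _ ≤ _ := mul_le_mul_of_nonneg_right h1 hd0.le
  exact mul_le_mul b1 b2 (by positivity) (by positivity)

/-- After Tonelli, the integrals over `φ` and over `u` each contribute a factor of order `(N +
1)^(-1/2)`. The resulting rate `1/(N + 1)` exactly balances the factor `N + 1` of the
Christoffel–Darboux remainder. Working with `lintegral` lets the same bound prove integrability. -/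
lemma lintegral_legQ_le {k : ℝ} (hk : 0 < k) (N : ℕ) :
    ∫⁻ φ in Set.Ioc 0 π, ENNReal.ofReal (legQ N (1 + k * (1 - Real.cos φ))) ≤
      ENNReal.ofReal (π ^ 3 / √k / (N + 1)) := by
  -- From `1 - cos φ ≥ 2φ²/π²` on `[0, π]`, which bounds the argument below by `1 + κ φ²`.
  set κ := k * (2 / π ^ 2) with hκ
  have hκ0 : 0 < κ := by positivity
  have hn : (0 : ℝ) < N + 1 := by positivity
  have hpt : ∀ φ ∈ Set.Ioc 0 π, ENNReal.ofReal (legQ N (1 + k * (1 - Real.cos φ))) ≤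
      ∫⁻ u in Set.Ioc (-1 : ℝ) 1, ENNReal.ofReal ((1 + (N + 1) / 2 * (1 - u))⁻¹ *
        ((1 - u) + (N + 1) * κ * φ ^ 2)⁻¹) := by
    intro φ hφ
    have he : 0 < κ * φ ^ 2 := by have := hφ.1; positivity
    have hle : 1 + κ * φ ^ 2 ≤ 1 + k * (1 - Real.cos φ) := by
      have := Real.cos_le_one_sub_mul_cos_sq (x := φ) (by rw [abs_of_pos hφ.1]; exact hφ.2)
      rw [hκ, mul_assoc]
      gcongr; linarith
    have h1 : 1 < 1 + κ * φ ^ 2 := by linarith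
    refine (ENNReal.ofReal_le_ofReal (legQ_anti h1 hle N)).trans ?_
    have hi := (intervalIntegrable_legQ h1 N).const_mul (1 / 2)
    rw [legQ, ← intervalIntegral.integral_const_mul, intervalIntegral.integral_of_le (by norm_num),
      ofReal_integral_eq_lintegral_ofReal hi.1]
    · refine lintegral_mono_ae ?_
      have h3 : ∀ᵐ u : ℝ, u ≠ 1 := by simp [ae_iff]
      filter_upwards [ae_restrict_mem measurableSet_Ioc, ae_restrict_of_ae h3] with u hu hu1
      apply ENNReal.ofReal_le_ofReal
      have := legQ_integrand_le he (u := u) ⟨hu.1, lt_of_le_of_ne hu.2 hu1⟩ N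
      rw [mul_assoc _ κ]
      linarith
    · rw [Filter.EventuallyLE, ae_restrict_iff' measurableSet_Ioc]
      refine Filter.Eventually.of_forall fun u hu => ?_
      have := legQ_integrand_nonneg h1 N (Set.Ioc_subset_Icc_self hu)
      simp only [Pi.zero_apply]; positivity
  calc _ ≤ ∫⁻ φ in Set.Ioc 0 π, ∫⁻ u in Set.Ioc (-1 : ℝ) 1,
          ENNReal.ofReal ((1 + (N + 1) / 2 * (1 - u))⁻¹ * ((1 - u) + (N + 1) * κ * φ ^ 2)⁻¹) :=
        setLIntegral_mono' measurableSet_Ioc hpt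
    _ = ∫⁻ u in Set.Ioc (-1 : ℝ) 1, ∫⁻ φ in Set.Ioc 0 π,
          ENNReal.ofReal ((1 + (N + 1) / 2 * (1 - u))⁻¹ * ((1 - u) + (N + 1) * κ * φ ^ 2)⁻¹) := by
        refine lintegral_lintegral_swap (Measurable.aemeasurable ?_)
        unfold Function.uncurry
        fun_prop
    _ ≤ ∫⁻ u in Set.Ioc (-1 : ℝ) 1, ENNReal.ofReal (π / √((N + 1) * κ)) *
          ENNReal.ofReal ((√(1 - u))⁻¹ * (1 + (N + 1) / 2 * (1 - u))⁻¹) := by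
        refine lintegral_mono_ae ?_
        have h3 : ∀ᵐ u : ℝ, u ≠ 1 := by simp [ae_iff]
        filter_upwards [ae_restrict_mem measurableSet_Ioc, ae_restrict_of_ae h3] with u hu hu1
        have hd : 0 < 1 - u := by have := lt_of_le_of_ne hu.2 hu1; linarith
        have h4 : 0 ≤ (1 + (N + 1) / 2 * (1 - u))⁻¹ := by positivity
        simp_rw [ENNReal.ofReal_mul h4]
        rw [lintegral_const_mul _ (by fun_prop)]
        -- Extending the range to the whole line leaves an explicit Cauchy integral.
        calc _ ≤ ENNReal.ofReal (1 + (N + 1) / 2 * (1 - u))⁻¹ * ∫⁻ φ : ℝ,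
                ENNReal.ofReal ((1 - u) + (N + 1) * κ * φ ^ 2)⁻¹ := by
              gcongr; exact Measure.restrict_le_self
          _ = _ := by
              rw [lintegral_inv_add_mul_sq hd (by positivity), ← ENNReal.ofReal_mul h4,
                ← ENNReal.ofReal_mul (by positivity)]
              congr 1
              field_simp
    _ ≤ ENNReal.ofReal (π / √((N + 1) * κ)) * ENNReal.ofReal (π / √((N + 1) / 2)) := by
        rw [lintegral_const_mul _ (by fun_prop)]
        gcongr
        exact lintegral_inv_sqrt_mul (by positivity)
    _ = _ := by
        rw [← ENNReal.ofReal_mul (by positivity)]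
        congr 1
        have h5 : √((N + 1) * κ) * √(((N : ℝ) + 1) / 2) = (N + 1) * √k / π := by
          rw [← Real.sqrt_mul (by positivity), Real.sqrt_eq_iff_mul_self_eq (by positivity)
            (by positivity), hκ]
          have := Real.mul_self_sqrt hk.le
          field_simp
          nlinarith
        rw [div_mul_div_comm, h5]
        field_simp

lemma integrableOn_legQ {k : ℝ} (hk : 0 < k) (N : ℕ) :
    IntegrableOn (fun φ => legQ N (1 + k * (1 - Real.cos φ))) (Set.Ioc 0 π) := by
  have hY : ∀ φ ∈ Set.Ioc 0 π, 1 < 1 + k * (1 - Real.cos φ) := by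
    intro φ hφ
    have : Real.cos φ < 1 := by
      rw [← Real.cos_zero]
      exact Real.cos_lt_cos_of_nonneg_of_le_pi le_rfl hφ.2 hφ.1
    have : 0 < 1 - Real.cos φ := by linarith
    have : 0 < k * (1 - Real.cos φ) := by positivity
    linarith
  refine ⟨ContinuousOn.aestronglyMeasurable ?_ measurableSet_Ioc, ?_⟩
  · exact (continuousOn_legQ N).comp (by fun_prop) hY
  · rw [hasFiniteIntegral_iff_ofReal]
    · exact (lintegral_legQ_le hk N).trans_lt ENNReal.ofReal_lt_top
    · rw [Filter.EventuallyLE, ae_restrict_iff' measurableSet_Ioc]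
      exact Filter.Eventually.of_forall fun φ hφ => legQ_nonneg (hY φ hφ) N

lemma setIntegral_legQ_le {k : ℝ} (hk : 0 < k) (N : ℕ) :
    ∫ φ in Set.Ioc 0 π, legQ N (1 + k * (1 - Real.cos φ)) ≤ π ^ 3 / √k / (N + 1) := by
  have h := lintegral_legQ_le hk N
  have hn : 0 ≤ᵐ[volume.restrict (Set.Ioc 0 π)] fun φ => legQ N (1 + k * (1 - Real.cos φ)) := by
    rw [Filter.EventuallyLE, ae_restrict_iff' measurableSet_Ioc]
    refine Filter.Eventually.of_forall fun φ hφ => legQ_nonneg ?_ N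
    have : Real.cos φ < 1 := by
      rw [← Real.cos_zero]
      exact Real.cos_lt_cos_of_nonneg_of_le_pi le_rfl hφ.2 hφ.1
    have : 0 < k * (1 - Real.cos φ) := mul_pos hk (by linarith)
    linarith
  rw [← ofReal_integral_eq_lintegral_ofReal (integrableOn_legQ hk N) hn] at h
  exact (ENNReal.ofReal_le_ofReal_iff (by positivity)).mp h

end HypFourier

namespace HypFourier
open Finset Real MeasureTheory

/-! ### The fundamental solution as an integral over `φ` -/

lemma integral_cos_div_sub_cos {c : ℝ} (hc : 1 < c) :
    ∫ φ in (0 : ℝ)..π, Real.cos φ / (c - Real.cos φ) = π * (c / √(c ^ 2 - 1) - 1) := by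
  have hS2 : √(c ^ 2 - 1) ^ 2 = c ^ 2 - 1 := Real.sq_sqrt (by nlinarith)
  have hS0 : 0 < √(c ^ 2 - 1) := Real.sqrt_pos.mpr (by nlinarith)
  set S := √(c ^ 2 - 1)
  -- The root of `q² - 2cq + 1 = 0` in `(0, 1)`, for which `1 - 2q cos φ + q² = 2q (c - cos φ)`.
  set q := c - S with hq
  have hSc : S < c := by nlinarith
  have hq0 : 0 < q := by rw [hq]; linarith
  have hq1 : q < 1 := by nlinarith
  have hqc : q ^ 2 - 2 * c * q + 1 = 0 := by rw [hq]; linear_combination hS2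
  have hden : ∀ φ : ℝ, 0 < 1 - q * Real.cos φ := fun φ => by nlinarith [Real.cos_le_one φ]
  have hcc : ∀ φ : ℝ, 0 < c - Real.cos φ := fun φ => by linarith [Real.cos_le_one φ]
  -- The arctangent is the argument of `1 / (1 - q e^{iφ})`. Unlike a primitive in `tan (φ/2)`, it
  -- is smooth on the closed interval and vanishes at both ends.
  have hd : ∀ φ ∈ Set.uIcc 0 π, HasDerivAt (fun φ : ℝ => c / S *
      (φ + 2 * Real.arctan (q * Real.sin φ / (1 - q * Real.cos φ))) - φ)
      (Real.cos φ / (c - Real.cos φ)) φ := by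
    intro φ _
    have h1 : HasDerivAt (fun φ : ℝ => q * Real.sin φ / (1 - q * Real.cos φ))
        ((q * Real.cos φ * (1 - q * Real.cos φ) - q * Real.sin φ * (q * Real.sin φ)) /
          (1 - q * Real.cos φ) ^ 2) φ := by
      refine ((Real.hasDerivAt_sin φ).const_mul q).div ?_ (hden φ).ne'
      convert! ((Real.hasDerivAt_cos φ).const_mul q).const_sub 1 using 1; ring
    have h2 := (((hasDerivAt_id φ).add (h1.arctan.const_mul 2)).const_mul (c / S)).sub
      (hasDerivAt_id φ)
    convert! h2 using 1
    have hs := Real.sin_sq_add_cos_sq φ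
    have e1 : 1 + (q * Real.sin φ / (1 - q * Real.cos φ)) ^ 2 =
        2 * q * (c - Real.cos φ) / (1 - q * Real.cos φ) ^ 2 := by
      have := (hden φ).ne'
      field_simp
      linear_combination q ^ 2 * hs + hqc
    have e2 : q * Real.cos φ * (1 - q * Real.cos φ) - q * Real.sin φ * (q * Real.sin φ) =
        q * (Real.cos φ - q) := by linear_combination (-q ^ 2) * hs
    have h3 := (hden φ).ne'
    have h4 := (hcc φ).ne'
    have e3 : 1 / (2 * q * (c - Real.cos φ) / (1 - q * Real.cos φ) ^ 2) *
        (q * (Real.cos φ - q) / (1 - q * Real.cos φ) ^ 2) =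
        (Real.cos φ - q) / (2 * (c - Real.cos φ)) := by field_simp
    rw [e1, e2, e3, hq]
    field_simp
    ring
  have hcont : Continuous fun φ : ℝ => Real.cos φ / (c - Real.cos φ) :=
    Continuous.div (by fun_prop) (by fun_prop) fun φ => (hcc φ).ne'
  rw [intervalIntegral.integral_eq_sub_of_hasDerivAt hd (hcont.intervalIntegrable _ _)]
  simp; ring

lemma tendsto_cosh_div_sinh :
    Filter.Tendsto (fun x => Real.cosh x / Real.sinh x) Filter.atTop (nhds 1) := by
  have h1 : Filter.Tendsto (fun x : ℝ => Real.exp (-(2 * x))) Filter.atTop (nhds 0) :=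
    Real.tendsto_exp_neg_atTop_nhds_zero.comp (Filter.tendsto_id.const_mul_atTop (by norm_num))
  have h2 : Filter.Tendsto (fun x : ℝ => (1 + Real.exp (-(2 * x))) / (1 - Real.exp (-(2 * x))))
      Filter.atTop (nhds ((1 + 0) / (1 - 0))) :=
    (h1.const_add 1).div (h1.const_sub 1) (by norm_num)
  simp only [add_zero, sub_zero, div_one] at h2
  refine h2.congr fun x => ?_
  have : Real.exp (-(2 * x)) = Real.exp (-x) / Real.exp x := by
    rw [← Real.exp_sub]; congr 1; ring
  rw [this, Real.cosh_eq, Real.sinh_eq]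
  have h3 := Real.exp_pos x
  rw [one_add_div h3.ne', one_sub_div h3.ne', div_div_div_cancel_right₀ h3.ne',
    div_div_div_cancel_right₀ two_ne_zero]

lemma radialIntegral_three {ρ : ℝ} (hρ : 0 < ρ) :
    radialIntegral 3 ρ = Real.cosh ρ / Real.sinh ρ - 1 := by
  have hd : ∀ x ∈ Set.Ici ρ, HasDerivAt (fun x => -(Real.cosh x / Real.sinh x))
      (1 / Real.sinh x ^ 2) x := by
    intro x hx
    have hs : Real.sinh x ≠ 0 := (Real.sinh_pos_iff.mpr (hρ.trans_le hx)).ne'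
    convert! ((Real.hasDerivAt_cosh x).div (Real.hasDerivAt_sinh x) hs).neg using 1
    have := Real.cosh_sq x
    field_simp
    linear_combination -this
  rw [radialIntegral, integral_Ioi_of_hasDerivAt_of_nonneg' hd (fun x _ => by positivity)
    tendsto_cosh_div_sinh.neg]
  ring

lemma minkowski_geodesicPolar (R r r' θ θ' ψ : ℝ) :
    minkowski (geodesicPolar R r θ ψ) (geodesicPolar R r' θ' 0) =
      R ^ 2 * (Real.cosh r * Real.cosh r' - Real.sinh r * Real.sinh r' * cosAngle θ θ' ψ) := by
  simp [minkowski, geodesicPolar, cosAngle]; ring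

/-- The normalization `4π · Γ(3/2) / (2 π^{3/2})` equals one and `R` cancels, so what remains is
`coth ρ - 1`. -/
lemma unnormFundSol_geodesicPolar {R r r' θ θ' ψ : ℝ} (hR : 0 < R)
    (h : 1 < Real.cosh r * Real.cosh r' - Real.sinh r * Real.sinh r' * cosAngle θ θ' ψ) :
    unnormFundSol R (geodesicPolar R r θ ψ) (geodesicPolar R r' θ' 0) =
      1 / π * ∫ φ in (0 : ℝ)..π, Real.cos φ / (Real.cosh r * Real.cosh r' -
        Real.sinh r * Real.sinh r' * cosAngle θ θ' ψ - Real.cos φ) := by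
  rw [integral_cos_div_sub_cos h, unnormFundSol, fundSol, hypDist, minkowski_geodesicPolar,
    mul_div_cancel_left₀ _ (by positivity : R ^ 2 ≠ 0), mul_div_cancel_left₀ _ hR.ne',
    radialIntegral_three (Real.arcosh_pos h), Real.cosh_arcosh h.le, Real.sinh_arcosh h.le]
  have h1 : Real.Gamma (3 / 2) = √π / 2 := by
    rw [show (3 / 2 : ℝ) = 1 / 2 + 1 by norm_num, Real.Gamma_add_one (by norm_num),
      Real.Gamma_one_half_eq]; ring
  have h2 : π ^ (3 / 2 : ℝ) = π * √π := by
    rw [show (3 / 2 : ℝ) = 1 + 1 / 2 by norm_num, Real.rpow_add Real.pi_pos, Real.rpow_one,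
      Real.sqrt_eq_rpow]
  rw [h1, h2]
  have h3 := Real.pi_pos
  have h4 : 0 < √π := Real.sqrt_pos.mpr h3
  field_simp
  ring

end HypFourier

namespace HypFourier
open Finset Real MeasureTheory

/-! ### Radial coefficients and their factorization -/

/-- The argument `Y(φ) = (cosh r cosh r' - cos φ) / (sinh r sinh r')`. -/
noncomputable def radialArg (r r' φ : ℝ) : ℝ :=
  (Real.cosh r * Real.cosh r' - Real.cos φ) / (Real.sinh r * Real.sinh r')

/-- The Legendre coefficient `a_l` of the fundamental solution, up to the factor `2 l + 1`. -/
noncomputable def radialCoeff (l : ℕ) (r r' : ℝ) : ℝ :=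
  1 / π * ∫ φ in (0 : ℝ)..π, Real.cos φ / (Real.sinh r * Real.sinh r') * legQ l (radialArg r r' φ)

lemma one_lt_radialArg {r r' : ℝ} (hr : 0 < r) (hr' : 0 < r') (h : r ≠ r') (φ : ℝ) :
    1 < radialArg r r' φ := by
  have h1 := Real.sinh_pos_iff.mpr hr
  have h2 := Real.sinh_pos_iff.mpr hr'
  rw [radialArg, lt_div_iff₀ (by positivity), one_mul]
  have h3 : 1 < Real.cosh (r - r') := Real.one_lt_cosh.mpr (sub_ne_zero.mpr h)
  rw [Real.cosh_sub] at h3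
  linarith [Real.cos_le_one φ]

lemma integral_neg_self_eq {E : Type*} [NormedAddCommGroup E] [NormedSpace ℝ E] {f : ℝ → E} {a : ℝ}
    (hf : ∀ b c, IntervalIntegrable f volume b c) :
    ∫ x in -a..a, f x = ∫ x in (0 : ℝ)..a, (f x + f (-x)) := by
  have h : IntervalIntegrable (fun x => f (-x)) volume 0 a := by
    have := (hf 0 (-a)).comp_sub_left 0; simpa using this
  rw [intervalIntegral.integral_add (hf _ _) h, intervalIntegral.integral_comp_neg,
    add_comm, neg_zero, intervalIntegral.integral_add_adjacent_intervals (hf _ _) (hf _ _)]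

/-! ### An integral for `Q_l` in which `φ` enters as an imaginary shift. -/

section Factorization

variable {r₁ r₂ : ℝ}

/-- The denominator `(cosh r₂ - cosh (s - iφ)) / sinh r₂`. -/
noncomputable def shiftDen (r₂ s φ : ℝ) : ℂ :=
  (Real.cosh r₂ - Complex.cosh (s - φ * Complex.I)) / Real.sinh r₂

/-- The real part of `cosh z` is `cosh (re z) cos (im z)`, which is below `cosh r₂`. This strip is
where the contour may move freely. -/
lemma cosh_sub_ne_zero {z : ℂ} (h : |z.re| < r₂) : (Real.cosh r₂ - Complex.cosh z : ℂ) ≠ 0 := by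
  intro h0
  have h1 := congrArg Complex.re h0
  have h2 : (Complex.cosh z).re = Real.cosh z.re * Real.cos z.im := by
    nth_rewrite 1 [← Complex.re_add_im z]
    rw [Complex.cosh_add, Complex.cosh_mul_I, Complex.sinh_mul_I, ← Complex.ofReal_cosh,
      ← Complex.ofReal_cos, ← Complex.ofReal_sinh, ← Complex.ofReal_sin]
    simp [-Complex.ofReal_cos, -Complex.ofReal_cosh, -Complex.ofReal_sin, -Complex.ofReal_sinh]
  rw [Complex.sub_re, h2, Complex.ofReal_re, Complex.zero_re] at h1
  have h3 : Real.cosh z.re < Real.cosh r₂ := by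
    rw [Real.cosh_lt_cosh]; exact h.trans_le (le_abs_self _)
  nlinarith [Real.cos_le_one z.im, Real.cosh_pos z.re]

lemma shiftDen_ne_zero (h₂ : 0 < r₂) {s : ℝ} (hs : |s| < r₂) (φ : ℝ) : shiftDen r₂ s φ ≠ 0 := by
  rw [shiftDen]
  refine div_ne_zero (cosh_sub_ne_zero (by simpa using hs)) ?_
  exact_mod_cast (Real.sinh_pos_iff.mpr h₂).ne'

lemma abs_lt_of_mem_uIcc (h₁ : 0 < r₁) (h : r₁ < r₂) {s : ℝ} (hs : s ∈ Set.uIcc (-r₁) r₁) :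
    |s| < r₂ := by
  rw [Set.uIcc_of_le (by linarith)] at hs
  exact (abs_le.mpr ⟨hs.1, hs.2⟩).trans_lt h

lemma hasDerivAt_cosh_shift (s φ : ℝ) : HasDerivAt (fun s : ℝ => Complex.cosh (s - φ * Complex.I))
    (Complex.sinh (s - φ * Complex.I)) s := by
  have h := (Complex.hasDerivAt_cosh (s - φ * Complex.I)).comp (s : ℂ)
    ((hasDerivAt_id (s : ℂ)).sub_const (φ * Complex.I))
  simpa [Function.comp_def] using h.comp_ofReal

lemma hasDerivAt_sinh_shift (s φ : ℝ) : HasDerivAt (fun s : ℝ => Complex.sinh (s - φ * Complex.I))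
    (Complex.cosh (s - φ * Complex.I)) s := by
  have h := (Complex.hasDerivAt_sinh (s - φ * Complex.I)).comp (s : ℂ)
    ((hasDerivAt_id (s : ℂ)).sub_const (φ * Complex.I))
  simpa [Function.comp_def] using h.comp_ofReal

/-- The condition `g' = (w - Y) v` of `integral_pow_mul_recurrence` as an algebraic identity, with
`p, p'` for `cosh s, sinh s` and `z, z'` for `cosh, sinh` of `s - iφ`. The relation for `c = cos φ`
is the subtraction formula for `s - (s - iφ) = iφ`. -/
lemma shift_deriv_identity {C₁ S₁ C₂ S₂ p p' z z' c : ℂ} (h₁ : S₁ ≠ 0) (h₂ : S₂ ≠ 0)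
    (hd : C₂ - z ≠ 0) (hC : C₂ ^ 2 = S₂ ^ 2 + 1) (hz : z ^ 2 = z' ^ 2 + 1)
    (hc : c = p * z - p' * z') :
    ((C₁ - p) / S₁ / ((C₂ - z) / S₂) - (C₁ * C₂ - c) / (S₁ * S₂)) * ((C₂ - z) / S₂)⁻¹ =
      -p / S₁ - ((-p' / S₁ * ((C₂ - z) / S₂) - (C₁ - p) / S₁ * (-z' / S₂)) / ((C₂ - z) / S₂) ^ 2 *
        (-z' / S₂) + (C₁ - p) / S₁ / ((C₂ - z) / S₂) * (-z / S₂)) := by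
  rw [hc]
  field_simp
  linear_combination (p - C₁) * hC + (C₁ - p) * hz

/-- The condition `g w' = (w² - 2Yw + 1) v` in the same notation. -/
lemma shift_discriminant_identity {C₁ S₁ C₂ S₂ p p' z z' c : ℂ} (h₁ : S₁ ≠ 0) (h₂ : S₂ ≠ 0)
    (hd : C₂ - z ≠ 0) (hC₁ : C₁ ^ 2 = S₁ ^ 2 + 1) (hC : C₂ ^ 2 = S₂ ^ 2 + 1)
    (hp : p ^ 2 = p' ^ 2 + 1) (hz : z ^ 2 = z' ^ 2 + 1) (hc : c = p * z - p' * z') :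
    (-p' / S₁ - (C₁ - p) / S₁ / ((C₂ - z) / S₂) * (-z' / S₂)) *
      ((-p' / S₁ * ((C₂ - z) / S₂) - (C₁ - p) / S₁ * (-z' / S₂)) / ((C₂ - z) / S₂) ^ 2) =
      (((C₁ - p) / S₁ / ((C₂ - z) / S₂)) ^ 2 -
        2 * ((C₁ * C₂ - c) / (S₁ * S₂)) * ((C₁ - p) / S₁ / ((C₂ - z) / S₂)) + 1) *
        ((C₂ - z) / S₂)⁻¹ := by
  rw [hc]
  field_simp
  linear_combination (C₂ - z) ^ 2 * (hC₁ - hp) + (C₁ - p) ^ 2 * (hC - hz)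

lemma shift_recurrence (h₁ : 0 < r₁) (h : r₁ < r₂) (φ : ℝ) :
    let J : ℕ → ℂ := fun l => 1 / 2 * ∫ s in -r₁..r₁,
      ((Real.cosh r₁ - Real.cosh s : ℝ) / Real.sinh r₁ / shiftDen r₂ s φ : ℂ) ^ l *
        (shiftDen r₂ s φ)⁻¹
    (∀ l : ℕ, (l + 2) * J (l + 2) - (2 * l + 3) * (radialArg r₁ r₂ φ : ℂ) * J (l + 1) +
      (l + 1) * J l = 0) ∧ J 1 = radialArg r₁ r₂ φ * J 0 - 1 := by
  intro J
  have h₂ : 0 < r₂ := h₁.trans h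
  have hS1 : (Real.sinh r₁ : ℂ) ≠ 0 := by exact_mod_cast (Real.sinh_pos_iff.mpr h₁).ne'
  have hS2 : (Real.sinh r₂ : ℂ) ≠ 0 := by exact_mod_cast (Real.sinh_pos_iff.mpr h₂).ne'
  have hq1 : (Real.cosh r₁ : ℂ) ^ 2 = (Real.sinh r₁ : ℂ) ^ 2 + 1 := by
    exact_mod_cast Real.cosh_sq r₁
  have hq2 : (Real.cosh r₂ : ℂ) ^ 2 = (Real.sinh r₂ : ℂ) ^ 2 + 1 := by
    exact_mod_cast Real.cosh_sq r₂
  have hY : (radialArg r₁ r₂ φ : ℂ) = (Real.cosh r₁ * Real.cosh r₂ - Real.cos φ) /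
      (Real.sinh r₁ * Real.sinh r₂) := by rw [radialArg]; push_cast; ring
  set z : ℝ → ℂ := fun s => Complex.cosh (s - φ * Complex.I) with hz
  set z' : ℝ → ℂ := fun s => Complex.sinh (s - φ * Complex.I) with hz'
  have hzz : ∀ s, z s ^ 2 = z' s ^ 2 + 1 := fun s => Complex.cosh_sq _
  have hpp : ∀ s : ℝ, (Real.cosh s : ℂ) ^ 2 = (Real.sinh s : ℂ) ^ 2 + 1 := fun s => by
    exact_mod_cast Real.cosh_sq s
  have hpz : ∀ s : ℝ, (Real.cos φ : ℂ) = Real.cosh s * z s - Real.sinh s * z' s := by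
    intro s
    rw [hz, hz', Complex.ofReal_cosh, Complex.ofReal_sinh, ← Complex.cosh_sub, sub_sub_cancel,
      Complex.cosh_mul_I, Complex.ofReal_cos]
  set D : ℝ → ℂ := fun s => shiftDen r₂ s φ with hD
  have hDz : ∀ s, D s = (Real.cosh r₂ - z s) / Real.sinh r₂ := fun s => rfl
  have hd0 : ∀ s ∈ Set.uIcc (-r₁) r₁, (Real.cosh r₂ - z s : ℂ) ≠ 0 := fun s hs =>
    cosh_sub_ne_zero (by simpa using abs_lt_of_mem_uIcc h₁ h hs)
  set N : ℝ → ℂ := fun s => (Real.cosh r₁ - Real.cosh s : ℝ) / Real.sinh r₁ with hN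
  have hD0 : ∀ s ∈ Set.uIcc (-r₁) r₁, D s ≠ 0 := fun s hs => div_ne_zero (hd0 s hs) hS2
  have dN : ∀ s, HasDerivAt N (-Real.sinh s / Real.sinh r₁) s := by
    intro s
    have := (((Real.hasDerivAt_cosh s).const_sub (Real.cosh r₁)).ofReal_comp).div_const
      (Real.sinh r₁ : ℂ)
    convert! this using 1; push_cast; ring
  have dN' : ∀ s : ℝ, HasDerivAt (fun s : ℝ => (-Real.sinh s / Real.sinh r₁ : ℂ))
      (-Real.cosh s / Real.sinh r₁) s := by
    intro s
    have := ((Real.hasDerivAt_sinh s).ofReal_comp).neg.div_const (Real.sinh r₁ : ℂ)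
    exact this
  have dD : ∀ s, HasDerivAt D (-z' s / Real.sinh r₂) s := fun s =>
    ((hasDerivAt_cosh_shift s φ).const_sub _).div_const _
  have dD' : ∀ s, HasDerivAt (fun s => -z' s / Real.sinh r₂) (-z s / Real.sinh r₂) s := fun s =>
    (hasDerivAt_sinh_shift s φ).neg.div_const _
  have dw : ∀ s ∈ Set.uIcc (-r₁) r₁, HasDerivAt (fun s => N s / D s)
      ((-Real.sinh s / Real.sinh r₁ * D s - N s * (-z' s / Real.sinh r₂)) / D s ^ 2) s :=
    fun s hs => (dN s).div (dD s) (hD0 s hs)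
  have hg : ∀ s ∈ Set.uIcc (-r₁) r₁, HasDerivAt
      (fun s => -Real.sinh s / Real.sinh r₁ - N s / D s * (-z' s / Real.sinh r₂))
      ((N s / D s - radialArg r₁ r₂ φ) * (D s)⁻¹) s := by
    intro s hs
    convert! (dN' s).sub ((dw s hs).mul (dD' s)) using 1
    rw [hY, hDz]
    simp only [hN, Complex.ofReal_sub]
    exact shift_deriv_identity hS1 hS2 (hd0 s hs) hq2 (hzz s) (hpz s)
  have hrel : ∀ s ∈ Set.uIcc (-r₁) r₁,
      (-Real.sinh s / Real.sinh r₁ - N s / D s * (-z' s / Real.sinh r₂)) *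
      ((-Real.sinh s / Real.sinh r₁ * D s - N s * (-z' s / Real.sinh r₂)) / D s ^ 2) =
      ((N s / D s) ^ 2 - 2 * radialArg r₁ r₂ φ * (N s / D s) + 1) * (D s)⁻¹ := by
    intro s hs
    rw [hY, hDz]
    simp only [hN, Complex.ofReal_sub]
    exact shift_discriminant_identity hS1 hS2 (hd0 s hs) hq1 hq2 (hpp s) (hzz s) (hpz s)
  have hv : ContinuousOn (fun s => (D s)⁻¹) (Set.uIcc (-r₁) r₁) := fun s hs =>
    ((dD s).continuousAt.inv₀ (hD0 s hs)).continuousWithinAt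
  have hwc : ContinuousOn (fun s => N s / D s) (Set.uIcc (-r₁) r₁) := fun s hs =>
    (dw s hs).continuousAt.continuousWithinAt
  have hNa : N (-r₁) / D (-r₁) = 0 := by simp [hN]
  have hNb : N r₁ / D r₁ = 0 := by simp [hN]
  constructor
  · intro l
    have := integral_pow_mul_recurrence dw hg hrel hv hNa hNb l
    simp only [J]
    linear_combination (1 / 2 : ℂ) * this
  · have := integral_mul_sub_integral hg hwc hv
    rw [hNa, hNb] at this
    have e1 : (-Real.sinh r₁ / Real.sinh r₁ : ℂ) = -1 := by field_simp
    have e2 : (-Real.sinh (-r₁) / Real.sinh r₁ : ℂ) = 1 := by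
      rw [Real.sinh_neg, Complex.ofReal_neg, neg_neg]; field_simp
    rw [e1, e2] at this
    simp only [J, pow_one, pow_zero, one_mul]
    linear_combination (1 / 2 : ℂ) * this

end Factorization
end HypFourier

/-! ### The base case of the shifted integral, and the contour shift. -/

namespace HypFourier
open Finset Real MeasureTheory

section Factorization

variable {r₁ r₂ : ℝ}

/-- Keeps the principal logarithm differentiable along the path in `shift_integral_zero`; there `v =
±φ/2`, which is why `φ` is confined to `[-π, π]`. -/
lemma sinh_mem_slitPlane {u v : ℝ} (hu : 0 < u) (hv : v ∈ Set.Icc (-(π / 2)) (π / 2)) :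
    Complex.sinh (u + v * Complex.I) ∈ Complex.slitPlane := by
  have hre : (Complex.sinh (u + v * Complex.I)).re = Real.sinh u * Real.cos v := by
    rw [Complex.sinh_add, Complex.cosh_mul_I, Complex.sinh_mul_I, ← Complex.ofReal_cosh,
      ← Complex.ofReal_cos, ← Complex.ofReal_sinh, ← Complex.ofReal_sin]
    simp [-Complex.ofReal_cos, -Complex.ofReal_cosh, -Complex.ofReal_sin, -Complex.ofReal_sinh]
  have him : (Complex.sinh (u + v * Complex.I)).im = Real.cosh u * Real.sin v := by
    rw [Complex.sinh_add, Complex.cosh_mul_I, Complex.sinh_mul_I, ← Complex.ofReal_cosh,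
      ← Complex.ofReal_cos, ← Complex.ofReal_sinh, ← Complex.ofReal_sin]
    simp [-Complex.ofReal_cos, -Complex.ofReal_cosh, -Complex.ofReal_sin, -Complex.ofReal_sinh]
  rw [Complex.mem_slitPlane_iff, hre, him]
  have hs := Real.sinh_pos_iff.mpr hu
  have hc := Real.cosh_pos u
  by_cases h : Real.sin v = 0
  · left
    have h1 := Real.cos_nonneg_of_mem_Icc hv
    have h2 := Real.sin_sq_add_cos_sq v
    have h3 : 0 < Real.cos v := lt_of_le_of_ne h1 fun h0 => by rw [h, ← h0] at h2; norm_num at h2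
    positivity
  · right; exact mul_ne_zero hc.ne' h

lemma norm_sq_sinh (u v : ℝ) :
    ‖Complex.sinh (u + v * Complex.I)‖ ^ 2 = (Real.cosh (2 * u) - Real.cos (2 * v)) / 2 := by
  have h : Complex.sinh (u + v * Complex.I) = ((Real.sinh u * Real.cos v : ℝ) : ℂ) +
      ((Real.cosh u * Real.sin v : ℝ) : ℂ) * Complex.I := by
    rw [Complex.sinh_add, Complex.cosh_mul_I, Complex.sinh_mul_I]; push_cast; ring
  rw [h, Complex.sq_norm, Complex.normSq_add_mul_I, Real.cosh_two_mul, Real.cos_two_mul]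
  linear_combination (Real.sinh u ^ 2 + 1) * Real.sin_sq_add_cos_sq v +
    (Real.sin v ^ 2 - 1 / 2) * Real.cosh_sq u

lemma log_add_log_conj {z : ℂ} (hz : z ∈ Complex.slitPlane) :
    Complex.log z + Complex.log ((starRingEnd ℂ) z) = ((Real.log (‖z‖ ^ 2) : ℝ) : ℂ) := by
  rw [Complex.log_conj _ (Complex.mem_slitPlane_iff_arg.mp hz).1, Complex.add_conj, Complex.log_re,
    Real.log_pow]
  push_cast; ring

lemma conj_sinh (u v : ℝ) : (starRingEnd ℂ) (Complex.sinh (u + v * Complex.I)) =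
    Complex.sinh (u + (-v : ℝ) * Complex.I) := by
  rw [← Complex.sinh_conj]
  congr 1
  simp

/-- With `A = (r₂ + s - iφ)/2` and `B = (r₂ - s + iφ)/2` the integrand is `sinh (A + B) / (2 sinh A
sinh B)`, with primitive `log sinh A - log sinh B`. The four endpoint values form two conjugate
pairs, so their sum is a real logarithm, namely `log ((Y + 1)/(Y - 1))`. -/
lemma shift_integral_zero (h₁ : 0 < r₁) (h : r₁ < r₂) {φ : ℝ} (hφ : φ ∈ Set.Icc (-π) π) :
    1 / 2 * ∫ s in -r₁..r₁, (shiftDen r₂ s φ)⁻¹ = (legQ 0 (radialArg r₁ r₂ φ) : ℂ) := by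
  have h₂ : 0 < r₂ := h₁.trans h
  have hS1 := Real.sinh_pos_iff.mpr h₁
  have hS2 := Real.sinh_pos_iff.mpr h₂
  have hv : -(φ / 2) ∈ Set.Icc (-(π / 2)) (π / 2) := ⟨by linarith [hφ.2], by linarith [hφ.1]⟩
  have hv' : φ / 2 ∈ Set.Icc (-(π / 2)) (π / 2) := ⟨by linarith [hφ.1], by linarith [hφ.2]⟩
  have hA : ∀ s ∈ Set.uIcc (-r₁) r₁,
      Complex.sinh (((r₂ + s) / 2 : ℝ) + (-(φ / 2) : ℝ) * Complex.I) ∈ Complex.slitPlane := fun s hs =>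
    sinh_mem_slitPlane (by have := abs_lt.mp (abs_lt_of_mem_uIcc h₁ h hs); linarith [this.1]) hv
  have hB : ∀ s ∈ Set.uIcc (-r₁) r₁,
      Complex.sinh (((r₂ - s) / 2 : ℝ) + (φ / 2 : ℝ) * Complex.I) ∈ Complex.slitPlane := fun s hs =>
    sinh_mem_slitPlane (by have := abs_lt.mp (abs_lt_of_mem_uIcc h₁ h hs); linarith [this.2]) hv'
  have hd : ∀ s ∈ Set.uIcc (-r₁) r₁, HasDerivAt (fun s : ℝ =>
      Complex.log (Complex.sinh (((r₂ + s) / 2 : ℝ) + (-(φ / 2) : ℝ) * Complex.I)) -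
      Complex.log (Complex.sinh (((r₂ - s) / 2 : ℝ) + (φ / 2 : ℝ) * Complex.I)))
      ((shiftDen r₂ s φ)⁻¹) s := by
    intro s hs
    have d1 : HasDerivAt (fun s : ℝ => (((r₂ + s) / 2 : ℝ) : ℂ) + (-(φ / 2) : ℝ) * Complex.I)
        (1 / 2 : ℂ) s := by
      have := ((((hasDerivAt_id s).const_add r₂).div_const 2).ofReal_comp).add_const
        (((-(φ / 2) : ℝ) : ℂ) * Complex.I)
      convert! this using 1; push_cast; rfl
    have d2 : HasDerivAt (fun s : ℝ => (((r₂ - s) / 2 : ℝ) : ℂ) + (φ / 2 : ℝ) * Complex.I)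
        (-1 / 2 : ℂ) s := by
      have := ((((hasDerivAt_id s).const_sub r₂).div_const 2).ofReal_comp).add_const
        (((φ / 2 : ℝ) : ℂ) * Complex.I)
      convert! this using 1; push_cast; rfl
    have l1 := (((Complex.hasDerivAt_sinh _).comp_of_eq s d1 rfl).clog_real (hA s hs))
    have l2 := (((Complex.hasDerivAt_sinh _).comp_of_eq s d2 rfl).clog_real (hB s hs))
    convert! l1.sub l2 using 1
    simp only [Function.comp_apply]
    set A : ℂ := (((r₂ + s) / 2 : ℝ) : ℂ) + (-(φ / 2) : ℝ) * Complex.I with hAdef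
    set B : ℂ := (((r₂ - s) / 2 : ℝ) : ℂ) + (φ / 2 : ℝ) * Complex.I with hBdef
    have hA0 : Complex.sinh A ≠ 0 := Complex.slitPlane_ne_zero (hA s hs)
    have hB0 : Complex.sinh B ≠ 0 := Complex.slitPlane_ne_zero (hB s hs)
    have hAB : A + B = r₂ := by rw [hAdef, hBdef]; push_cast; ring
    have hAB' : A - B = s - φ * Complex.I := by rw [hAdef, hBdef]; push_cast; ring
    have hS2' : Complex.sinh (A + B) ≠ 0 := by
      rw [hAB, ← Complex.ofReal_sinh]; exact_mod_cast hS2.ne'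
    have e : shiftDen r₂ s φ = 2 * Complex.sinh A * Complex.sinh B / Complex.sinh (A + B) := by
      rw [shiftDen, Complex.ofReal_cosh, Complex.ofReal_sinh, ← hAB, ← hAB', Complex.cosh_add,
        Complex.cosh_sub]
      ring
    rw [e, inv_div]
    field_simp
    rw [Complex.sinh_add]; ring
  have hcont : ContinuousOn (fun s => (shiftDen r₂ s φ)⁻¹) (Set.uIcc (-r₁) r₁) := fun s hs =>
    ((((hasDerivAt_cosh_shift s φ).const_sub _).div_const _).continuousAt.inv₀
      (shiftDen_ne_zero h₂ (abs_lt_of_mem_uIcc h₁ h hs) φ)).continuousWithinAt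
  rw [intervalIntegral.integral_eq_sub_of_hasDerivAt hd hcont.intervalIntegrable]
  have hα := log_add_log_conj (hA r₁ Set.right_mem_uIcc)
  have hβ := log_add_log_conj (hA (-r₁) Set.left_mem_uIcc)
  rw [conj_sinh, norm_sq_sinh, neg_neg] at hα hβ
  rw [sub_neg_eq_add, ← sub_eq_add_neg] at *
  rw [show Complex.log (Complex.sinh (((r₂ + r₁) / 2 : ℝ) + (-(φ / 2) : ℝ) * Complex.I)) -
      Complex.log (Complex.sinh (((r₂ - r₁) / 2 : ℝ) + (φ / 2 : ℝ) * Complex.I)) -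
      (Complex.log (Complex.sinh (((r₂ - r₁) / 2 : ℝ) + (-(φ / 2) : ℝ) * Complex.I)) -
      Complex.log (Complex.sinh (((r₂ + r₁) / 2 : ℝ) + (φ / 2 : ℝ) * Complex.I))) =
      (Complex.log (Complex.sinh (((r₂ + r₁) / 2 : ℝ) + (-(φ / 2) : ℝ) * Complex.I)) +
      Complex.log (Complex.sinh (((r₂ + r₁) / 2 : ℝ) + (φ / 2 : ℝ) * Complex.I))) -
      (Complex.log (Complex.sinh (((r₂ - r₁) / 2 : ℝ) + (-(φ / 2) : ℝ) * Complex.I)) +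
      Complex.log (Complex.sinh (((r₂ - r₁) / 2 : ℝ) + (φ / 2 : ℝ) * Complex.I))) by ring, hα, hβ,
    legQ_zero (one_lt_radialArg h₁ h₂ h.ne φ)]
  have e1 : 2 * ((r₂ + r₁) / 2) = r₂ + r₁ := by ring
  have e2 : 2 * ((r₂ - r₁) / 2) = r₂ - r₁ := by ring
  have e3 : Real.cos (2 * -(φ / 2)) = Real.cos φ := by
    rw [show 2 * -(φ / 2) = -φ by ring, Real.cos_neg]
  have h3 : 1 < Real.cosh (r₂ - r₁) := Real.one_lt_cosh.mpr (by linarith)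
  have h4 : 1 < Real.cosh (r₂ + r₁) := Real.one_lt_cosh.mpr (by linarith)
  have h5 := Real.cos_le_one φ
  rw [e1, e2, e3, ← Complex.ofReal_sub, ← Real.log_div (by linarith) (by linarith)]
  have e4 : (radialArg r₁ r₂ φ + 1) / (radialArg r₁ r₂ φ - 1) =
      (Real.cosh (r₂ + r₁) - Real.cos φ) / 2 / ((Real.cosh (r₂ - r₁) - Real.cos φ) / 2) := by
    rw [div_div_div_cancel_right₀ two_ne_zero]
    have h6 : Real.cosh (r₂ - r₁) - Real.cos φ ≠ 0 := by linarith
    have h7 : radialArg r₁ r₂ φ - 1 ≠ 0 := by linarith [one_lt_radialArg h₁ h₂ h.ne φ]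
    rw [div_eq_div_iff h7 h6, radialArg, Real.cosh_add, Real.cosh_sub]
    field_simp
    ring
  rw [e4]
  push_cast
  ring

/-- Both sides solve the same three-term recurrence with the same values at `l = 0` and `l = 1`, so
no change of contour in the defining integral is needed. -/
lemma shift_integral_eq_legQ (h₁ : 0 < r₁) (h : r₁ < r₂) {φ : ℝ} (hφ : φ ∈ Set.Icc (-π) π) (l : ℕ) :
    1 / 2 * ∫ s in -r₁..r₁, ((Real.cosh r₁ - Real.cosh s : ℝ) / Real.sinh r₁ / shiftDen r₂ s φ : ℂ) ^ l *
        (shiftDen r₂ s φ)⁻¹ = (legQ l (radialArg r₁ r₂ φ) : ℂ) := by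
  obtain ⟨hrec, h1⟩ := shift_recurrence h₁ h φ
  have hY := one_lt_radialArg h₁ (h₁.trans h) h.ne φ
  have h0 := shift_integral_zero h₁ h hφ
  refine eq_of_recurrence (𝕜 := ℂ) (Y := (radialArg r₁ r₂ φ : ℂ))
    (p := fun l => 1 / 2 * ∫ s in -r₁..r₁,
      ((Real.cosh r₁ - Real.cosh s : ℝ) / Real.sinh r₁ / shiftDen r₂ s φ : ℂ) ^ l *
        (shiftDen r₂ s φ)⁻¹) (q := fun l => (legQ l (radialArg r₁ r₂ φ) : ℂ)) ?_ ?_ hrec ?_ l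
  · simp only [pow_zero, one_mul]; exact h0
  · refine h1.trans ?_
    rw [legQ_one hY]
    simp only [pow_zero, one_mul]
    rw [h0]; push_cast; ring
  · intro l
    have := legQ_recurrence hY l
    exact_mod_cast this

/-- Cauchy's theorem on the rectangle with real parts between `0` and `s` and imaginary parts in
`[-π, π]`. The integrand is `2πi`-periodic, so the horizontal sides cancel. This is where the
dependence on `s` and on `r₂` separates. -/
lemma integral_exp_mul_shiftDen (h₂ : 0 < r₂) {s : ℝ} (hs : |s| < r₂) (l : ℕ) :
    ∫ φ in -π..π, Complex.exp (φ * Complex.I) * ((shiftDen r₂ s φ)⁻¹) ^ (l + 1) =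
      Complex.exp s * ∫ φ in -π..π, Complex.exp (φ * Complex.I) * ((shiftDen r₂ 0 φ)⁻¹) ^ (l + 1) := by
  set f : ℂ → ℂ := fun z => Complex.exp (-z) *
    (((Real.cosh r₂ - Complex.cosh z) / Real.sinh r₂)⁻¹) ^ (l + 1) with hf
  have hS2 : (Real.sinh r₂ : ℂ) ≠ 0 := by exact_mod_cast (Real.sinh_pos_iff.mpr h₂).ne'
  have hper : ∀ z, f (z + 2 * π * Complex.I) = f z := by
    intro z
    have h1 : Complex.cosh (z + 2 * π * Complex.I) = Complex.cosh z := by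
      rw [Complex.cosh_add, Complex.cosh_mul_I, Complex.sinh_mul_I]; simp
    have h2 : Complex.exp (-(z + 2 * π * Complex.I)) = Complex.exp (-z) := by
      rw [neg_add, Complex.exp_add, Complex.exp_neg (2 * π * Complex.I), Complex.exp_two_pi_mul_I]
      simp
    simp only [hf, h1, h2]
  have hrect := Complex.integral_boundary_rect_eq_zero_of_differentiableOn f
    (((0 : ℝ) : ℂ) + ((-π : ℝ) : ℂ) * Complex.I) ((s : ℂ) + (π : ℂ) * Complex.I) ?_
  · simp only [Complex.add_re, Complex.ofReal_re, Complex.mul_re, Complex.I_re, mul_zero,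
      Complex.ofReal_im, Complex.I_im, mul_one, sub_self, add_zero, Complex.add_im, Complex.mul_im,
      zero_add] at hrect
    have hhor : ∫ x in (0 : ℝ)..s, f (x + (π : ℂ) * Complex.I) =
        ∫ x in (0 : ℝ)..s, f (x + ((-π : ℝ) : ℂ) * Complex.I) := by
      refine intervalIntegral.integral_congr fun x _ => ?_
      rw [← hper (x + ((-π : ℝ) : ℂ) * Complex.I)]
      congr 1; push_cast; ring
    rw [hhor, sub_self, zero_add, sub_eq_zero, smul_right_inj Complex.I_ne_zero] at hrect
    -- `shiftDen` contains `s - iφ` while the contour is `t + iφ`, so the sign of `φ` is reversed;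
    -- `e^{-z}` then splits into `e^{-t} e^{iφ}`.
    have hflip : ∀ t : ℝ, ∫ φ in -π..π, f (t + φ * Complex.I) =
        ∫ φ in -π..π, Complex.exp (-t) * (Complex.exp (φ * Complex.I) *
          ((shiftDen r₂ t φ)⁻¹) ^ (l + 1)) := by
      intro t
      have := intervalIntegral.integral_comp_neg (a := -π) (b := π)
        (fun φ : ℝ => f (t + φ * Complex.I))
      rw [neg_neg] at this
      rw [← this]
      refine intervalIntegral.integral_congr fun φ _ => ?_
      simp only [hf, shiftDen]
      rw [← mul_assoc, ← Complex.exp_add]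
      push_cast
      congr 2
      · ring
      · rw [show (t : ℂ) + -φ * Complex.I = t - φ * Complex.I by ring]
    rw [hflip, hflip, intervalIntegral.integral_const_mul, intervalIntegral.integral_const_mul] at hrect
    simp only [Complex.ofReal_zero, neg_zero, Complex.exp_zero, one_mul] at hrect
    rw [← hrect, ← mul_assoc, ← Complex.exp_add]
    simp
  · intro z hz
    have hz' : |z.re| < r₂ := by
      rw [Complex.mem_reProdIm] at hz
      have := hz.1
      simp only [Complex.add_re, Complex.ofReal_re, Complex.mul_re, Complex.I_re, mul_zero,
        Complex.ofReal_im, Complex.I_im, mul_one, sub_self, add_zero] at this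
      rw [abs_lt] at hs ⊢
      rcases Set.mem_uIcc.mp this with h | h
      · exact ⟨by linarith [h.1], by linarith [h.2]⟩
      · exact ⟨by linarith [h.1], by linarith [h.2]⟩
    have h0 : ((Real.cosh r₂ - Complex.cosh z) / Real.sinh r₂ : ℂ) ≠ 0 :=
      div_ne_zero (cosh_sub_ne_zero hz') hS2
    apply DifferentiableAt.differentiableWithinAt
    have hd : DifferentiableAt ℂ (fun z => (Real.cosh r₂ - Complex.cosh z) / (Real.sinh r₂ : ℂ)) z := by
      fun_prop
    exact (by fun_prop : DifferentiableAt ℂ (fun z => Complex.exp (-z)) z).mul ((hd.inv h0).pow _)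

end Factorization
end HypFourier

/-! ### Separation of the radial coefficient into inner and outer factors. -/

namespace HypFourier
open Finset Real MeasureTheory

section Factorization

variable {r₁ r₂ : ℝ}

/-- The radial factor `∫₀^r ((cosh r - cosh s) / sinh r)^l cosh s ds`, regular at the origin. -/
noncomputable def innerRadial (l : ℕ) (r : ℝ) : ℝ :=
  ∫ s in (0 : ℝ)..r, ((Real.cosh r - Real.cosh s) / Real.sinh r) ^ l * Real.cosh s

/-- The radial factor `∫₀^π cos φ (sinh r / (cosh r - cos φ))^{l+1} dφ`, decaying at infinity. -/
noncomputable def outerRadial (l : ℕ) (r : ℝ) : ℝ :=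
  ∫ φ in (0 : ℝ)..π, Real.cos φ * (Real.sinh r / (Real.cosh r - Real.cos φ)) ^ (l + 1)

lemma continuous_radialArg (r r' : ℝ) : Continuous (radialArg r r') := by
  unfold radialArg; fun_prop

lemma exp_add_exp_neg_mul_I (φ : ℝ) :
    Complex.exp (φ * Complex.I) + Complex.exp ((-φ : ℝ) * Complex.I) = 2 * (Real.cos φ : ℂ) := by
  rw [(cos_sin_exp φ).1]; push_cast; rw [neg_mul]; ring

lemma integral_exp_mul_shiftDen_zero (h₂ : 0 < r₂) (l : ℕ) :
    ∫ φ in -π..π, Complex.exp (φ * Complex.I) * ((shiftDen r₂ 0 φ)⁻¹) ^ (l + 1) =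
      2 * (outerRadial l r₂ : ℂ) := by
  have hden : ∀ φ : ℝ, Real.cosh r₂ - Real.cos φ ≠ 0 := fun φ => by
    have := Real.one_lt_cosh.mpr h₂.ne'
    have := Real.cos_le_one φ
    linarith
  have hr : ∀ φ : ℝ, (shiftDen r₂ 0 φ)⁻¹ =
      ((Real.sinh r₂ / (Real.cosh r₂ - Real.cos φ) : ℝ) : ℂ) := by
    intro φ
    rw [shiftDen, Complex.ofReal_zero, zero_sub, Complex.cosh_neg, Complex.cosh_mul_I, inv_div]
    push_cast; rfl
  simp_rw [hr]
  have hc : Continuous fun φ : ℝ => Complex.exp (φ * Complex.I) *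
      ((Real.sinh r₂ / (Real.cosh r₂ - Real.cos φ) : ℝ) : ℂ) ^ (l + 1) := by
    have : Continuous fun φ : ℝ => Real.sinh r₂ / (Real.cosh r₂ - Real.cos φ) :=
      Continuous.div (by fun_prop) (by fun_prop) hden
    fun_prop
  rw [integral_neg_self_eq fun b c => hc.intervalIntegrable b c, outerRadial,
    ← intervalIntegral.integral_ofReal, ← intervalIntegral.integral_const_mul]
  refine intervalIntegral.integral_congr fun φ _ => ?_
  simp only [Real.cos_neg]
  rw [← add_mul, exp_add_exp_neg_mul_I]
  push_cast
  ring

lemma integral_pow_mul_exp (r : ℝ) (l : ℕ) :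
    ∫ s in -r..r, ((Real.cosh r - Real.cosh s : ℝ) / Real.sinh r : ℂ) ^ l * Complex.exp s =
      2 * (innerRadial l r : ℂ) := by
  have hc : Continuous fun s : ℝ => ((Real.cosh r - Real.cosh s : ℝ) / Real.sinh r : ℂ) ^ l *
      Complex.exp s := by fun_prop
  rw [integral_neg_self_eq fun b c => hc.intervalIntegrable b c, innerRadial,
    ← intervalIntegral.integral_ofReal, ← intervalIntegral.integral_const_mul]
  refine intervalIntegral.integral_congr fun s _ => ?_
  simp only [Real.cosh_neg]
  rw [← mul_add]
  have : Complex.exp s + Complex.exp ((-s : ℝ) : ℂ) = 2 * (Real.cosh s : ℂ) := by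
    rw [Complex.ofReal_cosh, Complex.cosh]; push_cast; ring
  rw [this]
  push_cast
  ring

/-- By evenness in `φ`, `cos φ` may be replaced by `e^{iφ}` on `[-π, π]`. After Fubini the contour
shift makes the `φ`-integral equal to `e^s` times a quantity independent of `s`, leaving a product.
-/
lemma integral_cos_mul_legQ (h₁ : 0 < r₁) (h : r₁ < r₂) (l : ℕ) :
    ∫ φ in (0 : ℝ)..π, Real.cos φ * legQ l (radialArg r₁ r₂ φ) =
      innerRadial l r₁ * outerRadial l r₂ := by
  have h₂ := h₁.trans h
  have hQ : Continuous fun φ => legQ l (radialArg r₁ r₂ φ) := by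
    rw [← continuousOn_univ]
    exact (continuousOn_legQ l).comp (continuous_radialArg _ _).continuousOn
      fun φ _ => one_lt_radialArg h₁ h₂ h.ne φ
  have hcQ : Continuous fun φ : ℝ => Complex.exp (φ * Complex.I) *
      ((legQ l (radialArg r₁ r₂ φ) : ℝ) : ℂ) := by fun_prop
  have e1 : ∫ φ in -π..π, Complex.exp (φ * Complex.I) * ((legQ l (radialArg r₁ r₂ φ) : ℝ) : ℂ) =
      2 * ((∫ φ in (0 : ℝ)..π, Real.cos φ * legQ l (radialArg r₁ r₂ φ) : ℝ) : ℂ) := by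
    rw [integral_neg_self_eq fun b c => hcQ.intervalIntegrable b c,
      ← intervalIntegral.integral_ofReal, ← intervalIntegral.integral_const_mul]
    refine intervalIntegral.integral_congr fun φ _ => ?_
    have : radialArg r₁ r₂ (-φ) = radialArg r₁ r₂ φ := by rw [radialArg, radialArg, Real.cos_neg]
    simp only [this]
    rw [← add_mul, exp_add_exp_neg_mul_I]
    push_cast
    ring
  set N : ℝ → ℂ := fun s => (Real.cosh r₁ - Real.cosh s : ℝ) / Real.sinh r₁ with hN
  have e2 : ∫ φ in -π..π, Complex.exp (φ * Complex.I) * ((legQ l (radialArg r₁ r₂ φ) : ℝ) : ℂ) =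
      ∫ φ in -π..π, ∫ s in -r₁..r₁, 1 / 2 * (N s ^ l *
        (Complex.exp (φ * Complex.I) * ((shiftDen r₂ s φ)⁻¹) ^ (l + 1))) := by
    refine intervalIntegral.integral_congr fun φ hφ => ?_
    rw [Set.uIcc_of_le (by linarith [Real.pi_pos])] at hφ
    rw [← shift_integral_eq_legQ h₁ h hφ l, ← mul_assoc, ← intervalIntegral.integral_const_mul]
    refine intervalIntegral.integral_congr fun s _ => ?_
    simp only [hN]
    rw [div_pow _ (shiftDen r₂ s φ), div_eq_mul_inv _ (shiftDen r₂ s φ ^ l), ← inv_pow, pow_succ]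
    ring
  have hcont : ContinuousOn (Function.uncurry fun φ s : ℝ => 1 / 2 * (N s ^ l *
        (Complex.exp (φ * Complex.I) * ((shiftDen r₂ s φ)⁻¹) ^ (l + 1))))
      (Set.uIcc (-π) π ×ˢ Set.uIcc (-r₁) r₁) := by
    have hD : ContinuousOn (fun p : ℝ × ℝ => (shiftDen r₂ p.2 p.1)⁻¹)
        (Set.uIcc (-π) π ×ˢ Set.uIcc (-r₁) r₁) := by
      refine ContinuousOn.inv₀ ?_ fun p hp =>
        shiftDen_ne_zero h₂ (abs_lt_of_mem_uIcc h₁ h hp.2) p.1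
      unfold shiftDen
      fun_prop
    have hNc : Continuous N := by rw [hN]; fun_prop
    unfold Function.uncurry
    fun_prop
  have e3 : ∫ φ in -π..π, ∫ s in -r₁..r₁, 1 / 2 * (N s ^ l *
        (Complex.exp (φ * Complex.I) * ((shiftDen r₂ s φ)⁻¹) ^ (l + 1))) =
      ∫ s in -r₁..r₁, outerRadial l r₂ * (N s ^ l * Complex.exp s) := by
    rw [intervalIntegral_swap_of_continuousOn hcont]
    refine intervalIntegral.integral_congr fun s hs => ?_
    rw [intervalIntegral.integral_const_mul, intervalIntegral.integral_const_mul,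
      integral_exp_mul_shiftDen h₂ (abs_lt_of_mem_uIcc h₁ h hs), integral_exp_mul_shiftDen_zero h₂]
    ring
  rw [e2, e3, intervalIntegral.integral_const_mul, integral_pow_mul_exp] at e1
  have : ((2 * (innerRadial l r₁ * outerRadial l r₂) : ℝ) : ℂ) =
      ((2 * ∫ φ in (0 : ℝ)..π, Real.cos φ * legQ l (radialArg r₁ r₂ φ) : ℝ) : ℂ) := by
    push_cast; rw [← e1]; ring
  have := Complex.ofReal_injective this
  linarith

/-! ### The limiting case `r = r'` -/

lemma radialArg_self {r : ℝ} (hr : 0 < r) (φ : ℝ) :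
    radialArg r r φ = 1 + (Real.sinh r ^ 2)⁻¹ * (1 - Real.cos φ) := by
  have h := Real.sinh_pos_iff.mpr hr
  have := Real.cosh_sq r
  rw [radialArg]
  field_simp
  linear_combination this

lemma one_lt_radialArg_self {r : ℝ} (hr : 0 < r) {φ : ℝ} (hφ : φ ∈ Set.Ioc 0 π) :
    1 < radialArg r r φ := by
  have : Real.cos φ < 1 := by
    rw [← Real.cos_zero]
    exact Real.cos_lt_cos_of_nonneg_of_le_pi le_rfl hφ.2 hφ.1
  have h := Real.sinh_pos_iff.mpr hr
  have : 0 < (Real.sinh r ^ 2)⁻¹ * (1 - Real.cos φ) := mul_pos (by positivity) (by linarith)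
  rw [radialArg_self hr]; linarith

lemma le_radialArg {r r' c : ℝ} (hr : 0 < r) (hr' : 0 < r')
    (hc : c ≤ (Real.sinh r * Real.sinh r')⁻¹) (φ : ℝ) :
    1 + c * (1 - Real.cos φ) ≤ radialArg r r' φ := by
  have h1 := Real.sinh_pos_iff.mpr hr
  have h2 := Real.sinh_pos_iff.mpr hr'
  have h3 := Real.one_le_cosh (r - r')
  rw [Real.cosh_sub] at h3
  have h4 : 0 ≤ 1 - Real.cos φ := by linarith [Real.cos_le_one φ]
  calc _ ≤ 1 + (Real.sinh r * Real.sinh r')⁻¹ * (1 - Real.cos φ) := by gcongr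
    _ ≤ _ := by
      rw [radialArg, le_div_iff₀ (by positivity)]
      field_simp
      linarith

lemma continuousAt_outerRadial (l : ℕ) {r : ℝ} (hr : 0 < r) : ContinuousAt (outerRadial l) r := by
  have hc : Continuous fun t : ℝ => ∫ φ in (0 : ℝ)..π,
      Real.cos φ * (Real.sinh t / (max (Real.cosh t) (Real.cosh (r / 2)) - Real.cos φ)) ^ (l + 1) := by
    refine intervalIntegral.continuous_parametric_intervalIntegral_of_continuous' ?_ _ _
    have h : ∀ p : ℝ × ℝ, max (Real.cosh p.1) (Real.cosh (r / 2)) - Real.cos p.2 ≠ 0 := fun p => by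
      have h1 := Real.one_lt_cosh.mpr (show r / 2 ≠ 0 by positivity)
      have h2 := le_max_right (Real.cosh p.1) (Real.cosh (r / 2))
      have h3 := Real.cos_le_one p.2
      linarith
    unfold Function.uncurry
    exact (Real.continuous_cos.comp continuous_snd).mul
      ((Continuous.div (by fun_prop) (by fun_prop) h).pow _)
  refine hc.continuousAt.congr ?_
  filter_upwards [Ioi_mem_nhds (show r / 2 < r by linarith)] with t ht
  have ht' : r / 2 < t := ht
  have : max (Real.cosh t) (Real.cosh (r / 2)) = Real.cosh t := by
    refine max_eq_left (Real.cosh_le_cosh.mpr ?_)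
    rw [abs_of_pos (by linarith), abs_of_pos (by linarith)]; exact ht'.le
  simp only [this, outerRadial]

/-- The separation requires distinct radii, so the larger one tends to `r` from above. At `r = r'`
the argument reaches one at `φ = 0`, where `Q_l` is singular; the domination is supplied by
`integrableOn_legQ`. -/
lemma integral_cos_mul_legQ_self {r : ℝ} (hr : 0 < r) (l : ℕ) :
    ∫ φ in (0 : ℝ)..π, Real.cos φ * legQ l (radialArg r r φ) =
      innerRadial l r * outerRadial l r := by
  have hS := Real.sinh_pos_iff.mpr hr
  -- A lower bound of `1 / (sinh r sinh t)` valid for all `t` in `(r, r + 1)`, so a single majorant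
  -- serves all of them.
  set k := (Real.sinh r * Real.sinh (r + 1))⁻¹ with hk
  have hS1 : 0 < Real.sinh (r + 1) := Real.sinh_pos_iff.mpr (by linarith)
  have hk0 : 0 < k := by positivity
  have hY : ∀ φ ∈ Set.Ioc 0 π, 1 < 1 + k * (1 - Real.cos φ) := by
    intro φ hφ
    have : Real.cos φ < 1 := by
      rw [← Real.cos_zero]
      exact Real.cos_lt_cos_of_nonneg_of_le_pi le_rfl hφ.2 hφ.1
    have : 0 < k * (1 - Real.cos φ) := mul_pos hk0 (by linarith)
    linarith
  have hnear : ∀ᶠ t in nhdsWithin r (Set.Ioi r), t ∈ Set.Ioo r (r + 1) :=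
    Ioo_mem_nhdsGT (by linarith)
  have hbd : ∀ t ∈ Set.Ioo r (r + 1), ∀ φ, 1 + k * (1 - Real.cos φ) ≤ radialArg r t φ := by
    intro t ht φ
    have ht0 : 0 < t := hr.trans ht.1
    refine le_radialArg hr ht0 ?_ φ
    have := Real.sinh_pos_iff.mpr ht0
    have := (Real.sinh_lt_sinh.mpr ht.2).le
    rw [hk]; gcongr
  have hlim : Filter.Tendsto (fun t => ∫ φ in (0 : ℝ)..π, Real.cos φ * legQ l (radialArg r t φ))
      (nhdsWithin r (Set.Ioi r)) (nhds (∫ φ in (0 : ℝ)..π, Real.cos φ * legQ l (radialArg r r φ))) := by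
    refine intervalIntegral.tendsto_integral_filter_of_dominated_convergence
      (fun φ => legQ l (1 + k * (1 - Real.cos φ))) ?_ ?_ ?_ ?_
    · filter_upwards [hnear] with t ht
      refine ContinuousOn.aestronglyMeasurable ?_ measurableSet_uIoc
      refine Real.continuous_cos.continuousOn.mul ?_
      refine (continuousOn_legQ l).comp (continuous_radialArg _ _).continuousOn fun φ _ =>
        one_lt_radialArg hr (hr.trans ht.1) ht.1.ne φ
    · filter_upwards [hnear] with t ht
      refine Filter.Eventually.of_forall fun φ hφ => ?_
      rw [Set.uIoc_of_le Real.pi_pos.le] at hφ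
      have h1 := hY φ hφ
      have h2 := hbd t ht φ
      rw [norm_mul, Real.norm_eq_abs, Real.norm_eq_abs,
        abs_of_nonneg (legQ_nonneg (h1.trans_le h2) l)]
      exact (mul_le_of_le_one_left (legQ_nonneg (h1.trans_le h2) l) (Real.abs_cos_le_one φ)).trans
        (legQ_anti h1 h2 l)
    · rw [intervalIntegrable_iff_integrableOn_Ioc_of_le Real.pi_pos.le]
      exact integrableOn_legQ hk0 l
    · refine Filter.Eventually.of_forall fun φ hφ => ?_
      rw [Set.uIoc_of_le Real.pi_pos.le] at hφ
      refine Filter.Tendsto.const_mul _ ?_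
      have h1 : ContinuousAt (legQ l) (radialArg r r φ) :=
        (continuousOn_legQ l).continuousAt (Ioi_mem_nhds (one_lt_radialArg_self hr hφ))
      have h2 : ContinuousAt (fun t => radialArg r t φ) r := by
        unfold radialArg
        exact ContinuousAt.div (by fun_prop) (by fun_prop) (by positivity)
      exact (ContinuousAt.comp_of_eq h1 h2 rfl).tendsto.mono_left nhdsWithin_le_nhds
  have hlim2 : Filter.Tendsto (fun t => innerRadial l r * outerRadial l t)
      (nhdsWithin r (Set.Ioi r)) (nhds (innerRadial l r * outerRadial l r)) :=
    ((continuousAt_outerRadial l hr).tendsto.mono_left nhdsWithin_le_nhds).const_mul _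
  refine tendsto_nhds_unique (hlim.congr' ?_) hlim2
  filter_upwards [hnear] with t ht
  exact integral_cos_mul_legQ hr ht.1 l

lemma radialCoeff_eq (l : ℕ) {r r' : ℝ} (hr : 0 < r) (hr' : 0 < r') :
    radialCoeff l r r' = (π * (Real.sinh r * Real.sinh r'))⁻¹ *
      (innerRadial l (min r r') * outerRadial l (max r r')) := by
  have hsym : ∀ a b φ, radialArg a b φ = radialArg b a φ := fun a b φ => by
    rw [radialArg, radialArg, mul_comm (Real.cosh a), mul_comm (Real.sinh a)]
  have h : ∫ φ in (0 : ℝ)..π, Real.cos φ * legQ l (radialArg r r' φ) =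
      innerRadial l (min r r') * outerRadial l (max r r') := by
    rcases lt_trichotomy r r' with h | h | h
    · rw [min_eq_left h.le, max_eq_right h.le, integral_cos_mul_legQ hr h]
    · subst h; rw [min_self, max_self, integral_cos_mul_legQ_self hr]
    · simp_rw [hsym r r']
      rw [min_eq_right h.le, max_eq_left h.le, integral_cos_mul_legQ hr' h]
  rw [radialCoeff, ← h, mul_inv, mul_assoc, one_div,
    ← intervalIntegral.integral_const_mul (Real.sinh r * Real.sinh r')⁻¹]
  congr 1
  refine intervalIntegral.integral_congr fun φ _ => ?_
  ring

end Factorization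
end HypFourier

namespace HypFourier
open Finset Real MeasureTheory

/-! ### The radial factor of the second kind as a Legendre function -/

lemma integral_cos_pow_two_mul_add_one (k : ℕ) :
    ∫ φ in (0 : ℝ)..π, Real.cos φ ^ (2 * k + 1) = 0 := by
  induction k with
  | zero => simp
  | succ k ih => rw [show 2 * (k + 1) + 1 = 2 * k + 1 + 2 by ring, integral_cos_pow, ih]; simp

lemma integral_cos_pow_two_mul (k : ℕ) :
    ∫ φ in (0 : ℝ)..π, Real.cos φ ^ (2 * k) =
      π * ((2 * k).factorial : ℝ) / (4 ^ k * (k.factorial : ℝ) ^ 2) := by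
  induction k with
  | zero => simp
  | succ k ih =>
    rw [show 2 * (k + 1) = 2 * k + 2 by ring, integral_cos_pow, ih, Nat.factorial_succ k,
      Nat.factorial_succ (2 * k + 1), Nat.factorial_succ (2 * k)]
    have := Nat.factorial_ne_zero k
    simp
    field_simp
    ring

lemma ascPochhammer_eval_two (k : ℕ) :
    (ascPochhammer ℝ k).eval 2 = ((k + 1).factorial : ℝ) := by
  induction k with
  | zero => simp
  | succ k ih =>
    rw [ascPochhammer_succ_eval, ih, Nat.factorial_succ (k + 1)]; push_cast; ring

lemma ascPochhammer_eval_mul_eval_half (l k : ℕ) :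
    (ascPochhammer ℝ k).eval (((l : ℝ) + 3) / 2) * (ascPochhammer ℝ k).eval (((l : ℝ) + 2) / 2) *
      (4 ^ k * ((l + 1).factorial : ℝ)) = ((l + 1 + 2 * k).factorial : ℝ) := by
  induction k with
  | zero => simp
  | succ k ih =>
    rw [ascPochhammer_succ_eval, ascPochhammer_succ_eval,
      show l + 1 + 2 * (k + 1) = l + 1 + 2 * k + 1 + 1 by ring, Nat.factorial_succ (l + 1 + 2 * k + 1),
      Nat.factorial_succ (l + 1 + 2 * k)]
    push_cast
    rw [← ih]
    ring

/-- The binomial series of `(1 - cos φ / c)^(-(l+1))` integrated term by term; it is dominated by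
the series at `1/c`. -/
lemma hasSum_integral_cos_mul_inv_pow {c : ℝ} (hc : 1 < c) (l : ℕ) :
    HasSum (fun n : ℕ => ((n + l).choose l : ℝ) / c ^ n * ∫ φ in (0 : ℝ)..π, Real.cos φ ^ (n + 1))
      (∫ φ in (0 : ℝ)..π, Real.cos φ * (c / (c - Real.cos φ)) ^ (l + 1)) := by
  have hc0 : 0 < c := by linarith
  have hn : ∀ φ : ℝ, ‖Real.cos φ / c‖ < 1 := fun φ => by
    rw [norm_div, Real.norm_eq_abs, Real.norm_of_nonneg hc0.le, div_lt_one hc0]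
    exact (Real.abs_cos_le_one φ).trans_lt hc
  have hs : Summable fun n : ℕ => ((n + l).choose l : ℝ) * (1 / c) ^ n :=
    (hasSum_choose_mul_geometric_of_norm_lt_one l (by
      rw [norm_div, norm_one, Real.norm_of_nonneg hc0.le, div_lt_one hc0]; exact hc)).summable
  have key := intervalIntegral.hasSum_integral_of_dominated_convergence (μ := volume) (a := 0) (b := π)
    (F := fun n φ => Real.cos φ * (((n + l).choose l : ℝ) * (Real.cos φ / c) ^ n))
    (f := fun φ => Real.cos φ * (1 / (1 - Real.cos φ / c) ^ (l + 1)))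
    (fun n _ => ((n + l).choose l : ℝ) * (1 / c) ^ n)
    (fun n => Continuous.aestronglyMeasurable (by fun_prop))
    (fun n => Filter.Eventually.of_forall fun φ _ => by
      rw [norm_mul, norm_mul, norm_pow, norm_div, Real.norm_natCast, Real.norm_eq_abs,
        Real.norm_of_nonneg hc0.le]
      have := Real.abs_cos_le_one φ
      calc _ ≤ 1 * (((n + l).choose l : ℝ) * (|Real.cos φ| / c) ^ n) := by gcongr
        _ ≤ _ := by rw [one_mul]; gcongr)
    (Filter.Eventually.of_forall fun _ _ => hs) (by simp)
    (Filter.Eventually.of_forall fun φ _ =>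
      (hasSum_choose_mul_geometric_of_norm_lt_one l (hn φ)).mul_left _)
  have e1 : ∀ n : ℕ, ((n + l).choose l : ℝ) / c ^ n * ∫ φ in (0 : ℝ)..π, Real.cos φ ^ (n + 1) =
      ∫ φ in (0 : ℝ)..π, Real.cos φ * (((n + l).choose l : ℝ) * (Real.cos φ / c) ^ n) := fun n => by
    rw [← intervalIntegral.integral_const_mul]
    refine intervalIntegral.integral_congr fun φ _ => ?_
    simp only [div_pow]
    ring
  have e2 : ∫ φ in (0 : ℝ)..π, Real.cos φ * (c / (c - Real.cos φ)) ^ (l + 1) =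
      ∫ φ in (0 : ℝ)..π, Real.cos φ * (1 / (1 - Real.cos φ / c) ^ (l + 1)) := by
    refine intervalIntegral.integral_congr fun φ _ => ?_
    simp only [one_div, ← inv_pow]
    rw [one_sub_div hc0.ne', inv_div]
  rw [e2]
  simp_rw [e1]
  exact key

lemma integral_cos_mul_inv_pow_eq {c : ℝ} (hc : 1 < c) (l : ℕ) :
    ∫ φ in (0 : ℝ)..π, Real.cos φ * (c / (c - Real.cos φ)) ^ (l + 1) =
      π * (l + 1) / (2 * c) *
        ordinaryHypergeometric (((l : ℝ) + 3) / 2) (((l : ℝ) + 2) / 2) 2 (1 / c ^ 2) := by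
  have hc0 : 0 < c := by linarith
  have h := hasSum_integral_cos_mul_inv_pow hc l
  have hinj : Function.Injective fun k : ℕ => 2 * k + 1 := fun a b h => by simpa using h
  -- Only the indices `n = 2k + 1` matter: for even `n` the integral of the odd power `cos^(n+1)`
  -- vanishes. This makes the series one in `1/c²`.
  rw [← hinj.hasSum_iff] at h
  · rw [← h.tsum_eq, ordinaryHypergeometric_eq_tsum, ← tsum_mul_left]
    refine tsum_congr fun k => ?_
    simp only [Function.comp_apply, smul_eq_mul]
    have e1 := integral_cos_pow_two_mul (k + 1)
    rw [show 2 * (k + 1) = 2 * k + 1 + 1 by ring] at e1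
    have e2 := ascPochhammer_eval_mul_eval_half l k
    have e3 : ((2 * k + 1 + l).choose l : ℝ) * (l.factorial * (2 * k + 1).factorial) =
        ((l + 1 + 2 * k).factorial : ℝ) := by
      have := Nat.add_choose_mul_factorial_mul_factorial (2 * k + 1) l
      rw [show l + 1 + 2 * k = 2 * k + 1 + l by ring, ← this]
      push_cast; ring
    have h1 := Nat.factorial_ne_zero k
    have h2 := Nat.factorial_ne_zero l
    have h3 := Nat.factorial_ne_zero (2 * k + 1)
    have e4 : ((2 * k + 1 + l).choose l : ℝ) = (ascPochhammer ℝ k).eval (((l : ℝ) + 3) / 2) *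
        (ascPochhammer ℝ k).eval (((l : ℝ) + 2) / 2) * (4 ^ k * (l + 1)) / (2 * k + 1).factorial := by
      rw [Nat.factorial_succ l] at e2
      push_cast at e2
      field_simp
      refine mul_left_cancel₀ (Nat.cast_ne_zero.mpr h2 : (l.factorial : ℝ) ≠ 0) ?_
      linear_combination e3 - e2
    rw [e1, e4, ascPochhammer_eval_two, Nat.factorial_succ (2 * k + 1), Nat.factorial_succ k]
    push_cast
    rw [one_div, inv_pow, ← pow_mul, pow_succ c (2 * k)]
    field_simp
    ring
  · intro n hn
    rcases Nat.even_or_odd' n with ⟨k, rfl | rfl⟩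
    · rw [integral_cos_pow_two_mul_add_one, mul_zero]
    · exact absurd ⟨k, rfl⟩ hn

lemma outerRadial_eq {r : ℝ} (hr : 0 < r) (l : ℕ) :
    outerRadial l r = Real.sinh r ^ (l + 1) * (π * (l + 1) / (2 * Real.cosh r ^ (l + 2)) *
      ordinaryHypergeometric (((l : ℝ) + 3) / 2) (((l : ℝ) + 2) / 2) 2 (1 / Real.cosh r ^ 2)) := by
  have h := integral_cos_mul_inv_pow_eq (Real.one_lt_cosh.mpr hr.ne') l
  have hc := Real.cosh_pos r
  calc outerRadial l r = (Real.sinh r / Real.cosh r) ^ (l + 1) *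
      ∫ φ in (0 : ℝ)..π, Real.cos φ * (Real.cosh r / (Real.cosh r - Real.cos φ)) ^ (l + 1) := by
        rw [outerRadial, ← intervalIntegral.integral_const_mul]
        refine intervalIntegral.integral_congr fun φ _ => ?_
        rw [mul_left_comm, ← mul_pow]
        congr 2
        field_simp
    _ = _ := by
      rw [h, div_pow]
      field_simp
      ring

lemma legendreSecond_half_eq {r : ℝ} (hr : 0 < r) (l : ℕ) :
    legendreSecond (1 / 2) (1 / 2 + l) (Real.cosh r) =
      Complex.exp (Complex.I * π * ((1 / 2 + l : ℝ) : ℂ)) *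
        ((l.factorial / (√(2 * π) * √(Real.sinh r)) * outerRadial l r : ℝ) : ℂ) := by
  have hs := Real.sinh_pos_iff.mpr hr
  have hc := Real.cosh_pos r
  rw [legendreSecond]
  congr 2
  have e1 : Real.Gamma (1 / 2 + (1 / 2 + l) + 1) = (l + 1).factorial := by
    rw [show (1 / 2 + (1 / 2 + l) + 1 : ℝ) = ((l + 1 : ℕ) : ℝ) + 1 by push_cast; ring,
      Real.Gamma_nat_eq_factorial]
  have e2 : Real.Gamma (1 / 2 + 3 / 2) = 1 := by
    rw [show (1 / 2 + 3 / 2 : ℝ) = 2 by norm_num, Real.Gamma_two]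
  have e3 : (Real.cosh r ^ 2 - 1) ^ ((1 / 2 + l : ℝ) / 2) = √(Real.sinh r) * Real.sinh r ^ l := by
    rw [Real.cosh_sq, add_sub_cancel_right, ← Real.rpow_natCast (Real.sinh r) 2, ← Real.rpow_mul hs.le,
      Real.sqrt_eq_rpow, ← Real.rpow_natCast (Real.sinh r) l, ← Real.rpow_add hs]
    congr 1
    push_cast; ring
  have e4 : (2 : ℝ) ^ (1 / 2 + 1 : ℝ) = 2 * √2 := by
    rw [Real.rpow_add two_pos, Real.rpow_one, Real.sqrt_eq_rpow, mul_comm]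
  have e5 : Real.cosh r ^ (1 / 2 + (1 / 2 + l) + 1 : ℝ) = Real.cosh r ^ (l + 2) := by
    rw [← Real.rpow_natCast]; congr 1; push_cast; ring
  rw [e1, e2, e3, e4, e5, gaussF, if_pos (by positivity), outerRadial_eq hr,
    show (1 / 2 + (1 / 2 + l) + 2 : ℝ) = l + 3 by ring,
    show (1 / 2 + (1 / 2 + l) + 1 : ℝ) = l + 2 by ring,
    show (1 / 2 + 3 / 2 : ℝ) = 2 by norm_num, Nat.factorial_succ, Real.sqrt_mul zero_le_two]
  generalize ordinaryHypergeometric (((l : ℝ) + 3) / 2) (((l : ℝ) + 2) / 2) 2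
    (1 / Real.cosh r ^ 2) = F
  have h3 : 0 < √(Real.sinh r) := Real.sqrt_pos.mpr hs
  have h4 : 0 < √π := Real.sqrt_pos.mpr Real.pi_pos
  push_cast
  field_simp
  rw [Real.sq_sqrt Real.pi_pos.le, Real.sq_sqrt hs.le]
  ring

end HypFourier

namespace HypFourier
open Finset Real MeasureTheory

/-! ### The radial factor of the first kind as a Legendre function -/

lemma summable_mul_pow_of_abs_le_one {a : ℕ → ℝ} (ha : ∀ n, |a n| ≤ 1) {z : ℝ} (hz : |z| < 1) :
    Summable fun n => a n * z ^ n := by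
  refine Summable.of_norm_bounded (summable_geometric_of_lt_one (abs_nonneg z) hz) fun n => ?_
  rw [norm_mul, norm_pow, Real.norm_eq_abs, Real.norm_eq_abs]
  exact mul_le_of_le_one_left (by positivity) (ha n)

lemma summable_nat_mul_mul_pow_of_abs_le_one {a : ℕ → ℝ} (ha : ∀ n, |a n| ≤ 1) {z : ℝ}
    (hz : |z| < 1) : Summable fun n : ℕ => n * a n * z ^ n := by
  have h := summable_pow_mul_geometric_of_norm_lt_one 1 (r := |z|) (by simpa using hz)
  refine Summable.of_norm_bounded h fun n => ?_
  rw [norm_mul, norm_mul, norm_pow, Real.norm_natCast, Real.norm_eq_abs, Real.norm_eq_abs, pow_one]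
  gcongr
  exact mul_le_of_le_one_right (by positivity) (ha n)

lemma hasDerivAt_tsum_mul_pow {a : ℕ → ℝ} (ha : ∀ n, |a n| ≤ 1) {z : ℝ} (hz : |z| < 1) :
    HasDerivAt (fun x => ∑' n, a n * x ^ n) (∑' n : ℕ, a n * (n * z ^ (n - 1))) z := by
  obtain ⟨q, hzq, hq⟩ := exists_between hz
  have hq0 : 0 < q := (abs_nonneg z).trans_lt hzq
  have hu : Summable fun n : ℕ => (n : ℝ) * q ^ (n - 1) := by
    rw [← summable_nat_add_iff 1]
    have h := summable_nat_mul_mul_pow_of_abs_le_one (a := fun _ => 1) (by simp)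
      (show |q| < 1 by rwa [abs_of_pos hq0])
    rw [← summable_nat_add_iff 1] at h
    refine (h.mul_left q⁻¹).congr fun n => ?_
    rw [Nat.add_sub_cancel, pow_succ]
    field_simp
  refine hasDerivAt_tsum_of_isPreconnected hu Metric.isOpen_ball
    (convex_ball (0 : ℝ) q).isPreconnected (t := Metric.ball 0 q)
    (fun n y _ => (hasDerivAt_pow n y).const_mul (a n)) (fun n y hy => ?_)
    (y₀ := 0) (by simpa using hq0) ?_ (by simpa using hzq)
  · have hy' : |y| < q := by simpa using hy
    rw [norm_mul, norm_mul, norm_pow, Real.norm_natCast, Real.norm_eq_abs, Real.norm_eq_abs]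
    calc _ ≤ 1 * ((n : ℝ) * |y| ^ (n - 1)) := by gcongr; exact ha n
      _ ≤ _ := by rw [one_mul]; gcongr
  · exact summable_mul_pow_of_abs_le_one ha (by simp)

/-- The Taylor coefficients of `₂F₁(-1/2, l; l + 3/2; z)`. -/
noncomputable def innerHypCoeff (l n : ℕ) : ℝ :=
  ordinaryHypergeometricCoefficient (-(1 / 2) : ℝ) l (l + 3 / 2) n

lemma innerHypCoeff_zero (l : ℕ) : innerHypCoeff l 0 = 1 := by
  simp [innerHypCoeff, ordinaryHypergeometricCoefficient]

lemma innerHypCoeff_succ (l n : ℕ) : innerHypCoeff l (n + 1) =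
    innerHypCoeff l n * ((n - 1 / 2) * (n + l) / ((n + l + 3 / 2) * (n + 1))) := by
  simp only [innerHypCoeff, ordinaryHypergeometricCoefficient, ascPochhammer_succ_eval,
    Nat.factorial_succ]
  push_cast
  rw [mul_inv, mul_inv]
  field_simp
  ring

/-- The ratio of consecutive coefficients is at most one in modulus. Comparison with the geometric
series then justifies termwise operations for `|z| < 1`. -/
lemma abs_innerHypCoeff_le_one (l n : ℕ) : |innerHypCoeff l n| ≤ 1 := by
  induction n with
  | zero => rw [innerHypCoeff_zero, abs_one]
  | succ n ih =>
    rw [innerHypCoeff_succ, abs_mul]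
    refine mul_le_one₀ ih (abs_nonneg _) ?_
    rw [abs_div, abs_mul, abs_of_nonneg (show (0 : ℝ) ≤ n + l by positivity),
      abs_of_pos (show (0 : ℝ) < (n + l + 3 / 2) * (n + 1) by positivity), div_le_one (by positivity)]
    have : |(n : ℝ) - 1 / 2| ≤ n + 1 := by
      rw [abs_le]; constructor <;> linarith [Nat.cast_nonneg (α := ℝ) n]
    calc _ ≤ ((n : ℝ) + 1) * (n + l + 3 / 2) :=
        mul_le_mul this (by linarith) (by positivity) (by positivity)
      _ = _ := mul_comm _ _

/-- All terms are multiples of `innerHypCoeff (l + 1) n`. Summed over `n` against powers of `z`,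
this is the first-order relation that lowers `l` in `innerHyp_contiguous`. -/
lemma innerHypCoeff_contiguous (l n : ℕ) :
    (l + 3 / 2 + (n + 1)) * innerHypCoeff (l + 1) (n + 1) + (1 / 2 - n) * innerHypCoeff (l + 1) n =
      (l + 3 / 2) * innerHypCoeff l (n + 1) := by
  have h : innerHypCoeff l (n + 1) =
      (n - 1 / 2) * l / ((l + 3 / 2) * (n + 1)) * innerHypCoeff (l + 1) n := by
    have hp : ∀ x : ℝ, (ascPochhammer ℝ (n + 1)).eval x = x * (ascPochhammer ℝ n).eval (x + 1) := by
      intro x; rw [ascPochhammer_succ_left]; simp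
    simp only [innerHypCoeff, ordinaryHypergeometricCoefficient, Nat.factorial_succ]
    rw [ascPochhammer_succ_eval, hp l, hp (l + 3 / 2)]
    push_cast
    rw [show (l : ℝ) + 3 / 2 + 1 = l + 1 + 3 / 2 by ring, mul_inv, mul_inv]
    field_simp
    ring
  rw [innerHypCoeff_succ, h]
  push_cast
  field_simp
  ring

lemma innerHyp_eq_tsum (l : ℕ) (z : ℝ) :
    ordinaryHypergeometric (-(1 / 2) : ℝ) (l : ℝ) (l + 3 / 2) z = ∑' n, innerHypCoeff l n * z ^ n := by
  rw [ordinaryHypergeometric_eq_tsum]; rfl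

lemma innerHyp_contiguous (l : ℕ) {z : ℝ} (hz : |z| < 1) :
    ((l + 3 / 2) * (1 - z) + (l + 2) * z) * ∑' n, innerHypCoeff (l + 1) n * z ^ n +
      z * (1 - z) * ∑' n : ℕ, innerHypCoeff (l + 1) n * (n * z ^ (n - 1)) =
      (l + 3 / 2) * ∑' n, innerHypCoeff l n * z ^ n := by
  have s1 := summable_mul_pow_of_abs_le_one (abs_innerHypCoeff_le_one (l + 1)) hz
  have s2 := summable_nat_mul_mul_pow_of_abs_le_one (abs_innerHypCoeff_le_one (l + 1)) hz
  have s3 := summable_mul_pow_of_abs_le_one (abs_innerHypCoeff_le_one l) hz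
  have hD : z * ∑' n : ℕ, innerHypCoeff (l + 1) n * (n * z ^ (n - 1)) =
      ∑' n : ℕ, n * innerHypCoeff (l + 1) n * z ^ n := by
    rw [← tsum_mul_left]
    refine tsum_congr fun n => ?_
    cases n with
    | zero => simp
    | succ n => rw [Nat.add_sub_cancel, pow_succ]; ring
  have hp : Summable fun n : ℕ => (l + 3 / 2 + n) * innerHypCoeff (l + 1) n * z ^ n :=
    ((s1.mul_left (l + 3 / 2 : ℝ)).add s2).congr fun n => by ring
  have hq : Summable fun n : ℕ => (1 / 2 - n) * innerHypCoeff (l + 1) n * z ^ (n + 1) :=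
    (((s1.mul_left (1 / 2 : ℝ)).sub s2).mul_left z).congr fun n => by ring
  have e1 : ∑' n : ℕ, (l + 3 / 2 + n) * innerHypCoeff (l + 1) n * z ^ n =
      (l + 3 / 2) * ∑' n, innerHypCoeff (l + 1) n * z ^ n +
        ∑' n : ℕ, n * innerHypCoeff (l + 1) n * z ^ n := by
    rw [← tsum_mul_left, ← (s1.mul_left _).tsum_add s2]
    exact tsum_congr fun n => by ring
  have e2 : ∑' n : ℕ, (1 / 2 - n) * innerHypCoeff (l + 1) n * z ^ (n + 1) =
      z * (1 / 2 * ∑' n, innerHypCoeff (l + 1) n * z ^ n -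
        ∑' n : ℕ, n * innerHypCoeff (l + 1) n * z ^ n) := by
    rw [← tsum_mul_left, ← (s1.mul_left _).tsum_sub s2, ← tsum_mul_left]
    exact tsum_congr fun n => by ring
  have e3 : ∑' n : ℕ, (l + 3 / 2 + n) * innerHypCoeff (l + 1) n * z ^ n +
      ∑' n : ℕ, (1 / 2 - n) * innerHypCoeff (l + 1) n * z ^ (n + 1) =
      (l + 3 / 2) * ∑' n, innerHypCoeff l n * z ^ n := by
    rw [hp.tsum_eq_zero_add, s3.tsum_eq_zero_add, add_assoc,
      ← ((summable_nat_add_iff 1).mpr hp).tsum_add hq, mul_add, ← tsum_mul_left,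
      innerHypCoeff_zero, innerHypCoeff_zero]
    congr 1
    · simp
    · refine tsum_congr fun n => ?_
      rw [← mul_assoc, ← innerHypCoeff_contiguous]; push_cast; ring
  linear_combination e3 - e1 - e2 + (1 - z) * hD

lemma innerHyp_zero_eq_one (z : ℝ) : ∑' n, innerHypCoeff 0 n * z ^ n = 1 := by
  have h : ∀ n, innerHypCoeff 0 (n + 1) = 0 := by
    intro n
    induction n with
    | zero => simp [innerHypCoeff_succ]
    | succ n ih => rw [innerHypCoeff_succ, ih, zero_mul]
  rw [tsum_eq_single 0, innerHypCoeff_zero, pow_zero, mul_one]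
  intro n hn
  obtain ⟨k, rfl⟩ := Nat.exists_eq_succ_of_ne_zero hn
  rw [Nat.succ_eq_add_one, h, zero_mul]

/-- The hypergeometric form of `∫₀^s (cosh s - cosh t)^l cosh t dt`. -/
noncomputable def innerHyp (l : ℕ) (s : ℝ) : ℝ :=
  2 ^ l * l.factorial * √π / Real.Gamma (l + 3 / 2) *
    (Real.sinh (s / 2) ^ (2 * l + 1) * Real.cosh (s / 2) *
      ∑' n, innerHypCoeff l n * (Real.sinh (s / 2) ^ 2 / Real.cosh (s / 2) ^ 2) ^ n)

lemma innerHyp_zero (s : ℝ) : innerHyp 0 s = Real.sinh s := by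
  have h : Real.Gamma (3 / 2) = √π / 2 := by
    rw [show (3 / 2 : ℝ) = 1 / 2 + 1 by norm_num, Real.Gamma_add_one (by norm_num),
      Real.Gamma_one_half_eq]; ring
  have h2 : 0 < √π := Real.sqrt_pos.mpr Real.pi_pos
  have h3 := Real.sinh_two_mul (s / 2)
  rw [mul_div_cancel₀ s two_ne_zero] at h3
  rw [innerHyp, innerHyp_zero_eq_one, h3]
  simp only [pow_zero, Nat.factorial_zero, Nat.cast_one, Nat.cast_zero, zero_add, mul_zero, h]
  field_simp

lemma innerHyp_apply_zero (l : ℕ) : innerHyp l 0 = 0 := by simp [innerHyp]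

/-- With `z = tanh² (s/2)`, the product rule produces precisely the combination of `F` and `F'` in
`innerHyp_contiguous`. The integral that `innerHyp` is to represent has the same derivative
relation. -/
lemma hasDerivAt_innerHyp (l : ℕ) (s : ℝ) :
    HasDerivAt (innerHyp (l + 1)) ((l + 1) * Real.sinh s * innerHyp l s) s := by
  have hκ := Real.cosh_pos (s / 2)
  have hq := Real.cosh_sq (s / 2)
  have hsinh := Real.sinh_two_mul (s / 2)
  rw [mul_div_cancel₀ s two_ne_zero] at hsinh
  have hz : |Real.sinh (s / 2) ^ 2 / Real.cosh (s / 2) ^ 2| < 1 := by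
    rw [abs_of_nonneg (by positivity), div_lt_one (by positivity)]; linarith
  have d0 : HasDerivAt (fun s : ℝ => s / 2) (1 / 2) s := (hasDerivAt_id s).div_const 2
  have dσ := d0.sinh
  have dκ := d0.cosh
  have dz := (dσ.pow 2).div (dκ.pow 2) (pow_pos hκ 2).ne'
  have dF := (hasDerivAt_tsum_mul_pow (abs_innerHypCoeff_le_one (l + 1)) hz).comp s dz
  have d := (((dσ.pow (2 * (l + 1) + 1)).mul dκ).mul dF).const_mul
    (2 ^ (l + 1) * (l + 1).factorial * √π / Real.Gamma ((l + 1 : ℕ) + 3 / 2))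
  have hΓ : Real.Gamma ((l + 1 : ℕ) + 3 / 2) = (l + 3 / 2) * Real.Gamma (l + 3 / 2) := by
    rw [← Real.Gamma_add_one (by positivity)]; congr 1; push_cast; ring
  have hΓ0 : 0 < Real.Gamma (l + 3 / 2) := Real.Gamma_pos_of_pos (by positivity)
  refine d.congr_deriv ?_
  have hc := innerHyp_contiguous l hz
  rw [innerHyp, hΓ, hsinh, Nat.factorial_succ]
  simp only [Function.comp_apply, Pi.pow_apply, Pi.div_apply, Pi.mul_apply]
  generalize ∑' n, innerHypCoeff (l + 1) n *
    (Real.sinh (s / 2) ^ 2 / Real.cosh (s / 2) ^ 2) ^ n = F at hc ⊢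
  generalize ∑' n : ℕ, innerHypCoeff (l + 1) n *
    (n * (Real.sinh (s / 2) ^ 2 / Real.cosh (s / 2) ^ 2) ^ (n - 1)) = F' at hc ⊢
  generalize ∑' n, innerHypCoeff l n *
    (Real.sinh (s / 2) ^ 2 / Real.cosh (s / 2) ^ 2) ^ n = F₀ at hc ⊢
  generalize Real.sinh (s / 2) = σ at hc hq ⊢
  generalize Real.cosh (s / 2) = κ at hc hq hκ ⊢
  have hF₀ : F₀ = (((l + 3 / 2) * (1 - σ ^ 2 / κ ^ 2) + (l + 2) * (σ ^ 2 / κ ^ 2)) * F +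
      σ ^ 2 / κ ^ 2 * (1 - σ ^ 2 / κ ^ 2) * F') / (l + 3 / 2) := by
    rw [hc]; field_simp
  rw [hF₀]
  push_cast
  simp only [pow_succ (2 : ℝ) l]
  field_simp
  ring

/-- Repeated integration by parts lowers the power of `cosh r - cosh s` and raises `j`. Boundary
terms vanish, at `r` by that factor and at `0` by `h0`. This avoids differentiating an integral
whose limit and integrand both depend on `r`. -/
lemma integral_pow_mul_deriv_eq {g g' : ℕ → ℝ → ℝ} {r : ℝ}
    (hg : ∀ j s, HasDerivAt (g j) (g' j s) s) (h0 : ∀ j, g j 0 = 0)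
    (hs : ∀ j s, g' (j + 1) s = (j + 1) * Real.sinh s * g j s) (hc : Continuous (g' 0)) (k j : ℕ) :
    ((k + j).factorial : ℝ) * ∫ s in (0 : ℝ)..r, (Real.cosh r - Real.cosh s) ^ k * g' j s =
      k.factorial * j.factorial * g (k + j) r := by
  have hgc : ∀ j, Continuous (g j) := fun j =>
    continuous_iff_continuousAt.mpr fun s => (hg j s).continuousAt
  have hgc' : ∀ j, Continuous (g' j) := by
    intro j
    cases j with
    | zero => exact hc
    | succ j =>
      have := hgc j
      have h2 : g' (j + 1) = fun s => (j + 1) * Real.sinh s * g j s := funext (hs j)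
      rw [h2]; fun_prop
  induction k generalizing j with
  | zero =>
    have := intervalIntegral.integral_eq_sub_of_hasDerivAt (fun s _ => hg j s)
      ((hgc' j).intervalIntegrable 0 r)
    simp [this, h0]
  | succ k ih =>
    have hu : ∀ s, HasDerivAt (fun s => (Real.cosh r - Real.cosh s) ^ (k + 1))
        ((k + 1) * (Real.cosh r - Real.cosh s) ^ k * -Real.sinh s) s := by
      intro s
      refine (((Real.hasDerivAt_cosh s).const_sub (Real.cosh r)).pow (k + 1)).congr_deriv ?_
      rw [Nat.add_sub_cancel]; push_cast; ring
    have hp := intervalIntegral.integral_mul_deriv_eq_deriv_mul (a := 0) (b := r)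
      (fun s _ => hu s) (fun s _ => hg j s)
      (Continuous.intervalIntegrable (by fun_prop) _ _) ((hgc' j).intervalIntegrable _ _)
    rw [sub_self, zero_pow k.succ_ne_zero, zero_mul, h0, mul_zero, sub_zero, zero_sub] at hp
    have h1 := ih (j + 1)
    have h2 : ∫ s in (0 : ℝ)..r, (Real.cosh r - Real.cosh s) ^ k * g' (j + 1) s =
        -(((j + 1 : ℝ) / (k + 1)) * ∫ s in (0 : ℝ)..r,
          (k + 1) * (Real.cosh r - Real.cosh s) ^ k * -Real.sinh s * g j s) := by
      rw [← intervalIntegral.integral_const_mul, ← intervalIntegral.integral_neg]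
      refine intervalIntegral.integral_congr fun s _ => ?_
      simp only [hs]
      field_simp
    generalize ∫ s in (0 : ℝ)..r, (k + 1) * (Real.cosh r - Real.cosh s) ^ k * -Real.sinh s * g j s = I
      at hp h2
    rw [hp, show k + 1 + j = k + (j + 1) by ring, Nat.factorial_succ k]
    rw [h2, Nat.factorial_succ j] at h1
    push_cast at h1 ⊢
    refine mul_left_cancel₀ (show (j + 1 : ℝ) ≠ 0 by positivity) ?_
    have h3 : (0 : ℝ) < k + 1 := by positivity
    field_simp at h1
    linear_combination (j + 1 : ℝ) * h1

lemma innerHyp_eq_integral (l : ℕ) (r : ℝ) :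
    innerHyp l r = ∫ s in (0 : ℝ)..r, (Real.cosh r - Real.cosh s) ^ l * Real.cosh s := by
  let g' : ℕ → ℝ → ℝ := fun j s => match j with
    | 0 => Real.cosh s
    | j + 1 => (j + 1) * Real.sinh s * innerHyp j s
  have hg : ∀ j s, HasDerivAt (innerHyp j) (g' j s) s := by
    intro j s
    cases j with
    | zero => rw [funext innerHyp_zero]; exact Real.hasDerivAt_sinh s
    | succ j => exact hasDerivAt_innerHyp j s
  have h := integral_pow_mul_deriv_eq (r := r) hg innerHyp_apply_zero (fun _ _ => rfl)
    Real.continuous_cosh l 0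
  simp only [add_zero, Nat.factorial_zero, Nat.cast_one, mul_one] at h
  exact (mul_left_cancel₀ (by positivity) h).symm

lemma innerRadial_eq (l : ℕ) (r : ℝ) : innerRadial l r = innerHyp l r / Real.sinh r ^ l := by
  rw [innerHyp_eq_integral, innerRadial, ← intervalIntegral.integral_div]
  refine intervalIntegral.integral_congr fun s _ => ?_
  simp only [div_pow]
  ring

lemma legendreFirst_half_eq {r : ℝ} (hr : 0 < r) (l : ℕ) :
    legendreFirst (1 / 2) (-(1 / 2 + l)) (Real.cosh r) =
      √(2 / π) / (l.factorial * √(Real.sinh r)) * innerRadial l r := by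
  have hκ := Real.cosh_pos (r / 2)
  have hσ := Real.sinh_pos_iff.mpr (half_pos hr)
  have hq := Real.cosh_sq (r / 2)
  have hsinh := Real.sinh_two_mul (r / 2)
  have hcosh := Real.cosh_two_mul (r / 2)
  rw [mul_div_cancel₀ r two_ne_zero] at hsinh hcosh
  have hΓ0 : 0 < Real.Gamma (l + 3 / 2) := Real.Gamma_pos_of_pos (by positivity)
  rw [legendreFirst, innerRadial_eq, innerHyp, ← innerHyp_eq_tsum, gaussF, hsinh, hcosh]
  generalize hS : Real.sinh (r / 2) = σ at hσ hq ⊢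
  generalize hK : Real.cosh (r / 2) = κ at hκ hq ⊢
  have e1 : (κ ^ 2 + σ ^ 2 + 1) / (κ ^ 2 + σ ^ 2 - 1) = (κ / σ) ^ 2 := by
    rw [show κ ^ 2 + σ ^ 2 + 1 = 2 * κ ^ 2 by linarith,
      show κ ^ 2 + σ ^ 2 - 1 = 2 * σ ^ 2 by linarith]
    field_simp
  have e2 : (1 - (κ ^ 2 + σ ^ 2)) / 2 = -σ ^ 2 := by linarith
  have e3 : -σ ^ 2 / (-σ ^ 2 - 1) = σ ^ 2 / κ ^ 2 := by
    rw [hq, ← neg_div_neg_eq]; congr 1 <;> ring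
  have e4 : (1 - -σ ^ 2) ^ (-(-(1 / 2)) : ℝ) = κ := by
    rw [sub_neg_eq_add, add_comm, ← hq, neg_neg, ← Real.sqrt_eq_rpow, Real.sqrt_sq hκ.le]
  have e5 : ((κ / σ) ^ 2) ^ (-(1 / 2 + l : ℝ) / 2) = √σ * σ ^ l / (√κ * κ ^ l) := by
    have h1 : ∀ x : ℝ, 0 < x → √x * x ^ l = x ^ (1 / 2 + l : ℝ) := fun x hx => by
      rw [Real.rpow_add hx, ← Real.sqrt_eq_rpow, Real.rpow_natCast]
    rw [h1 σ hσ, h1 κ hκ, ← Real.div_rpow hσ.le hκ.le, ← Real.rpow_natCast (κ / σ) 2,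
      ← Real.rpow_mul (by positivity), ← inv_div σ κ, Real.inv_rpow (by positivity),
      ← Real.rpow_neg (by positivity)]
    congr 1
    push_cast; ring
  -- The argument `-sinh² (r/2)` is negative, so `gaussF` is given by Pfaff's transformation: the
  -- prefactor is `cosh (r/2)`, the new argument `tanh² (r/2)`, and `c - b` reduces to `l`.
  rw [e1, e2, if_neg (by have := pow_pos hσ 2; linarith), e3, e4, e5,
    show (1 - -(1 / 2 + l) : ℝ) = l + 3 / 2 by ring, show (l + 3 / 2 - (1 / 2 + 1) : ℝ) = l by ring]
  generalize ordinaryHypergeometric (-(1 / 2) : ℝ) (l : ℝ) (l + 3 / 2) (σ ^ 2 / κ ^ 2) = F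
  rw [Real.sqrt_div zero_le_two, Real.sqrt_mul (by positivity), Real.sqrt_mul zero_le_two, mul_pow,
    mul_pow]
  have h2 : 0 < √π := Real.sqrt_pos.mpr Real.pi_pos
  have h3 : 0 < √σ := Real.sqrt_pos.mpr hσ
  have h4 : 0 < √κ := Real.sqrt_pos.mpr hκ
  have h5 := Real.sq_sqrt hσ.le
  have h6 := Real.sq_sqrt hκ.le
  field_simp
  rw [h5]
  ring

end HypFourier

namespace HypFourier
open Finset Real MeasureTheory

/-! ### Convergence of the Fourier coefficients of the partial sums -/

section Convergence

variable {r r' : ℝ}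

lemma one_lt_radialArg_of_mem_Ioc (hr : 0 < r) (hr' : 0 < r') {φ : ℝ} (hφ : φ ∈ Set.Ioc 0 π) :
    1 < radialArg r r' φ := by
  by_cases h : r = r'
  · subst h; exact one_lt_radialArg_self hr hφ
  · exact one_lt_radialArg hr hr' h φ

lemma intervalIntegrable_legQ_radialArg (hr : 0 < r) (hr' : 0 < r') (l : ℕ) :
    IntervalIntegrable (fun φ => legQ l (radialArg r r' φ)) volume 0 π := by
  by_cases h : r = r'
  · subst h
    have hS := Real.sinh_pos_iff.mpr hr
    rw [intervalIntegrable_iff_integrableOn_Ioc_of_le Real.pi_pos.le]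
    simp_rw [radialArg_self hr]
    exact integrableOn_legQ (by positivity) l
  · refine Continuous.intervalIntegrable ?_ _ _
    rw [← continuousOn_univ]
    exact (continuousOn_legQ l).comp (continuous_radialArg _ _).continuousOn
      fun φ _ => one_lt_radialArg hr hr' h φ

/-- The argument is smallest at `φ = 0`, where it still exceeds one for distinct radii; monotonicity
of `Q_N` and `legQ_add_le` then give a uniform geometric rate. -/
lemma exists_mul_integral_legQ_radialArg_le (hr : 0 < r) (hr' : 0 < r') (h : r ≠ r') :
    ∃ A q : ℝ, 0 ≤ q ∧ q < 1 ∧ ∀ N : ℕ, ∫ φ in (0 : ℝ)..π, legQ N (radialArg r r' φ) ≤ A * q ^ N := by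
  have hY := one_lt_radialArg hr hr' h 0
  refine ⟨π * legQ 0 (radialArg r r' 0), 2 / (radialArg r r' 0 + 1), by positivity,
    by rw [div_lt_one] <;> linarith, fun N => ?_⟩
  have hS := Real.sinh_pos_iff.mpr hr
  have hS' := Real.sinh_pos_iff.mpr hr'
  have hle : ∀ φ, radialArg r r' 0 ≤ radialArg r r' φ := fun φ => by
    unfold radialArg
    gcongr
    rw [Real.cos_zero]; exact Real.cos_le_one φ
  calc ∫ φ in (0 : ℝ)..π, legQ N (radialArg r r' φ) ≤ ∫ φ in (0 : ℝ)..π, legQ N (radialArg r r' 0) :=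
        intervalIntegral.integral_mono_on Real.pi_pos.le (intervalIntegrable_legQ_radialArg hr hr' N)
          (by simp) fun φ _ => legQ_anti hY (hle φ) N
    _ = π * legQ N (radialArg r r' 0) := by simp
    _ ≤ π * ((2 / (radialArg r r' 0 + 1)) ^ N * legQ 0 (radialArg r r' 0)) :=
        mul_le_mul_of_nonneg_left (legQ_add_le hY N 0) Real.pi_pos.le
    _ = _ := by ring

lemma integral_legQ_radialArg_nonneg (hr : 0 < r) (hr' : 0 < r') (l : ℕ) :
    0 ≤ ∫ φ in (0 : ℝ)..π, legQ l (radialArg r r' φ) := by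
  rw [intervalIntegral.integral_of_le Real.pi_pos.le]
  exact setIntegral_nonneg measurableSet_Ioc fun φ hφ =>
    legQ_nonneg (one_lt_radialArg_of_mem_Ioc hr hr' hφ) l

lemma tendsto_mul_integral_legQ_radialArg (hr : 0 < r) (hr' : 0 < r') (h : r ≠ r') :
    Filter.Tendsto (fun N : ℕ => (N + 1) * ∫ φ in (0 : ℝ)..π, legQ N (radialArg r r' φ))
      Filter.atTop (nhds 0) := by
  obtain ⟨A, q, hq0, hq1, hA⟩ := exists_mul_integral_legQ_radialArg_le hr hr' h
  have hlim : Filter.Tendsto (fun N : ℕ => A * (N * q ^ N + q ^ N)) Filter.atTop (nhds 0) := by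
    have := ((tendsto_self_mul_const_pow_of_lt_one hq0 hq1).add
      (tendsto_pow_atTop_nhds_zero_of_lt_one hq0 hq1)).const_mul A
    simpa using this
  refine squeeze_zero (fun N => mul_nonneg (by positivity) (integral_legQ_radialArg_nonneg hr hr' N))
    (fun N => ?_) hlim
  calc _ ≤ ((N : ℝ) + 1) * (A * q ^ N) := mul_le_mul_of_nonneg_left (hA N) (by positivity)
    _ = _ := by ring

lemma exists_mul_integral_legQ_radialArg_self_le (hr : 0 < r) :
    ∃ M : ℝ, ∀ N : ℕ, (N + 1) * ∫ φ in (0 : ℝ)..π, legQ N (radialArg r r φ) ≤ M := by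
  have hS := Real.sinh_pos_iff.mpr hr
  refine ⟨π ^ 3 / √(Real.sinh r ^ 2)⁻¹, fun N => ?_⟩
  have := setIntegral_legQ_le (k := (Real.sinh r ^ 2)⁻¹) (by positivity) N
  simp_rw [radialArg_self hr]
  rw [intervalIntegral.integral_of_le Real.pi_pos.le]
  rwa [le_div_iff₀ (by positivity), mul_comm] at this

/-- The fundamental solution as a function of the cosine `x` of the spherical distance. -/
noncomputable def kernelAt (r r' x : ℝ) : ℝ :=
  1 / π * ∫ φ in (0 : ℝ)..π,
    Real.cos φ / (Real.cosh r * Real.cosh r' - Real.sinh r * Real.sinh r' * x - Real.cos φ)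

/-- Integrates the Christoffel–Darboux remainder over `φ`, using `Q_{N+1} ≤ Q_N` and the bound `δ⁻¹`
for `|cos φ| / (c - cos φ)`. Keeping the factors `|P_N|` is essential when `r = r'`. -/
lemma abs_kernelAt_sub_sum_le (hr : 0 < r) (hr' : 0 < r') {x δ : ℝ} (hx : x ∈ Set.Icc (-1) 1)
    (hδ : 0 < δ) (h : 1 + δ ≤ Real.cosh r * Real.cosh r' - Real.sinh r * Real.sinh r' * x) (N : ℕ) :
    |kernelAt r r' x - ∑ l ∈ range (N + 1), (2 * l + 1) * radialCoeff l r r' * legP l x| ≤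
      (π * δ)⁻¹ * ((N + 1) * ∫ φ in (0 : ℝ)..π, legQ N (radialArg r r' φ)) *
        (|legP (N + 1) x| + |legP N x|) := by
  have hS := Real.sinh_pos_iff.mpr hr
  have hS' := Real.sinh_pos_iff.mpr hr'
  set C := Real.cosh r * Real.cosh r' - Real.sinh r * Real.sinh r' * x with hC
  have hCφ : ∀ φ, δ ≤ C - Real.cos φ := fun φ => by linarith [Real.cos_le_one φ]
  have hterm : ∀ l, IntervalIntegrable (fun φ => (2 * l + 1) * legP l x *
      (Real.cos φ / (Real.sinh r * Real.sinh r') * legQ l (radialArg r r' φ))) volume 0 π := fun l =>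
    ((intervalIntegrable_legQ_radialArg hr hr' l).continuousOn_mul
      (by fun_prop : Continuous fun φ => Real.cos φ /
        (Real.sinh r * Real.sinh r')).continuousOn).const_mul _
  have hker : IntervalIntegrable (fun φ => Real.cos φ / (C - Real.cos φ)) volume 0 π := by
    refine Continuous.intervalIntegrable (Continuous.div (by fun_prop) (by fun_prop) fun φ => ?_) _ _
    have := hCφ φ
    linarith
  have e : kernelAt r r' x - ∑ l ∈ range (N + 1), (2 * l + 1) * radialCoeff l r r' * legP l x =
      1 / π * ∫ φ in (0 : ℝ)..π, (Real.cos φ / (C - Real.cos φ) - ∑ l ∈ range (N + 1),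
        (2 * l + 1) * legP l x *
          (Real.cos φ / (Real.sinh r * Real.sinh r') * legQ l (radialArg r r' φ))) := by
    have hsum : IntervalIntegrable (fun φ => ∑ l ∈ range (N + 1), (2 * l + 1) * legP l x *
        (Real.cos φ / (Real.sinh r * Real.sinh r') * legQ l (radialArg r r' φ))) volume 0 π := by
      simpa only [Finset.sum_fn] using IntervalIntegrable.sum (range (N + 1)) fun l _ => hterm l
    rw [intervalIntegral.integral_sub hker hsum,
      intervalIntegral.integral_finsetSum fun l _ => hterm l, mul_sub, mul_sum, kernelAt]
    congr 1
    refine sum_congr rfl fun l _ => ?_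
    rw [intervalIntegral.integral_const_mul, radialCoeff]
    ring
  have hb : ∀ φ ∈ Set.Ioc 0 π, ‖Real.cos φ / (C - Real.cos φ) - ∑ l ∈ range (N + 1),
        (2 * l + 1) * legP l x *
          (Real.cos φ / (Real.sinh r * Real.sinh r') * legQ l (radialArg r r' φ))‖ ≤
      δ⁻¹ * (N + 1) * (|legP (N + 1) x| + |legP N x|) * legQ N (radialArg r r' φ) := by
    intro φ hφ
    have hY := one_lt_radialArg_of_mem_Ioc hr hr' hφ
    have hcd := christoffel_darboux_heine hY hx N
    have hYx : radialArg r r' φ - x = (C - Real.cos φ) / (Real.sinh r * Real.sinh r') := by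
      rw [radialArg, hC]; field_simp; ring
    have hD := hCφ φ
    have hD0 : 0 < C - Real.cos φ := by linarith
    have e1 : Real.cos φ / (C - Real.cos φ) - ∑ l ∈ range (N + 1),
        (2 * l + 1) * legP l x *
          (Real.cos φ / (Real.sinh r * Real.sinh r') * legQ l (radialArg r r' φ)) =
        Real.cos φ / (C - Real.cos φ) * ((N + 1) * (legP (N + 1) x * legQ N (radialArg r r' φ) -
          legP N x * legQ (N + 1) (radialArg r r' φ))) := by
      have e2 : ∑ l ∈ range (N + 1), (2 * l + 1) * legP l x *
          (Real.cos φ / (Real.sinh r * Real.sinh r') * legQ l (radialArg r r' φ)) =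
          Real.cos φ / (Real.sinh r * Real.sinh r') *
            ∑ l ∈ range (N + 1), (2 * l + 1) * legP l x * legQ l (radialArg r r' φ) := by
        rw [mul_sum]; exact sum_congr rfl fun l _ => by ring
      rw [← hcd, hYx, e2]
      field_simp
    have q0 := legQ_nonneg hY N
    have q1 := legQ_nonneg hY (N + 1)
    have q2 := legQ_succ_le hY N
    rw [e1, norm_mul, norm_mul, norm_div, Real.norm_of_nonneg hD0.le,
      Real.norm_of_nonneg (by positivity : (0 : ℝ) ≤ N + 1), Real.norm_eq_abs, Real.norm_eq_abs]
    have h3 : |Real.cos φ| / (C - Real.cos φ) ≤ δ⁻¹ := by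
      rw [← one_div]
      exact div_le_div₀ zero_le_one (Real.abs_cos_le_one φ) hδ hD
    have h4 : |legP (N + 1) x * legQ N (radialArg r r' φ) -
        legP N x * legQ (N + 1) (radialArg r r' φ)| ≤
        (|legP (N + 1) x| + |legP N x|) * legQ N (radialArg r r' φ) := by
      refine (abs_sub _ _).trans ?_
      rw [abs_mul, abs_mul, abs_of_nonneg q0, abs_of_nonneg q1, add_mul]
      gcongr
    calc _ ≤ δ⁻¹ * ((N + 1) * ((|legP (N + 1) x| + |legP N x|) * legQ N (radialArg r r' φ))) := by
          gcongr
      _ = _ := by ring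
  have hI := intervalIntegral.norm_integral_le_of_norm_le Real.pi_pos.le
    (Filter.Eventually.of_forall hb) ((intervalIntegrable_legQ_radialArg hr hr' N).const_mul _)
  rw [e, abs_mul, abs_of_pos (by positivity : 0 < 1 / π)]
  calc _ ≤ 1 / π * _ := mul_le_mul_of_nonneg_left hI (by positivity)
    _ = _ := by rw [intervalIntegral.integral_const_mul, mul_inv]; ring

lemma exists_pos_add_one_le_sub_mul_cosAngle {θ θ' : ℝ} (hr : 0 < r) (hr' : 0 < r')
    (hθ : θ ∈ Set.Icc 0 π) (hθ' : θ' ∈ Set.Icc 0 π) (hne : (r, θ) ≠ (r', θ')) :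
    ∃ δ > 0, ∀ ψ, 1 + δ ≤
      Real.cosh r * Real.cosh r' - Real.sinh r * Real.sinh r' * cosAngle θ θ' ψ := by
  have hS : 0 < Real.sinh r * Real.sinh r' :=
    mul_pos (Real.sinh_pos_iff.mpr hr) (Real.sinh_pos_iff.mpr hr')
  have h1 := Real.one_le_cosh (r - r')
  have h2 := Real.cos_le_one (θ - θ')
  have hs := mul_nonneg (Real.sin_nonneg_of_mem_Icc hθ) (Real.sin_nonneg_of_mem_Icc hθ')
  -- This is the value at `ψ = 0`, where `cos γ = cos (θ - θ')` is largest. It is positive because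
  -- the points differ in `r` or in `θ`.
  refine ⟨Real.cosh (r - r') - 1 + Real.sinh r * Real.sinh r' * (1 - Real.cos (θ - θ')), ?_,
    fun ψ => ?_⟩
  · by_cases h : r = r'
    · have hθne : θ ≠ θ' := fun h' => hne (by rw [h, h'])
      have : Real.cos (θ - θ') < 1 := by
        refine lt_of_le_of_ne h2 fun h0 => hθne ?_
        have := (Real.cos_eq_one_iff_of_lt_of_lt (by linarith [hθ.1, hθ'.2, Real.pi_pos])
          (by linarith [hθ.2, hθ'.1, Real.pi_pos])).mp h0
        linarith
      have := mul_pos hS (sub_pos.mpr this)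
      linarith
    · have := Real.one_lt_cosh.mpr (sub_ne_zero.mpr h)
      have := mul_nonneg hS.le (sub_nonneg.mpr h2)
      linarith
  · have h3 : cosAngle θ θ' ψ ≤ Real.cos (θ - θ') := by
      rw [cosAngle, Real.cos_sub]
      nlinarith [Real.cos_le_one ψ]
    have h4 := mul_le_mul_of_nonneg_left h3 hS.le
    rw [Real.cosh_sub]
    linarith

/-- The closed form `c / √(c² - 1) - 1` is used in place of the parametric integral. -/
lemma continuous_kernelAt_cosAngle {θ θ' : ℝ} (h : ∀ ψ, 1 <
      Real.cosh r * Real.cosh r' - Real.sinh r * Real.sinh r' * cosAngle θ θ' ψ) :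
    Continuous fun ψ => kernelAt r r' (cosAngle θ θ' ψ) := by
  have hc := continuous_cosAngle θ θ'
  simp_rw [kernelAt, fun ψ => integral_cos_div_sub_cos (h ψ)]
  refine continuous_const.mul (continuous_const.mul (Continuous.sub (Continuous.div (by fun_prop)
    (by fun_prop) fun ψ => ?_) continuous_const))
  have := h ψ
  exact (Real.sqrt_pos.mpr (by nlinarith)).ne'

lemma one_sub_cosAngle_sq (θ θ' ψ : ℝ) : 1 - cosAngle θ θ' ψ ^ 2 =
    (Real.sin θ * Real.cos θ' - Real.cos θ * Real.sin θ' * Real.cos ψ) ^ 2 +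
      (Real.sin θ' * Real.sin ψ) ^ 2 := by
  have h1 := Real.sin_sq_add_cos_sq θ
  have h2 := Real.sin_sq_add_cos_sq θ'
  have h3 := Real.sin_sq_add_cos_sq ψ
  rw [cosAngle]
  linear_combination (-Real.cos θ' ^ 2 - Real.sin θ' ^ 2 * Real.cos ψ ^ 2) * h1 - h2 -
    Real.sin θ' ^ 2 * h3

lemma cosAngle_comm (θ θ' ψ : ℝ) : cosAngle θ θ' ψ = cosAngle θ' θ ψ := by
  rw [cosAngle, cosAngle]; ring

/-- If one of the directions is off the axis, `|cos γ| < 1` for `0 < ψ < π`, so `P_N(cos γ) → 0`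
pointwise, with majorant one. -/
lemma tendsto_integral_abs_legP_cosAngle {θ θ' : ℝ} (h : Real.sin θ ≠ 0 ∨ Real.sin θ' ≠ 0) :
    Filter.Tendsto (fun N => ∫ ψ in (0 : ℝ)..π, |legP N (cosAngle θ θ' ψ)|) Filter.atTop
      (nhds 0) := by
  have key := intervalIntegral.tendsto_integral_filter_of_dominated_convergence (μ := volume)
    (a := 0) (b := π) (F := fun N ψ => |legP N (cosAngle θ θ' ψ)|) (f := fun _ => 0)
    (l := Filter.atTop) (fun _ => 1)
    (Filter.Eventually.of_forall fun N => Continuous.aestronglyMeasurable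
      ((continuous_legP N).comp (continuous_cosAngle θ θ')).abs)
    (Filter.Eventually.of_forall fun N => Filter.Eventually.of_forall fun ψ _ => by
      rw [Real.norm_eq_abs, abs_abs]; exact abs_legP_le_one N (cosAngle_mem_Icc θ θ' ψ))
    (by simp) ?_
  · simpa using key
  have hae : ∀ᵐ ψ : ℝ ∂volume, ψ ≠ π := by simp [ae_iff, measure_singleton]
  filter_upwards [hae] with ψ hψ hmem
  rw [Set.uIoc_of_le Real.pi_pos.le] at hmem
  have hsin : 0 < Real.sin ψ := Real.sin_pos_of_pos_of_lt_pi hmem.1 (lt_of_le_of_ne hmem.2 hψ)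
  have hx := cosAngle_mem_Icc θ θ' ψ
  have hpos : 0 < 1 - cosAngle θ θ' ψ ^ 2 := by
    rcases h with h | h
    · rw [cosAngle_comm, one_sub_cosAngle_sq]; positivity
    · rw [one_sub_cosAngle_sq]; positivity
  have h1 : Real.sin (Real.arccos (cosAngle θ θ' ψ)) ≠ 0 := by
    rw [Real.sin_arccos]; exact (Real.sqrt_pos.mpr hpos).ne'
  have h2 := (tendsto_legP_cos h1).abs
  rwa [Real.cos_arccos hx.1 hx.2, abs_zero] at h2

lemma tendsto_sum_radialCoeff {θ θ' : ℝ} (hr : 0 < r) (hr' : 0 < r')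
    (hθ : θ ∈ Set.Icc 0 π) (hθ' : θ' ∈ Set.Icc 0 π) (hne : (r, θ) ≠ (r', θ'))
    (h : r ≠ r' ∨ Real.sin θ ≠ 0 ∨ Real.sin θ' ≠ 0) (k : ℕ) :
    Filter.Tendsto (fun N : ℕ => ∑ l ∈ range (N + 1), (2 * l + 1) * radialCoeff l r r' *
        ∫ ψ in (0 : ℝ)..π, legP l (cosAngle θ θ' ψ) * Real.cos (k * ψ)) Filter.atTop
      (nhds (∫ ψ in (0 : ℝ)..π, kernelAt r r' (cosAngle θ θ' ψ) * Real.cos (k * ψ))) := by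
  obtain ⟨δ, hδ, hC⟩ := exists_pos_add_one_le_sub_mul_cosAngle hr hr' hθ hθ' hne
  have hK : Continuous fun ψ => kernelAt r r' (cosAngle θ θ' ψ) :=
    continuous_kernelAt_cosAngle fun ψ => by linarith [hC ψ]
  have hP : ∀ l, Continuous fun ψ => legP l (cosAngle θ θ' ψ) := fun l =>
    (continuous_legP l).comp (continuous_cosAngle θ θ')
  set M : ℕ → ℝ := fun N => (N + 1) * ∫ φ in (0 : ℝ)..π, legQ N (radialArg r r' φ) with hM
  set p : ℕ → ℝ := fun N => ∫ ψ in (0 : ℝ)..π, |legP N (cosAngle θ θ' ψ)| with hp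
  have hM0 : ∀ N, 0 ≤ M N := fun N =>
    mul_nonneg (by positivity) (integral_legQ_radialArg_nonneg hr hr' N)
  have hp0 : ∀ N, 0 ≤ p N := fun N =>
    intervalIntegral.integral_nonneg Real.pi_pos.le fun _ _ => abs_nonneg _
  have hpπ : ∀ N, p N ≤ π := fun N => by
    calc p N ≤ ∫ ψ in (0 : ℝ)..π, (1 : ℝ) :=
          intervalIntegral.integral_mono_on Real.pi_pos.le ((hP N).abs.intervalIntegrable _ _)
            (by simp) fun ψ _ => abs_legP_le_one N (cosAngle_mem_Icc θ θ' ψ)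
      _ = π := by simp
  have hlim : Filter.Tendsto (fun N => (π * δ)⁻¹ * M N * (p (N + 1) + p N)) Filter.atTop
      (nhds 0) := by
    have hpos : 0 < (π * δ)⁻¹ := by positivity
    -- For equal radii `M N` is only bounded and `p N` supplies the decay; for distinct radii `M N`
    -- tends to zero and `p N ≤ π` suffices.
    by_cases hrr : r = r'
    · have hs := h.resolve_left (not_not.mpr hrr)
      have hp1 := tendsto_integral_abs_legP_cosAngle hs
      obtain ⟨B, hB⟩ := exists_mul_integral_legQ_radialArg_self_le hr
      have hp2 : Filter.Tendsto (fun N => (π * δ)⁻¹ * B * (p (N + 1) + p N)) Filter.atTop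
          (nhds 0) := by
        have := (((Filter.tendsto_add_atTop_iff_nat 1).mpr hp1).add hp1).const_mul ((π * δ)⁻¹ * B)
        simpa using this
      refine squeeze_zero (fun N => ?_) (fun N => ?_) hp2
      · have := hM0 N; have := hp0 N; have := hp0 (N + 1); positivity
      · have := hp0 N; have := hp0 (N + 1)
        have hMB : M N ≤ B := by rw [hM, ← hrr]; exact hB N
        gcongr
    · have h1 : Filter.Tendsto (fun N => (π * δ)⁻¹ * M N * (π + π)) Filter.atTop (nhds 0) := by
        have := ((tendsto_mul_integral_legQ_radialArg hr hr' hrr).const_mul (π * δ)⁻¹).mul_const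
          (π + π)
        simpa using this
      refine squeeze_zero (fun N => ?_) (fun N => ?_) h1
      · have := hM0 N; have := hp0 N; have := hp0 (N + 1); positivity
      · have := hM0 N; have := hpπ N; have := hpπ (N + 1)
        gcongr
  rw [tendsto_iff_norm_sub_tendsto_zero]
  refine squeeze_zero (fun _ => norm_nonneg _) (fun N => ?_) hlim
  have hcos : Continuous fun ψ : ℝ => Real.cos (k * ψ) := by fun_prop
  have e : (∑ l ∈ range (N + 1), (2 * l + 1) * radialCoeff l r r' *
        ∫ ψ in (0 : ℝ)..π, legP l (cosAngle θ θ' ψ) * Real.cos (k * ψ)) -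
      ∫ ψ in (0 : ℝ)..π, kernelAt r r' (cosAngle θ θ' ψ) * Real.cos (k * ψ) =
      -∫ ψ in (0 : ℝ)..π, (kernelAt r r' (cosAngle θ θ' ψ) - ∑ l ∈ range (N + 1),
        (2 * l + 1) * radialCoeff l r r' * legP l (cosAngle θ θ' ψ)) * Real.cos (k * ψ) := by
    have c1 : Continuous fun ψ => kernelAt r r' (cosAngle θ θ' ψ) * Real.cos (k * ψ) := hK.mul hcos
    have c2 : ∀ l : ℕ, Continuous fun ψ => (2 * l + 1) * radialCoeff l r r' *
        legP l (cosAngle θ θ' ψ) * Real.cos (k * ψ) := fun l =>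
      (continuous_const.mul (hP l)).mul hcos
    have c3 : Continuous fun ψ => ∑ l ∈ range (N + 1), (2 * l + 1) * radialCoeff l r r' *
        legP l (cosAngle θ θ' ψ) * Real.cos (k * ψ) := continuous_finsetSum _ fun l _ => c2 l
    simp_rw [sub_mul, sum_mul]
    rw [intervalIntegral.integral_sub (c1.intervalIntegrable _ _) (c3.intervalIntegrable _ _),
      intervalIntegral.integral_finsetSum fun l _ => (c2 l).intervalIntegrable _ _, neg_sub]
    congr 1
    refine sum_congr rfl fun l _ => ?_
    rw [← intervalIntegral.integral_const_mul]
    exact intervalIntegral.integral_congr fun ψ _ => by ring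
  rw [e, norm_neg]
  have hb : ∀ ψ ∈ Set.Ioc 0 π, ‖(kernelAt r r' (cosAngle θ θ' ψ) - ∑ l ∈ range (N + 1),
        (2 * l + 1) * radialCoeff l r r' * legP l (cosAngle θ θ' ψ)) * Real.cos (k * ψ)‖ ≤
      (π * δ)⁻¹ * M N * (|legP (N + 1) (cosAngle θ θ' ψ)| + |legP N (cosAngle θ θ' ψ)|) := by
    intro ψ _
    rw [norm_mul, Real.norm_eq_abs, Real.norm_eq_abs]
    exact (mul_le_of_le_one_right (abs_nonneg _) (Real.abs_cos_le_one _)).trans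
      (abs_kernelAt_sub_sum_le hr hr' (cosAngle_mem_Icc θ θ' ψ) hδ (hC ψ) N)
  refine (intervalIntegral.norm_integral_le_of_norm_le Real.pi_pos.le
    (Filter.Eventually.of_forall hb) (Continuous.intervalIntegrable
      (continuous_const.mul ((hP (N + 1)).abs.add (hP N).abs)) _ _)).trans_eq ?_
  rw [intervalIntegral.integral_const_mul, intervalIntegral.integral_add
    ((hP (N + 1)).abs.intervalIntegrable _ _) ((hP N).abs.intervalIntegrable _ _)]

lemma integral_cos_nat_mul_eq_zero {k : ℕ} (hk : k ≠ 0) :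
    ∫ ψ in (0 : ℝ)..π, Real.cos (k * ψ) = 0 := by
  rw [intervalIntegral.integral_comp_mul_left (fun x => Real.cos x) (Nat.cast_ne_zero.mpr hk),
    integral_cos, mul_zero, Real.sin_zero, Real.sin_nat_mul_pi, sub_self, smul_zero]

/-- On the axis `cos γ` does not depend on `ψ`, so only the zeroth Fourier coefficient can be
nonzero. -/
lemma integral_comp_cosAngle_mul_cos_eq_zero {θ θ' : ℝ} (h : Real.sin θ = 0) (f : ℝ → ℝ) {k : ℕ}
    (hk : k ≠ 0) : ∫ ψ in (0 : ℝ)..π, f (cosAngle θ θ' ψ) * Real.cos (k * ψ) = 0 := by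
  have : ∀ ψ, cosAngle θ θ' ψ = Real.cos θ * Real.cos θ' := fun ψ => by
    rw [cosAngle, h]; ring
  simp_rw [this]
  rw [intervalIntegral.integral_const_mul, integral_cos_nat_mul_eq_zero hk, mul_zero]

end Convergence
end HypFourier

namespace HypFourier
open Finset Real MeasureTheory

/-! ### The addition theorem -/

/-- The summand is even in `m`: for negative order the squared factorial ratio from the two Ferrers
functions inverts the prefactor, and the signs cancel. -/
lemma factorial_div_mul_ferrers {l : ℕ} {m : ℤ} (h : m.natAbs ≤ l) (x x' : ℝ) :
    (((l : ℤ) - m).toNat.factorial : ℝ) / (((l : ℤ) + m).toNat.factorial : ℝ) *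
      ferrers l m x * ferrers l m x' =
    ((l - m.natAbs).factorial : ℝ) / ((l + m.natAbs).factorial : ℝ) *
      ferrersNat l m.natAbs x * ferrersNat l m.natAbs x' := by
  by_cases hm : 0 ≤ m
  · have h1 : ((l : ℤ) - m).toNat = l - m.natAbs := by omega
    have h2 : ((l : ℤ) + m).toNat = l + m.natAbs := by omega
    rw [ferrers, ferrers, if_pos hm, if_pos hm, h1, h2]
  · have h1 : ((l : ℤ) - m).toNat = l + m.natAbs := by omega
    have h2 : ((l : ℤ) + m).toNat = l - m.natAbs := by omega
    have h3 : ((-1 : ℝ) ^ m.natAbs) * (-1) ^ m.natAbs = 1 := by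
      rw [← mul_pow]; norm_num
    have h4 := Nat.factorial_ne_zero (l - m.natAbs)
    have h5 := Nat.factorial_ne_zero (l + m.natAbs)
    rw [ferrers, ferrers, if_neg hm, if_neg hm, h1, h2]
    field_simp
    linear_combination (ferrersNat l m.natAbs x * ferrersNat l m.natAbs x') * h3

lemma exp_I_mul_pi_mul_half_add (l : ℕ) :
    Complex.exp (Complex.I * π * ((1 / 2 + l : ℝ) : ℂ)) = Complex.I * (-1) ^ l := by
  rw [show Complex.I * π * ((1 / 2 + l : ℝ) : ℂ) = π / 2 * Complex.I + l * (π * Complex.I) by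
    push_cast; ring, Complex.exp_add, Complex.exp_pi_div_two_mul_I, Complex.exp_nat_mul,
    Complex.exp_pi_mul_I]

/-- The constants `√(2/π) / l!` and `l! / √(2π)` multiply to `1/π`, and the square roots of `sinh`
are symmetric in the radii. -/
lemma legendre_product_eq {r r' : ℝ} (hr : 0 < r) (hr' : 0 < r') (l : ℕ) :
    legendreFirst (1 / 2) (-(1 / 2 + l)) (Real.cosh (min r r')) *
      (l.factorial / (√(2 * π) * √(Real.sinh (max r r'))) * outerRadial l (max r r')) =
      √(Real.sinh r * Real.sinh r') * radialCoeff l r r' := by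
  have hS := Real.sinh_pos_iff.mpr hr
  have hS' := Real.sinh_pos_iff.mpr hr'
  have h1 := Nat.factorial_ne_zero l
  have hmm : √(Real.sinh (min r r')) * √(Real.sinh (max r r')) = √(Real.sinh r) * √(Real.sinh r') := by
    rcases le_total r r' with h | h
    · rw [min_eq_left h, max_eq_right h]
    · rw [min_eq_right h, max_eq_left h, mul_comm]
  have a1 : 0 < √(Real.sinh r) := Real.sqrt_pos.mpr hS
  have a2 : 0 < √(Real.sinh r') := Real.sqrt_pos.mpr hS'
  have a3 : 0 < √π := Real.sqrt_pos.mpr Real.pi_pos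
  have b1 := Real.sq_sqrt hS.le
  have b2 := Real.sq_sqrt hS'.le
  have b3 := Real.sq_sqrt Real.pi_pos.le
  rw [legendreFirst_half_eq (lt_min hr hr'), radialCoeff_eq l hr hr', Real.sqrt_div zero_le_two,
    Real.sqrt_mul zero_le_two, Real.sqrt_mul hS.le]
  calc _ = (innerRadial l (min r r') * outerRadial l (max r r')) / (√π ^ 2 *
        (√(Real.sinh (min r r')) * √(Real.sinh (max r r')))) := by field_simp
    _ = _ := by
      rw [hmm, b3]
      nth_rewrite 3 [← b1]
      nth_rewrite 3 [← b2]
      field_simp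

lemma smul_additionTerm_eq {m : ℤ} {r r' θ θ' : ℝ} (hr : 0 < r) (hr' : 0 < r')
    (hθ : θ ∈ Set.Icc 0 π) (hθ' : θ' ∈ Set.Icc 0 π) {l : ℕ} (h : m.natAbs ≤ l) :
    -Complex.I * (neumannFactor m : ℂ) / ((√(Real.sinh r * Real.sinh r') : ℝ) : ℂ) *
      additionTerm m r r' θ θ' l =
    ((neumannFactor m / π * ((2 * l + 1) * radialCoeff l r r' *
      ∫ ψ in (0 : ℝ)..π, legP l (cosAngle θ θ' ψ) * Real.cos (m.natAbs * ψ)) : ℝ) : ℂ) := by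
  have hS : 0 < √(Real.sinh r * Real.sinh r') :=
    Real.sqrt_pos.mpr (mul_pos (Real.sinh_pos_iff.mpr hr) (Real.sinh_pos_iff.mpr hr'))
  have hA := integral_legP_cosAngle_mul_cos l m.natAbs (Real.sin_nonneg_of_mem_Icc hθ)
    (Real.sin_nonneg_of_mem_Icc hθ')
  rw [if_pos h, ← factorial_div_mul_ferrers h] at hA
  -- The phase `e^{iπ(l+1/2)} = i (-1)^l` in `Q` is cancelled by `-i` and the sign `(-1)^l` of the
  -- series.
  have hI : -Complex.I * (Complex.I * (-1) ^ l) * (-1) ^ l = 1 := by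
    have h1 : ((-1 : ℂ) ^ l) * (-1) ^ l = 1 := by rw [← mul_pow]; norm_num
    linear_combination h1 - ((-1 : ℂ) ^ l) * (-1) ^ l * Complex.I_sq
  have hL : ((legendreFirst (1 / 2) (-(1 / 2 + l)) (Real.cosh (min r r')) : ℝ) : ℂ) *
      ((l.factorial / (√(2 * π) * √(Real.sinh (max r r'))) * outerRadial l (max r r') : ℝ) : ℂ) =
      ((√(Real.sinh r * Real.sinh r') : ℝ) : ℂ) * ((radialCoeff l r r' : ℝ) : ℂ) := by
    rw [← Complex.ofReal_mul, legendre_product_eq hr hr', Complex.ofReal_mul]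
  have hS' : ((√(Real.sinh r * Real.sinh r') : ℝ) : ℂ) ≠ 0 := by exact_mod_cast hS.ne'
  have hπ : (π : ℂ) ≠ 0 := by exact_mod_cast Real.pi_ne_zero
  rw [hA, additionTerm, legendreSecond_half_eq (lt_max_of_lt_left hr), exp_I_mul_pi_mul_half_add]
  generalize ((l.factorial / (√(2 * π) * √(Real.sinh (max r r'))) *
    outerRadial l (max r r') : ℝ) : ℂ) = X at hL ⊢
  generalize √(Real.sinh r * Real.sinh r') = S at hS' hL ⊢
  generalize ((((l : ℤ) - m).toNat.factorial : ℝ) / (((l : ℤ) + m).toNat.factorial : ℝ)) = w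
  generalize legendreFirst (1 / 2) (-(1 / 2 + l)) (Real.cosh (min r r')) = Y at hL ⊢
  push_cast
  field_simp
  linear_combination (neumannFactor m * (2 * l + 1) * (-Complex.I * (Complex.I * (-1) ^ l) *
    (-1) ^ l) * w * ferrers l m (Real.cos θ) *
    ferrers l m (Real.cos θ')) * hL + (neumannFactor m * (2 * l + 1) * w * ferrers l m (Real.cos θ) * ferrers l m (Real.cos θ') * S *
    radialCoeff l r r') * hI

lemma fourierIntegrand_eq {R r r' θ θ' : ℝ} (hR : 0 < R) (m : ℤ) {ψ : ℝ}
    (h : 1 < Real.cosh r * Real.cosh r' - Real.sinh r * Real.sinh r' * cosAngle θ θ' ψ) :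
    fourierIntegrand R m r r' θ θ' ψ =
      kernelAt r r' (cosAngle θ θ' ψ) * Real.cos (m.natAbs * ψ) := by
  rw [fourierIntegrand, unnormFundSol_geodesicPolar hR h, kernelAt]
  congr 1
  rcases Int.natAbs_eq m with hm | hm
  · rw [hm]; simp
  · rw [hm]; simp

lemma tendsto_sum_radialCoeff_of_ne {m : ℤ} {r r' θ θ' : ℝ} (hr : 0 < r) (hr' : 0 < r')
    (hθ : θ ∈ Set.Icc 0 π) (hθ' : θ' ∈ Set.Icc 0 π) (hne : (r, θ) ≠ (r', θ'))
    (hanti : m = 0 → r = r' → 0 < Real.sin θ ∨ 0 < Real.sin θ') :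
    Filter.Tendsto (fun N : ℕ => ∑ l ∈ range (N + 1), (2 * l + 1) * radialCoeff l r r' *
        ∫ ψ in (0 : ℝ)..π, legP l (cosAngle θ θ' ψ) * Real.cos (m.natAbs * ψ)) Filter.atTop
      (nhds (∫ ψ in (0 : ℝ)..π, kernelAt r r' (cosAngle θ θ' ψ) * Real.cos (m.natAbs * ψ))) := by
  by_cases h : r ≠ r' ∨ Real.sin θ ≠ 0 ∨ Real.sin θ' ≠ 0
  · exact tendsto_sum_radialCoeff hr hr' hθ hθ' hne h _
  · push Not at h
    -- In the exceptional configuration both sines vanish and the radii agree, so `hanti` excludes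
    -- `m = 0`. Every partial sum and the limit are then zero.
    have hm : m.natAbs ≠ 0 := fun h0 => by
      have := hanti (Int.natAbs_eq_zero.mp h0) h.1
      rw [h.2.1, h.2.2] at this
      simp at this
    have e : ∀ f : ℝ → ℝ, ∫ ψ in (0 : ℝ)..π, f (cosAngle θ θ' ψ) * Real.cos (m.natAbs * ψ) = 0 :=
      fun f => integral_comp_cosAngle_mul_cos_eq_zero h.2.1 f hm
    simp_rw [e (kernelAt r r'), fun l => e (legP l)]
    simp

end HypFourier

theorem mainTheorem3 (R : ℝ) (hR : 0 < R) (m : ℤ) (r r' θ θ' : ℝ)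
    (hr : 0 < r) (hr' : 0 < r')
    (hθ : θ ∈ Set.Icc 0 Real.pi) (hθ' : θ' ∈ Set.Icc 0 Real.pi)
    (hne : (r, θ) ≠ (r', θ'))
    (hanti : m = 0 → r = r' → 0 < Real.sin θ ∨ 0 < Real.sin θ') :
    IntervalIntegrable (HypFourier.fourierIntegrand R m r r' θ θ') MeasureTheory.volume
        0 Real.pi ∧
      Filter.Tendsto
        (fun N : ℕ =>
          -Complex.I * (HypFourier.neumannFactor m : ℂ) /
              ((Real.sqrt (Real.sinh r * Real.sinh r') : ℝ) : ℂ) *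
            ∑ l ∈ Finset.Icc m.natAbs N, HypFourier.additionTerm m r r' θ θ' l)
        Filter.atTop (nhds ((HypFourier.azimuthalCoeff R m r r' θ θ' : ℝ) : ℂ)) := by
  obtain ⟨δ, hδ, hC⟩ := HypFourier.exists_pos_add_one_le_sub_mul_cosAngle hr hr' hθ hθ' hne
  have hC1 : ∀ ψ, 1 < Real.cosh r * Real.cosh r' - Real.sinh r * Real.sinh r' *
      HypFourier.cosAngle θ θ' ψ := fun ψ => by linarith [hC ψ]
  have hF : HypFourier.fourierIntegrand R m r r' θ θ' = fun ψ =>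
      HypFourier.kernelAt r r' (HypFourier.cosAngle θ θ' ψ) * Real.cos (m.natAbs * ψ) :=
    funext fun ψ => HypFourier.fourierIntegrand_eq hR m (hC1 ψ)
  refine ⟨?_, ?_⟩
  · rw [hF]
    exact ((HypFourier.continuous_kernelAt_cosAngle hC1).mul (by fun_prop)).intervalIntegrable _ _
  · have hlim := (HypFourier.tendsto_sum_radialCoeff_of_ne hr hr' hθ hθ' hne hanti).const_mul
      (HypFourier.neumannFactor m / Real.pi)
    rw [HypFourier.azimuthalCoeff, hF]
    refine ((Complex.continuous_ofReal.tendsto _).comp hlim).congr fun N => ?_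
    rw [Function.comp_apply, Finset.mul_sum, Finset.mul_sum, Complex.ofReal_sum]
    symm
    rw [Finset.sum_congr rfl fun l hl =>
      HypFourier.smul_additionTerm_eq hr hr' hθ hθ' (Finset.mem_Icc.mp hl).1]
    -- The limit was proved for sums from `l = 0`; the terms with `l < |m|` vanish because `P_l(cos
    -- γ)` has no Fourier coefficient of order above `l`.
    refine Finset.sum_subset (fun l hl => ?_) fun l hl hl' => ?_
    · have := (Finset.mem_Icc.mp hl).2
      exact Finset.mem_range.mpr (by omega)
    · have h1 := Finset.mem_range.mp hl
      rw [Finset.mem_Icc] at hl'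
      rw [HypFourier.integral_legP_cosAngle_mul_cos l m.natAbs (Real.sin_nonneg_of_mem_Icc hθ)
        (Real.sin_nonneg_of_mem_Icc hθ'), if_neg (by omega), mul_zero, mul_zero, Complex.ofReal_zero]
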